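/- Let $\Lambda$ be a group with a finite generating set $S$, let $r=|S|$, and let $|\gamma|$ be the word length of $\gamma\in\Lambda$ with respect to $S$. Let $\lambda$ be the left regular representation of $\Lambda$ on $\ell^2(\Lambda)$, and let $\tau(a)=\langle\delta_e,a\delta_e\rangle$. For each $n\ge1$ let $\pi_n:\Lambda\to \mathrm{U}(n)$ be a random unitary representation, and let $\operatorname{tr}=\frac1n\operatorname{Tr}$ be the normalized trace on $\mathrm{M}_n(\mathbb{C})$. Let $C\ge1$ and let $u_k(\gamma)\in\mathbb{R}$ ($k\ge0$, $\gamma\in\Lambda$) be constants, with $u_k$ extended linearly to $\mathbb{C}[\Lambda]$, and suppose: 1. $u_0(\gamma)=\tau(\lambda(\gamma))$ for all $\gamma\in\Lambda$, and $$\Bigg|\mathbb{E}[\operatorname{tr}\pi_n(\gamma)]-\sum_{k=0}^{q-1}\frac{u_k(\gamma)}{n^k}\Bigg|\le\frac{(Cq)^{Cq}}{n^q}$$ for all $\gamma\in\Lambda$, integers $q\ge|\gamma|$ and $n\ge \max(1,Cq^C)$ (with $0^0=1$). 2. $\limsup_{p\to\infty}|u_1(y^p)|^{1/p}\le\|\lambda(y)\|$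 for every self-adjoint $y\in\mathbb{C}[\Lambda]$. Then for every $d$, every nonzero self-adjoint $x=\sum_\gamma A_\gamma\otimes\gamma\in \mathrm{M}_d(\mathbb{C})\otimes\mathbb{C}[\Lambda]$, every $n\ge1$ and every $\varepsilon>0$, $$\mathbb{P}\big[\|[\mathrm{id}\otimes\pi_n](x)\|\ge(1+\varepsilon)\|[\mathrm{id}\otimes\lambda](x)\|\big]\le\frac{c\,d}{n\,\varepsilon^{b}}.$$ Here the norms are operator norms, $b>0$ is a constant that depends only on $C$, and $c>0$ is a constant that depends only on $C$, $r$ and $|x|=\max\{|\gamma|:A_\gamma\ne0\}$. -/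

import Mathlib

open Filter MeasureTheory
open scoped ENNReal

noncomputable section

namespace StrongConv

/-- The word length `|γ|` of `γ` with respect to the generating set `S`: the least length of a word
in the letters `s`, `s⁻¹` (`s ∈ S`) that represents `γ`. -/
def wordLength {Λ : Type*} [Group Λ] (S : Finset Λ) (γ : Λ) : ℕ :=
  sInf {k : ℕ | ∃ w : List Λ, w.length = k ∧ (∀ s ∈ w, s ∈ S ∨ s⁻¹ ∈ S) ∧ w.prod = γ}

/-- `|x|`: the maximal word length of a group element in the support of `x`. This is used for
`R = M_d(ℂ)`, where `R[Λ] = M_d(ℂ) ⊗ ℂ[Λ]` is the algebra of finite sums `∑ A_γ ⊗ γ`. -/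
def supportLength {R Λ : Type*} [Semiring R] [Group Λ] (S : Finset Λ)
    (x : MonoidAlgebra R Λ) : ℕ :=
  x.coeff.support.sup (wordLength S)

/-- The involution `(∑ a_γ γ)^* = ∑ a_γ^* γ⁻¹` of the group algebra with coefficients in `R`
(used for `R = ℂ` and `R = M_d(ℂ)`). -/
def groupStar {R Λ : Type*} [Semiring R] [StarRing R] [Group Λ]
    (x : MonoidAlgebra R Λ) : MonoidAlgebra R Λ :=
  x.coeff.sum fun γ a => MonoidAlgebra.single γ⁻¹ (star a)

/-- The Hilbert space `ℓ²(Λ)`. -/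
abbrev Ell2 (Λ : Type*) : Type _ := lp (fun _ : Λ => ℂ) 2

theorem memlp_translate {Λ : Type*} [Group Λ] (γ : Λ) (f : Ell2 Λ) :
    Memℓp (fun y => (f : Λ → ℂ) (γ⁻¹ * y)) 2 := by
  have h := lp.memℓp f
  rw [memℓp_gen_iff (by norm_num)] at h ⊢
  exact h.comp_injective (mul_right_injective γ⁻¹)

/-- Left translation `[λ(γ) f](y) = f(γ⁻¹ y)` as a linear isometry of `ℓ²(Λ)`. -/
def translate {Λ : Type*} [Group Λ] (γ : Λ) : Ell2 Λ →ₗᵢ[ℂ] Ell2 Λ where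
  toFun f := ⟨fun y => (f : Λ → ℂ) (γ⁻¹ * y), memlp_translate γ f⟩
  map_add' _ _ := rfl
  map_smul' _ _ := rfl
  norm_map' f := by
    have h2 : 0 < (2 : ℝ≥0∞).toReal := by norm_num
    rw [lp.norm_eq_tsum_rpow h2, lp.norm_eq_tsum_rpow h2]
    congr 1
    exact (Equiv.mulLeft γ⁻¹).tsum_eq fun y => ‖(f : Λ → ℂ) y‖ ^ (2 : ℝ≥0∞).toReal

/-- The left regular representation `λ` of `Λ` on `ℓ²(Λ)`. -/
def leftRegular (Λ : Type*) [Group Λ] : Λ →* (Ell2 Λ →L[ℂ] Ell2 Λ) where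
  toFun γ := (translate γ).toContinuousLinearMap
  map_one' := by
    ext f y
    change (f : Λ → ℂ) ((1 : Λ)⁻¹ * y) = (f : Λ → ℂ) y
    simp
  map_mul' γ η := by
    ext f y
    change (f : Λ → ℂ) ((γ * η)⁻¹ * y) = (f : Λ → ℂ) (η⁻¹ * (γ⁻¹ * y))
    simp [mul_assoc]

open Classical in
/-- The canonical trace `τ(a) = ⟨δ_e, a δ_e⟩`. -/
def canonicalTrace {Λ : Type*} [Group Λ] (a : Ell2 Λ →L[ℂ] Ell2 Λ) : ℂ :=
  inner ℂ (lp.single 2 (1 : Λ) (1 : ℂ) : Ell2 Λ) (a (lp.single 2 (1 : Λ) (1 : ℂ)))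

/-- An `n`-dimensional unitary representation, viewed as acting by operators on Euclidean `ℂⁿ`. -/
def unitaryRep {Λ : Type*} [Group Λ] {n : ℕ} (ρ : Λ →* Matrix.unitaryGroup (Fin n) ℂ) :
    Λ →* (EuclideanSpace ℂ (Fin n) →L[ℂ] EuclideanSpace ℂ (Fin n)) where
  toFun γ := Matrix.toEuclideanCLM (n := Fin n) (𝕜 := ℂ) (ρ γ : Matrix (Fin n) (Fin n) ℂ)
  map_one' := by simp
  map_mul' γ η := by simp

/-- The operator `A ⊗ T` on the Hilbert space `ℂ^d ⊗ H = H^d` (with the `ℓ²` direct sum norm):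
`((A ⊗ T) v)_i = ∑_j A_{ij} T v_j`. -/
def matTensor {d : ℕ} {H : Type*} [NormedAddCommGroup H] [NormedSpace ℂ H]
    (A : Matrix (Fin d) (Fin d) ℂ) (T : H →L[ℂ] H) :
    PiLp 2 (fun _ : Fin d => H) →L[ℂ] PiLp 2 (fun _ : Fin d => H) :=
  ((PiLp.continuousLinearEquiv 2 ℂ (fun _ : Fin d => H)).symm :
      (Fin d → H) →L[ℂ] PiLp 2 (fun _ : Fin d => H)) ∘L
    ContinuousLinearMap.pi fun i =>
      ∑ j, A i j • (T ∘L PiLp.proj 2 (fun _ : Fin d => H) j)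

/-- `[id ⊗ ρ](x) = ∑_γ A_γ ⊗ ρ(γ)` for `x = ∑_γ A_γ ⊗ γ` in `M_d(ℂ) ⊗ ℂ[Λ]`. -/
def idTensor {d : ℕ} {Λ H : Type*} [Group Λ] [NormedAddCommGroup H] [NormedSpace ℂ H]
    (ρ : Λ →* (H →L[ℂ] H)) (x : MonoidAlgebra (Matrix (Fin d) (Fin d) ℂ) Λ) :
    PiLp 2 (fun _ : Fin d => H) →L[ℂ] PiLp 2 (fun _ : Fin d => H) :=
  x.coeff.sum fun γ A => matTensor A (ρ γ)

/-- The linear extension of a function `u : Λ → ℝ` to the group algebra `ℂ[Λ]`. -/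
def extendLinear {Λ : Type*} [Group Λ] (u : Λ → ℝ) (x : MonoidAlgebra ℂ Λ) : ℂ :=
  x.coeff.sum fun γ a => a * (u γ : ℂ)

/-- The effective `1/n`-expansion, with constant `C` and coefficients `u k γ`, of the expected
normalized traces `E[tr π_n(γ)]` of the random representations `π_n : Λ → U(n)`. -/
def EffectiveExpansion {Λ : Type*} [Group Λ] (S : Finset Λ) {Ω : ℕ → Type*}
    [∀ n, MeasurableSpace (Ω n)] (P : ∀ n, Measure (Ω n))
    (π : ∀ n, Ω n → (Λ →* Matrix.unitaryGroup (Fin n) ℂ)) (C : ℝ) (u : ℕ → Λ → ℝ) : Prop :=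
  (∀ γ : Λ, (u 0 γ : ℂ) = canonicalTrace (leftRegular Λ γ)) ∧
  ∀ (γ : Λ) (q n : ℕ), wordLength S γ ≤ q → 1 ≤ n → C * (q : ℝ) ^ C ≤ (n : ℝ) →
    ‖(∫ ω, (π n ω γ : Matrix (Fin n) (Fin n) ℂ).trace / (n : ℂ) ∂(P n)) -
        ∑ k ∈ Finset.range q, (u k γ : ℂ) / (n : ℂ) ^ k‖ ≤
      (C * q) ^ (C * q) / (n : ℝ) ^ q

/-- Temperedness: `limsup_p |u(x^p)|^{1/p} ≤ ‖λ(x)‖` for every self-adjoint `x ∈ ℂ[Λ]`. The limsup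
is taken in `[0, ∞]`. -/
def Tempered {Λ : Type*} [Group Λ] (u : Λ → ℝ) : Prop :=
  ∀ x : MonoidAlgebra ℂ Λ, groupStar x = x →
    limsup (fun p : ℕ => ‖extendLinear u (x ^ p)‖ₑ ^ (1 / (p : ℝ))) atTop ≤
      ‖MonoidAlgebra.lift ℂ (Ell2 Λ →L[ℂ] Ell2 Λ) Λ (leftRegular Λ) x‖ₑ

end StrongConv

end

/-! The proof is the polynomial method. Rescale `x` to `y` with `∑ ‖A_γ‖ ≤ 1`; then the eigenvalues
of `X_n = [id ⊗ π_n](y)` lie in `[-1, 1]`, and `s = ‖[id ⊗ λ](y)‖` is bounded below in terms of `r`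
and `|x|`. The event implies that `X_n` has an eigenvalue outside `[-s, s]` by a definite margin, so
by Markov's inequality it suffices to show `E Tr f(X_n) = O(d / n)` for a smooth cutoff `f`
vanishing on `[-s, s]`.

For a Chebyshev polynomial `T_j`, hypothesis 1 makes `E tr T_j(X_n)` nearly a polynomial in `1/n` of
degree `O(j)`. It is also bounded by `1`. Markov's inequality for derivatives of polynomials then
gives `E tr T_j(X_n) = U₀(T_j) + U₁(T_j)/n + O(j^E / n²)`, with coefficients that also grow at most
polynomially in `j` (`expansion_bound`, `poly_expansion`). The Chebyshev coefficients of a smooth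
function decay fast, so summation gives the same two-term expansion for smooth `f`
(`ExpansionData.abs_integral_sub_le`). The term `U₀` comes from the trace of the regular
representation, hence vanishes on the cutoff.

It remains to see that `U₁(f) = 0`. For scalar coefficients, temperedness bounds the moments
`U₁(X^p)` by nearly `s^p`, which excludes mass outside `[-s, s]` (`tendsto_sum_cutoff_of_moments`).
Temperedness says nothing directly about matrix coefficients. There the entries `w_ij` of `w = y^k`
are used: a vector on which every `1 ⊗ w_ij` is small is contracted by `X_n^k`, so a dimension count
bounds the number of large eigenvalues of `X_n` by those of the scalar elements `w_ij^* w_ij`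
(`card_eigs_le`). The expected number of the latter tends to zero. No rate is needed: `d U₁(f)` is
the limit of `E Tr f(X_n)`, so it vanishes, and the remainder in the expansion for `y` itself
supplies the rate `d / n` with the right constants (`integral_sum_cutoff_le`). -/

namespace StrongConv

/-! ### Markov inequalities and approximate polynomial expansions in `1/n` -/

section Markov

open Polynomial

/-- Markov's inequality for the derivative at the right endpoint of an interval. -/
theorem abs_derivative_eval_right_le {P : ℝ[X]} {n : ℕ} (hdeg : P.natDegree ≤ n) {a b M : ℝ}
    (hab : a < b) (hM : 0 < M) (hP : ∀ x ∈ Set.Icc a b, |P.eval x| ≤ M) :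
    |P.derivative.eval b| ≤ 2 * n ^ 2 * M / (b - a) := by
  have key : ∀ Q : ℝ[X], Q.natDegree ≤ n → (∀ x ∈ Set.Icc a b, |Q.eval x| ≤ M) →
      Q.derivative.eval b ≤ 2 * n ^ 2 * M / (b - a) := by
    intro Q hQ hb
    set ℓ : ℝ[X] := C ((b - a) / 2) * X + C ((a + b) / 2) with hℓ
    set R : ℝ[X] := C M⁻¹ * Q.comp ℓ with hR
    have hℓdeg : ℓ.natDegree ≤ 1 := by
      rw [hℓ]; compute_degree
    have hRdeg : R.degree ≤ n := by
      apply natDegree_le_iff_degree_le.mp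
      refine (natDegree_C_mul_le _ _).trans (natDegree_comp_le.trans ?_)
      calc Q.natDegree * ℓ.natDegree ≤ n * 1 := Nat.mul_le_mul hQ hℓdeg
        _ = n := mul_one n
    have h := Chebyshev.eval_iterate_derivative_le_of_forall_abs_le_one (k := 1) (x := 1) le_rfl
      hRdeg (fun x hx => by
        have hm : (b - a) / 2 * x + (a + b) / 2 ∈ Set.Icc a b := by
          constructor <;> nlinarith [hx.1, hx.2]
        have := hb _ hm
        simp only [hR, hℓ, eval_mul, eval_C, eval_comp, eval_add, eval_X, abs_mul,
          abs_inv, abs_of_pos hM]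
        rw [inv_mul_le_iff₀ hM]
        linarith)
    simp only [Function.iterate_one, Chebyshev.derivative_T_eval_one] at h
    have e : R.derivative.eval 1 = M⁻¹ * ((b - a) / 2 * Q.derivative.eval b) := by
      simp only [hR, hℓ, derivative_mul, derivative_C, derivative_comp, derivative_add,
        derivative_X, eval_mul, eval_add, eval_C, eval_X, eval_comp, eval_zero, eval_one]
      have : (b - a) / 2 * 1 + (a + b) / 2 = b := by ring
      rw [this]; ring
    rw [e, inv_mul_le_iff₀ hM] at h
    rw [le_div_iff₀ (by linarith)]
    push_cast at h
    nlinarith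
  rw [abs_le]
  constructor
  · have := key (-P) (by simpa using hdeg) (by simpa using hP)
    simp only [derivative_neg, eval_neg] at this
    linarith
  · exact key P hdeg hP

theorem abs_derivative_eval_left_le {P : ℝ[X]} {n : ℕ} (hdeg : P.natDegree ≤ n) {a b M : ℝ}
    (hab : a < b) (hM : 0 < M) (hP : ∀ x ∈ Set.Icc a b, |P.eval x| ≤ M) :
    |P.derivative.eval a| ≤ 2 * n ^ 2 * M / (b - a) := by
  have h := abs_derivative_eval_right_le (P := P.comp (-X)) (n := n) (a := -b) (b := -a) (M := M)
    (by
      refine natDegree_comp_le.trans ?_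
      simpa using hdeg) (by linarith) hM (fun x hx => by
        have := hP (-x) ⟨by linarith [hx.2], by linarith [hx.1]⟩
        simpa [eval_comp] using this)
  simp only [derivative_comp, derivative_neg, derivative_X, eval_mul, eval_neg, eval_one,
    eval_comp, eval_X, neg_neg, abs_mul, abs_neg, abs_one, one_mul] at h
  calc _ ≤ _ := h
    _ = _ := by ring

/-- Markov's inequality on an interval, up to a factor two. -/
theorem abs_derivative_eval_le {P : ℝ[X]} {n : ℕ} (hdeg : P.natDegree ≤ n) {δ M : ℝ}
    (hδ : 0 < δ) (hM : 0 < M) (hP : ∀ x ∈ Set.Icc 0 δ, |P.eval x| ≤ M) :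
    ∀ x ∈ Set.Icc 0 δ, |P.derivative.eval x| ≤ 4 * n ^ 2 * M / δ := by
  intro x hx
  -- Each point is an endpoint of a subinterval of length at least `δ / 2`, so the endpoint
  -- inequality loses only a factor two.
  rcases le_total (δ / 2) x with h | h
  · have := abs_derivative_eval_right_le hdeg (a := 0) (b := x) (by linarith) hM
      (fun y hy => hP y ⟨hy.1, hy.2.trans hx.2⟩)
    refine this.trans ?_
    rw [div_le_div_iff₀ (by linarith) hδ]
    have : 0 ≤ (n : ℝ) ^ 2 * M := by positivity
    nlinarith
  · have := abs_derivative_eval_left_le hdeg (a := x) (b := δ) (by linarith) hM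
      (fun y hy => hP y ⟨hx.1.trans hy.1, hy.2⟩)
    refine this.trans ?_
    rw [div_le_div_iff₀ (by linarith) hδ]
    have : 0 ≤ (n : ℝ) ^ 2 * M := by positivity
    nlinarith

theorem abs_eval_sub_eval_le {P : ℝ[X]} {δ M : ℝ}
    (hP : ∀ x ∈ Set.Icc 0 δ, |P.derivative.eval x| ≤ M) {x y : ℝ} (hx : x ∈ Set.Icc 0 δ)
    (hy : y ∈ Set.Icc 0 δ) : |P.eval y - P.eval x| ≤ M * |y - x| := by
  have := (convex_Icc (0 : ℝ) δ).norm_image_sub_le_of_norm_deriv_le (f := fun x => P.eval x)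
    (C := M) (fun z _ => P.differentiableAt) (fun z hz => by
      rw [Polynomial.deriv]; exact hP z hz) hx hy
  simpa [Real.norm_eq_abs] using this

/-- A polynomial bounded at the points `1 / n`, `n ≥ N`, is bounded on `[0, 1 / N]` when `N` is
large compared to the square of the degree. -/
theorem abs_eval_le_of_abs_eval_inv_le {P : ℝ[X]} {q N : ℕ} (hdeg : P.natDegree ≤ q)
    (hN : 1 ≤ N) (hqN : 8 * q ^ 2 ≤ N) {B : ℝ}
    (hP : ∀ n : ℕ, N ≤ n → |P.eval (1 / (n : ℝ))| ≤ B) :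
    ∀ x ∈ Set.Icc 0 (1 / (N : ℝ)), |P.eval x| ≤ 2 * B := by
  have hN0 : (0 : ℝ) < N := by exact_mod_cast hN
  have hδ : (0 : ℝ) < 1 / N := by positivity
  have hB : 0 ≤ B := (abs_nonneg _).trans (hP N le_rfl)
  obtain ⟨x₀, hx₀, hmax⟩ := isCompact_Icc.exists_isMaxOn (s := Set.Icc 0 (1 / (N : ℝ)))
    ⟨0, by simp⟩ (f := fun x => |P.eval x|) (by fun_prop)
  have hmax' : ∀ x ∈ Set.Icc 0 (1 / (N : ℝ)), |P.eval x| ≤ |P.eval x₀| := fun x hx => hmax hx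
  suffices h : |P.eval x₀| ≤ 2 * B from fun x hx => (hmax' x hx).trans h
  rcases (abs_nonneg (P.eval x₀)).eq_or_lt with hM | hM
  · rw [← hM]; linarith
  set M := |P.eval x₀| with hMdef
  have hd := abs_derivative_eval_le hdeg hδ hM hmax'
  -- If the maximum sits at `0`, which is not a sample point, it is a limit of sample values.
  rcases hx₀.1.eq_or_lt with h0 | h0
  · have : Tendsto (fun n : ℕ => |P.eval (1 / (n : ℝ))|) atTop (nhds |P.eval 0|) := by
      have h1 : Tendsto (fun n : ℕ => 1 / (n : ℝ)) atTop (nhds 0) :=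
        tendsto_one_div_atTop_nhds_zero_nat
      exact ((P.continuous.tendsto 0).comp h1).abs
    have h2 : |P.eval 0| ≤ B :=
      le_of_tendsto this (eventually_atTop.mpr ⟨N, fun n hn => hP n hn⟩)
    rw [hMdef, ← h0]; linarith
  -- The sample point `1/n` is within `1/N²` of the maximiser. The derivative bound is itself
  -- proportional to the maximum `M`, so moving there costs at most `4q²M/N ≤ M/2`, which is
  -- absorbed on the left.
  · set n := ⌊1 / x₀⌋₊ with hn
    have hx0N : (N : ℝ) ≤ 1 / x₀ := by
      rw [le_div_iff₀ h0]
      have := hx₀.2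
      rw [le_div_iff₀ hN0] at this
      linarith
    have hNn : N ≤ n := Nat.le_floor hx0N
    have hn0 : (0 : ℝ) < n := lt_of_lt_of_le hN0 (by exact_mod_cast hNn)
    have hNn' : (N : ℝ) ≤ n := by exact_mod_cast hNn
    have hle : (n : ℝ) ≤ 1 / x₀ := Nat.floor_le (by positivity)
    have hlt : 1 / x₀ < n + 1 := Nat.lt_floor_add_one _
    rw [le_div_iff₀ h0] at hle
    rw [div_lt_iff₀ h0] at hlt
    have hy : 1 / (n : ℝ) ∈ Set.Icc 0 (1 / (N : ℝ)) :=
      ⟨by positivity, one_div_le_one_div_of_le hN0 hNn'⟩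
    have hdist : |x₀ - 1 / (n : ℝ)| ≤ 1 / (N : ℝ) ^ 2 := by
      have e1 : x₀ ≤ 1 / n := by rw [le_div_iff₀ hn0]; linarith
      rw [abs_sub_comm, abs_of_nonneg (by linarith)]
      have e2 : 1 / (n : ℝ) - x₀ ≤ x₀ / n := by
        rw [sub_le_comm, ← sub_div, div_le_iff₀ hn0]
        linarith
      refine e2.trans ?_
      calc x₀ / n ≤ (1 / N) / N := by
            gcongr; exact hx₀.2
        _ = 1 / (N : ℝ) ^ 2 := by field_simp
    have h1 := abs_eval_sub_eval_le hd hy hx₀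
    have h2 := hP n hNn
    have h3 : |P.eval x₀| ≤ |P.eval (1 / (n : ℝ))| + |P.eval x₀ - P.eval (1 / (n : ℝ))| := by
      have := abs_add_le (P.eval (1 / (n : ℝ))) (P.eval x₀ - P.eval (1 / (n : ℝ)))
      simpa using this
    have h4 : 4 * (q : ℝ) ^ 2 * M / (1 / N) * |x₀ - 1 / (n : ℝ)| ≤ M / 2 := by
      have hq : 8 * (q : ℝ) ^ 2 ≤ N := by exact_mod_cast hqN
      calc 4 * (q : ℝ) ^ 2 * M / (1 / N) * |x₀ - 1 / (n : ℝ)|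
          ≤ 4 * (q : ℝ) ^ 2 * M / (1 / N) * (1 / (N : ℝ) ^ 2) := by gcongr
        _ = 4 * (q : ℝ) ^ 2 * M / N := by field_simp
        _ ≤ M / 2 := by
            rw [div_le_div_iff₀ hN0 two_pos]
            nlinarith
    linarith

theorem taylor_bound {P : ℝ[X]} {δ M : ℝ}
    (hP : ∀ x ∈ Set.Icc 0 δ, |P.derivative.derivative.eval x| ≤ M) {x : ℝ}
    (hx : x ∈ Set.Icc 0 δ) :
    |P.eval x - P.eval 0 - P.derivative.eval 0 * x| ≤ M * x ^ 2 := by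
  have hM : 0 ≤ M := (abs_nonneg _).trans (hP x hx)
  set R : ℝ[X] := P - C (P.derivative.eval 0) * X with hR
  have h1 : ∀ y ∈ Set.Icc 0 x, |R.derivative.eval y| ≤ M * x := by
    intro y hy
    have hyδ : y ∈ Set.Icc 0 δ := ⟨hy.1, hy.2.trans hx.2⟩
    have := abs_eval_sub_eval_le hP ⟨le_rfl, hx.1.trans hx.2⟩ hyδ
    simp only [hR, derivative_sub, derivative_mul, derivative_C, derivative_X, eval_sub,
      eval_C, zero_mul, zero_add, mul_one]
    refine this.trans ?_
    rw [sub_zero, abs_of_nonneg hy.1]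
    exact mul_le_mul_of_nonneg_left hy.2 hM
  have h2 := abs_eval_sub_eval_le h1 (x := 0) (y := x) ⟨le_rfl, hx.1⟩ ⟨hx.1, le_rfl⟩
  simp only [hR, eval_sub, eval_mul, eval_C, eval_X, mul_zero, sub_zero,
    abs_of_nonneg hx.1] at h2
  calc _ = |P.eval x - P.derivative.eval 0 * x - P.eval 0| := by congr 1; ring
    _ ≤ _ := h2
    _ = _ := by ring

/-- If bounded numbers `F n` have an approximate polynomial expansion in `1 / n` of degree `q`,
then the first two terms of the expansion are controlled polynomially. -/
theorem expansion_bound {F U : ℕ → ℝ} {q A : ℕ} (hq : 2 ≤ q) (hA : 1 ≤ A)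
    (hF : ∀ n : ℕ, 1 ≤ n → |F n| ≤ 1)
    (hFU : ∀ n : ℕ, A ≤ n → |F n - ∑ k ∈ Finset.range q, U k / (n : ℝ) ^ k| ≤ (A / n : ℝ) ^ q) :
    |U 0| ≤ 65 * (q : ℝ) ^ 4 * (A + 8 * q ^ 2 : ℝ) ^ 3 ∧
    |U 1| ≤ 65 * (q : ℝ) ^ 4 * (A + 8 * q ^ 2 : ℝ) ^ 3 ∧
    ∀ n : ℕ, 1 ≤ n →
      |F n - U 0 - U 1 / n| ≤ 65 * (q : ℝ) ^ 4 * (A + 8 * q ^ 2 : ℝ) ^ 3 / (n : ℝ) ^ 2 := by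
  -- From `N` on, the error `(A/n)^q` is at most `1`, and the sample points are dense enough to
  -- control a polynomial of degree `q`. The bound `4` on `[0, 1/N]` and two uses of Markov then
  -- give `16q²N` for the first derivative and `64q⁴N²` for the second.
  set N : ℕ := A + 8 * q ^ 2 with hN
  have hNr : ((A : ℝ) + 8 * (q : ℝ) ^ 2) = (N : ℝ) := by rw [hN]; push_cast; ring
  rw [hNr]
  have hN1 : 1 ≤ N := by omega
  have hN1r : (1 : ℝ) ≤ N := by exact_mod_cast hN1
  have hN0 : (0 : ℝ) < N := by linarith
  have hq1 : (1 : ℝ) ≤ q := by exact_mod_cast (by omega : 1 ≤ q)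
  have hAN : (A : ℝ) ≤ N := by exact_mod_cast (by omega : A ≤ N)
  set P : ℝ[X] := ∑ k ∈ Finset.range q, C (U k) * X ^ k with hPdef
  have hdeg : P.natDegree ≤ q := by
    refine natDegree_sum_le_of_forall_le _ _ fun k hk => ?_
    refine (natDegree_C_mul_X_pow_le _ _).trans (Finset.mem_range.mp hk).le
  have hPeval : ∀ n : ℕ, P.eval (1 / (n : ℝ)) = ∑ k ∈ Finset.range q, U k / (n : ℝ) ^ k := by
    intro n
    simp only [hPdef, eval_finsetSum, eval_mul, eval_C, eval_pow, eval_X]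
    refine Finset.sum_congr rfl fun k _ => ?_
    rw [one_div, inv_pow]; rfl
  have hcoeff : ∀ k, k < q → P.coeff k = U k := by
    intro k hk
    simp [hPdef, coeff_X_pow, hk]
  have hP0 : P.eval 0 = U 0 := by
    rw [← coeff_zero_eq_eval_zero, hcoeff 0 (by omega)]
  have hP1 : P.derivative.eval 0 = U 1 := by
    rw [← coeff_zero_eq_eval_zero, coeff_derivative, hcoeff 1 (by omega)]; simp
  have hB : ∀ n : ℕ, N ≤ n → |P.eval (1 / (n : ℝ))| ≤ 2 := by
    intro n hn
    have hn0 : (0 : ℝ) < n := lt_of_lt_of_le hN0 (by exact_mod_cast hn)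
    have h1 := hFU n (by omega)
    rw [← hPeval] at h1
    have h2 := hF n (by omega)
    have h3 : (A / n : ℝ) ^ q ≤ 1 := by
      refine pow_le_one₀ (by positivity) ?_
      rw [div_le_one hn0]
      exact hAN.trans (by exact_mod_cast hn)
    have h4 := abs_sub_abs_le_abs_sub (P.eval (1 / (n : ℝ))) (F n)
    rw [abs_sub_comm] at h4
    linarith
  have hδ : (0 : ℝ) < 1 / N := by positivity
  have hP4 := abs_eval_le_of_abs_eval_inv_le hdeg hN1 (by omega) hB
  have hP4' : ∀ x ∈ Set.Icc 0 (1 / (N : ℝ)), |P.eval x| ≤ 4 := fun x hx =>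
    (hP4 x hx).trans (by norm_num)
  have hd1 := abs_derivative_eval_le hdeg hδ (by norm_num) hP4'
  have hd2 := abs_derivative_eval_le ((natDegree_derivative_le P).trans (by omega : _ ≤ q)) hδ
    (by positivity) hd1
  have h0mem : (0 : ℝ) ∈ Set.Icc 0 (1 / (N : ℝ)) := ⟨le_rfl, hδ.le⟩
  have hU0 : |U 0| ≤ 4 := hP0 ▸ hP4' 0 h0mem
  have hU1 : |U 1| ≤ 16 * q ^ 2 * N := by
    have := hP1 ▸ hd1 0 h0mem
    refine this.trans (le_of_eq ?_)
    field_simp; ring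
  have hbig : 16 * (q : ℝ) ^ 2 * N ≤ 16 * (q : ℝ) ^ 4 * N ^ 3 := by
    have : (q : ℝ) ^ 2 ≤ (q : ℝ) ^ 4 := pow_le_pow_right₀ hq1 (by norm_num)
    have : (N : ℝ) ≤ (N : ℝ) ^ 3 := le_self_pow₀ hN1r (by norm_num)
    gcongr
  have hone : 1 ≤ (q : ℝ) ^ 4 * N ^ 3 :=
    one_le_mul_of_one_le_of_one_le (one_le_pow₀ hq1) (one_le_pow₀ hN1r)
  refine ⟨by linarith, by linarith, fun n hn => ?_⟩
  have hn0 : (0 : ℝ) < n := by exact_mod_cast hn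
  have hn1 : (1 : ℝ) ≤ n := by exact_mod_cast hn
  rw [le_div_iff₀ (by positivity)]
  rcases le_or_gt N n with h | h
  · have hNn : (N : ℝ) ≤ n := by exact_mod_cast h
    have h1 := hFU n (by omega)
    rw [← hPeval] at h1
    have h2 : (A / n : ℝ) ^ q ≤ (A / n : ℝ) ^ 2 := by
      refine pow_le_pow_of_le_one (by positivity) ?_ hq
      rw [div_le_one hn0]
      exact hAN.trans hNn
    have hx : 1 / (n : ℝ) ∈ Set.Icc 0 (1 / (N : ℝ)) :=
      ⟨by positivity, one_div_le_one_div_of_le hN0 hNn⟩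
    have h3 := taylor_bound hd2 hx
    rw [hP0, hP1] at h3
    have h4 : |F n - U 0 - U 1 / n| ≤ (A / n : ℝ) ^ 2 +
        4 * q ^ 2 * (4 * q ^ 2 * 4 / (1 / N)) / (1 / N) * (1 / (n : ℝ)) ^ 2 := by
      calc |F n - U 0 - U 1 / n| = |(F n - P.eval (1 / (n : ℝ))) +
            (P.eval (1 / (n : ℝ)) - U 0 - U 1 * (1 / n))| := by congr 1; ring
        _ ≤ _ := abs_add_le _ _
        _ ≤ _ := add_le_add (h1.trans h2) h3
    have h5 : |F n - U 0 - U 1 / n| * (n : ℝ) ^ 2 ≤ A ^ 2 + 64 * q ^ 4 * N ^ 2 := by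
      refine (mul_le_mul_of_nonneg_right h4 (by positivity)).trans (le_of_eq ?_)
      field_simp; ring
    have h6 : (A : ℝ) ^ 2 ≤ N ^ 2 := by gcongr
    have h7 : (N : ℝ) ^ 2 ≤ N ^ 3 := pow_le_pow_right₀ hN1r (by norm_num)
    have h8 : (N : ℝ) ^ 3 ≤ q ^ 4 * N ^ 3 := le_mul_of_one_le_left (by positivity)
      (one_le_pow₀ hq1)
    have h9 : 64 * (q : ℝ) ^ 4 * N ^ 2 ≤ 64 * q ^ 4 * N ^ 3 := by gcongr
    linarith
  -- For `n < N` there is nothing to expand: each term is bounded separately and `n² ≤ N²` pays for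
  -- it.
  · have hNn : (n : ℝ) ≤ N := by exact_mod_cast h.le
    have h1 : |F n - U 0 - U 1 / n| ≤ 1 + 4 + 16 * q ^ 2 * N := by
      have hU1n : |U 1 / n| ≤ 16 * q ^ 2 * N := by
        rw [abs_div, abs_of_pos hn0]
        exact (div_le_self (abs_nonneg _) hn1).trans hU1
      have := abs_sub (F n - U 0) (U 1 / n)
      have := abs_sub (F n) (U 0)
      have := hF n hn
      linarith
    have h2 : 1 + 4 + 16 * (q : ℝ) ^ 2 * N ≤ 21 * (q ^ 4 * N) := by
      have : (q : ℝ) ^ 2 ≤ (q : ℝ) ^ 4 := pow_le_pow_right₀ hq1 (by norm_num)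
      have h3 : 1 ≤ (q : ℝ) ^ 4 * N :=
        one_le_mul_of_one_le_of_one_le (one_le_pow₀ hq1) hN1r
      have : 16 * (q : ℝ) ^ 2 * N ≤ 16 * (q : ℝ) ^ 4 * N := by gcongr
      linarith
    calc |F n - U 0 - U 1 / n| * (n : ℝ) ^ 2 ≤ 21 * (q ^ 4 * N) * (N : ℝ) ^ 2 := by
          gcongr; exact h1.trans h2
      _ ≤ 65 * (q : ℝ) ^ 4 * N ^ 3 := by
          have : 0 ≤ (q : ℝ) ^ 4 * N ^ 3 := by positivity
          nlinarith

end Markov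

/-! ### Fourier coefficients of smooth periodic functions -/

section Fourier

open Real

/-- Smooth `2π`-periodic functions. -/
def SmoothPeriodic (f : ℝ → ℝ) : Prop :=
  ContDiff ℝ (⊤ : ℕ∞) f ∧ Function.Periodic f (2 * π)

namespace SmoothPeriodic

variable {f g : ℝ → ℝ}

theorem add (hf : SmoothPeriodic f) (hg : SmoothPeriodic g) :
    SmoothPeriodic (fun x => f x + g x) :=
  ⟨hf.1.add hg.1, fun x => congrArg₂ (· + ·) (hf.2 x) (hg.2 x)⟩

theorem mul (hf : SmoothPeriodic f) (hg : SmoothPeriodic g) :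
    SmoothPeriodic (fun x => f x * g x) :=
  ⟨hf.1.mul hg.1, fun x => congrArg₂ (· * ·) (hf.2 x) (hg.2 x)⟩

theorem pow (hf : SmoothPeriodic f) (p : ℕ) : SmoothPeriodic (fun x => f x ^ p) :=
  ⟨hf.1.pow p, fun x => congrArg (· ^ p) (hf.2 x)⟩

theorem const (c : ℝ) : SmoothPeriodic (fun _ => c) := ⟨contDiff_const, fun _ => rfl⟩

theorem sin : SmoothPeriodic Real.sin := ⟨Real.contDiff_sin, Real.sin_periodic⟩

theorem cos : SmoothPeriodic Real.cos := ⟨Real.contDiff_cos, Real.cos_periodic⟩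

theorem comp {ψ : ℝ → ℝ} (hψ : ContDiff ℝ (⊤ : ℕ∞) ψ) (hf : SmoothPeriodic f) :
    SmoothPeriodic (fun x => ψ (f x)) :=
  ⟨hψ.comp hf.1, fun x => congrArg ψ (hf.2 x)⟩

theorem differentiable (hf : SmoothPeriodic f) : Differentiable ℝ f :=
  hf.1.differentiable (by simp)

theorem deriv (hf : SmoothPeriodic f) : SmoothPeriodic (deriv f) := by
  refine ⟨?_, fun x => ?_⟩
  · exact (contDiff_infty_iff_deriv.mp hf.1).2
  · rw [← deriv_comp_add_const]
    congr 1
    funext y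
    exact hf.2 y

theorem bounded (hf : SmoothPeriodic f) : ∃ B, 0 ≤ B ∧ ∀ x, |f x| ≤ B := by
  obtain ⟨B, hB⟩ := isCompact_Icc.exists_bound_of_continuousOn (s := Set.Icc 0 (2 * π))
    hf.1.continuous.continuousOn
  refine ⟨B, (norm_nonneg _).trans (hB 0 ⟨le_rfl, by positivity⟩), fun x => ?_⟩
  obtain ⟨y, hy, hxy⟩ := hf.2.exists_mem_Ico₀ (by positivity) x
  rw [hxy]
  exact hB y ⟨hy.1, hy.2.le⟩

end SmoothPeriodic

theorem norm_fourierCoeffOn_le {f : ℝ → ℂ} {B : ℝ} (hB : ∀ x, ‖f x‖ ≤ B) (n : ℤ) :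
    ‖fourierCoeffOn two_pi_pos f n‖ ≤ B := by
  rw [fourierCoeffOn_eq_integral]
  have h := intervalIntegral.norm_integral_le_of_norm_le_const (a := 0) (b := 2 * π) (C := B)
    (f := fun x => fourier (T := 2 * π - 0) (-n) (x : AddCircle (2 * π - 0)) • f x) (fun x _ => by
      rw [norm_smul]
      have : ‖fourier (T := 2 * π - 0) (-n) (x : AddCircle (2 * π - 0))‖ = 1 := by
        rw [fourier_apply]; exact Circle.norm_coe _
      rw [this, one_mul]; exact hB x)
  rw [norm_smul]
  have hp : (0 : ℝ) < 2 * π := two_pi_pos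
  rw [sub_zero, abs_of_pos hp] at h
  rw [Real.norm_of_nonneg (by simp [pi_pos.le]), sub_zero, one_div, inv_mul_le_iff₀ hp]
  calc _ ≤ _ := h
    _ = _ := by ring

/-- Integration by parts; the boundary term vanishes by periodicity. -/
theorem norm_fourierCoeffOn_deriv {f : ℝ → ℝ} (hf : SmoothPeriodic f) {n : ℤ} (hn : n ≠ 0) :
    ‖fourierCoeffOn two_pi_pos (fun x => (f x : ℂ)) n‖ =
      ‖fourierCoeffOn two_pi_pos (fun x => ((deriv f x : ℝ) : ℂ)) n‖ / |(n : ℝ)| := by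
  rw [fourierCoeffOn_of_hasDerivAt two_pi_pos hn (f' := fun x => ((deriv f x : ℝ) : ℂ))
    (fun x _ => (hf.differentiable x).hasDerivAt.ofReal_comp)
    ((Complex.continuous_ofReal.comp hf.deriv.1.continuous).intervalIntegrable _ _)]
  have h0 : f (2 * π) = f 0 := by simpa using hf.2 0
  rw [h0, sub_self, mul_zero, zero_sub, norm_mul, norm_neg, norm_mul]
  have hn' : |(n : ℝ)| ≠ 0 := by simpa using hn
  have hp : (0 : ℝ) < π := pi_pos
  simp only [norm_div, norm_mul, norm_neg, norm_one, Complex.norm_I, Complex.norm_intCast,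
    Complex.norm_real, Complex.norm_two, Real.norm_eq_abs, abs_of_pos hp, sub_zero, Complex.ofReal_zero, Complex.ofReal_mul, Complex.ofReal_ofNat]
  field_simp

theorem norm_fourierCoeffOn_iteratedDeriv (m : ℕ) {n : ℤ} (hn : n ≠ 0) {f : ℝ → ℝ}
    (hf : SmoothPeriodic f) :
    ‖fourierCoeffOn two_pi_pos (fun x => (f x : ℂ)) n‖ =
      ‖fourierCoeffOn two_pi_pos (fun x => ((iteratedDeriv m f x : ℝ) : ℂ)) n‖ / |(n : ℝ)| ^ m := by
  induction m generalizing f with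
  | zero => simp
  | succ m ih =>
    rw [norm_fourierCoeffOn_deriv hf hn, ih hf.deriv, iteratedDeriv_succ', pow_succ, div_div]

theorem summable_int_inv_sq : Summable fun j : ℤ => 1 / (|(j : ℝ)| + 1) ^ 2 := by
  have h : Summable fun j : ℕ => 1 / ((j : ℝ) + 1) ^ 2 := by
    have := (summable_nat_add_iff 1).mpr (Real.summable_one_div_nat_pow.mpr one_lt_two)
    simpa using this
  refine Summable.of_nat_of_neg ?_ ?_ <;> simpa using h

/-- The series representation of a smooth even periodic function by cosines, with quantitative
control of the coefficients. -/
theorem exists_cosine_series (E : ℕ) : ∃ D : ℝ, 0 ≤ D ∧ ∀ (G : ℝ → ℝ) (B : ℝ), SmoothPeriodic G →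
    (∀ x, G (-x) = G x) → (∀ x, |G x| ≤ B) → (∀ x, |iteratedDeriv (E + 2) G x| ≤ B) →
    ∃ b : ℤ → ℝ, (∀ x, HasSum (fun j : ℤ => b j * Real.cos (j * x)) (G x)) ∧
      Summable (fun j : ℤ => |b j| * (|(j : ℝ)| + 1) ^ E) ∧
      ∑' j : ℤ, |b j| * (|(j : ℝ)| + 1) ^ E ≤ D * B := by
  refine ⟨2 ^ (E + 2) * ∑' j : ℤ, 1 / (|(j : ℝ)| + 1) ^ 2,
    mul_nonneg (by positivity) (tsum_nonneg fun j => by positivity), ?_⟩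
  intro G B hG heven hB hB'
  have hB0 : 0 ≤ B := (abs_nonneg _).trans (hB 0)
  set c : ℤ → ℂ := fun n => fourierCoeffOn two_pi_pos (fun x => (G x : ℂ)) n with hc
  -- Of the `E + 2` derivatives, `E` pay for the weight and two leave a summable `1/j²`. The factor
  -- `2 ^ (E + 2)` comes from `|j| + 1 ≤ 2|j|`.
  have hcb : ∀ j : ℤ, ‖c j‖ * (|(j : ℝ)| + 1) ^ E ≤
      2 ^ (E + 2) * B * (1 / (|(j : ℝ)| + 1) ^ 2) := by
    intro j
    by_cases hj : j = 0
    · subst hj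
      have h1 := norm_fourierCoeffOn_le (f := fun x => (G x : ℂ)) (B := B) (by simpa using hB) 0
      have h2 : (1 : ℝ) ≤ 2 ^ (E + 2) := one_le_pow₀ (by norm_num)
      simp only [Int.cast_zero, abs_zero, zero_add, one_pow, mul_one, div_one]
      nlinarith
    · have h1 : ‖c j‖ ≤ B / |(j : ℝ)| ^ (E + 2) := by
        rw [hc]
        simp only
        rw [norm_fourierCoeffOn_iteratedDeriv (E + 2) hj hG]
        gcongr
        exact norm_fourierCoeffOn_le (by simpa using hB') j
      have hj1 : (1 : ℝ) ≤ |(j : ℝ)| := by exact_mod_cast Int.one_le_abs hj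
      have hj0 : (0 : ℝ) < |(j : ℝ)| := by linarith
      have h2 : B / |(j : ℝ)| ^ (E + 2) ≤ 2 ^ (E + 2) * B / (|(j : ℝ)| + 1) ^ (E + 2) := by
        rw [div_le_div_iff₀ (by positivity) (by positivity)]
        have : (|(j : ℝ)| + 1) ^ (E + 2) ≤ 2 ^ (E + 2) * |(j : ℝ)| ^ (E + 2) := by
          rw [← mul_pow]
          exact pow_le_pow_left₀ (by positivity) (by linarith) _
        nlinarith
      calc ‖c j‖ * (|(j : ℝ)| + 1) ^ E
          ≤ 2 ^ (E + 2) * B / (|(j : ℝ)| + 1) ^ (E + 2) * (|(j : ℝ)| + 1) ^ E := by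
            gcongr; exact h1.trans h2
        _ = _ := by rw [pow_add (|(j : ℝ)| + 1)]; field_simp
  have hsum : Summable fun j : ℤ => ‖c j‖ * (|(j : ℝ)| + 1) ^ E :=
    Summable.of_nonneg_of_le (fun j => by positivity) hcb (summable_int_inv_sq.mul_left _)
  have hcsum : Summable c := by
    refine Summable.of_norm (Summable.of_nonneg_of_le (fun j => norm_nonneg _) (fun j => ?_) hsum)
    exact le_mul_of_one_le_right (norm_nonneg _)
      (one_le_pow₀ (by linarith [abs_nonneg (j : ℝ)]))
  have hle : ∀ j : ℤ, |(c j).re| * (|(j : ℝ)| + 1) ^ E ≤ ‖c j‖ * (|(j : ℝ)| + 1) ^ E :=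
    fun j => mul_le_mul_of_nonneg_right (Complex.abs_re_le_norm _) (by positivity)
  have hsum' : Summable fun j : ℤ => |(c j).re| * (|(j : ℝ)| + 1) ^ E :=
    Summable.of_nonneg_of_le (fun j => by positivity) hle hsum
  refine ⟨fun j => (c j).re, fun x => ?_, hsum', ?_⟩
  · have : Fact (0 < 2 * π) := ⟨two_pi_pos⟩
    have hper : Function.Periodic (fun x => (G x : ℂ)) (2 * π) := fun x => by
      simp only [hG.2 x]
    let f : C(AddCircle (2 * π), ℂ) := ⟨hper.lift,
      continuous_coinduced_dom.mpr (Complex.continuous_ofReal.comp hG.1.continuous)⟩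
    have hfc : fourierCoeff f = c := by
      funext n
      rw [fourierCoeff_eq_intervalIntegral _ _ 0, hc]
      simp only
      rw [fourierCoeffOn_eq_integral]
      have h0 : 2 * π - 0 = 2 * π := sub_zero _
      rw [h0]
      simp only [zero_add]
      rfl
    have hpt : ∀ y : ℝ, HasSum (fun j : ℤ => c j * Complex.exp (Complex.I * (j * y))) (G y) := by
      intro y
      have := has_pointwise_sum_fourier_series_of_summable (f := f) (by rw [hfc]; exact hcsum)
        (y : AddCircle (2 * π))
      rw [hfc] at this
      have e : f (y : AddCircle (2 * π)) = G y := rfl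
      rw [e] at this
      convert this using 2 with j
      rw [fourier_coe_apply, smul_eq_mul]
      congr 2
      have : (π : ℂ) ≠ 0 := by exact_mod_cast pi_pos.ne'
      push_cast
      field_simp
    -- Evenness of `G` allows averaging the series at `x` and `-x`, which turns exponentials into
    -- cosines; taking real parts then makes the coefficients real.
    have h1 := (hpt x).add (hpt (-x))
    rw [heven] at h1
    have h2 := (Complex.reCLM.hasSum h1).mul_left (1 / 2)
    have hval : 1 / 2 * Complex.reCLM ((G x : ℂ) + (G x : ℂ)) = G x := by
      simp only [map_add, Complex.reCLM_apply, Complex.ofReal_re]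
      ring
    have hfun : (fun j : ℤ => (c j).re * Real.cos (j * x)) = fun j : ℤ => 1 / 2 *
        Complex.reCLM (c j * Complex.exp (Complex.I * (j * x)) +
          c j * Complex.exp (Complex.I * (j * (-x : ℝ)))) := by
      funext j
      simp only [Complex.reCLM_apply]
      rw [← mul_add]
      have : Complex.exp (Complex.I * (j * x)) + Complex.exp (Complex.I * (j * (-x : ℝ))) =
          ((2 * Real.cos (j * x) : ℝ) : ℂ) := by
        push_cast
        rw [Complex.two_cos]
        congr 2 <;> ring
      rw [this, Complex.re_mul_ofReal]
      ring
    rw [hval] at h2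
    rw [hfun]
    exact h2
  · calc ∑' j : ℤ, |(c j).re| * (|(j : ℝ)| + 1) ^ E
        ≤ ∑' j : ℤ, 2 ^ (E + 2) * B * (1 / (|(j : ℝ)| + 1) ^ 2) :=
          hsum'.tsum_le_tsum (fun j => (hle j).trans (hcb j)) (summable_int_inv_sq.mul_left _)
      _ = _ := by rw [tsum_mul_left]; ring

/-- The function is locally constant off `[0, 1]`, and compactness handles `[0, 1]`. -/
theorem iteratedDeriv_smoothTransition_bounded (k : ℕ) :
    ∃ B, 0 ≤ B ∧ ∀ x, |iteratedDeriv k smoothTransition x| ≤ B := by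
  have hsm : ContDiff ℝ (⊤ : ℕ∞) smoothTransition := smoothTransition.contDiff
  have hcont : Continuous (iteratedDeriv k smoothTransition) :=
    hsm.continuous_iteratedDeriv k (by exact_mod_cast le_top)
  obtain ⟨B, hB⟩ := isCompact_Icc.exists_bound_of_continuousOn (s := Set.Icc 0 1)
    hcont.continuousOn
  have hcst : ∀ c x : ℝ, |iteratedDeriv k (fun _ : ℝ => c) x| ≤ |c| := by
    intro c x
    rw [iteratedDeriv_const]
    split_ifs <;> simp
  refine ⟨max B 1, by positivity, fun x => ?_⟩
  rcases lt_or_ge x 0 with h | h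
  · have : smoothTransition =ᶠ[nhds x] fun _ => (0 : ℝ) := by
      filter_upwards [Iio_mem_nhds h] with y hy
      exact smoothTransition.zero_of_nonpos (le_of_lt hy)
    rw [this.iteratedDeriv_eq]
    exact (hcst 0 x).trans (by simp)
  rcases lt_or_ge 1 x with h' | h'
  · have : smoothTransition =ᶠ[nhds x] fun _ => (1 : ℝ) := by
      filter_upwards [Ioi_mem_nhds h'] with y hy
      exact smoothTransition.one_of_one_le (le_of_lt hy)
    rw [this.iteratedDeriv_eq]
    exact (hcst 1 x).trans (by simp)
  · exact (hB x ⟨h, h'⟩).trans (le_max_left _ _)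

/-- The derivative is a sum of two functions of the same shape, one with `p'` and one with `ψ'` and
a factor `μ`. Hence the induction runs over all `p` and `ψ`, and each derivative costs one power of
`1 + μ`, uniformly in `a`. -/
theorem iteratedDeriv_mul_comp_bound (k : ℕ) : ∀ (p ψ : ℝ → ℝ), SmoothPeriodic p →
    ContDiff ℝ (⊤ : ℕ∞) ψ → (∀ m, ∃ B, 0 ≤ B ∧ ∀ x, |iteratedDeriv m ψ x| ≤ B) →
    ∃ D, 0 ≤ D ∧ ∀ μ, 0 ≤ μ → ∀ a x : ℝ,
      |iteratedDeriv k (fun x => p x * ψ (μ * (cos x ^ 2 - a))) x| ≤ D * (1 + μ) ^ k := by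
  induction k with
  | zero =>
    intro p ψ hp hψ hb
    obtain ⟨B₁, h₁, hB₁⟩ := hp.bounded
    obtain ⟨B₂, h₂, hB₂⟩ := hb 0
    refine ⟨B₁ * B₂, by positivity, fun μ hμ a x => ?_⟩
    simp only [iteratedDeriv_zero] at hB₂
    simp only [iteratedDeriv_zero, pow_zero, mul_one, abs_mul]
    exact mul_le_mul (hB₁ x) (hB₂ _) (abs_nonneg _) h₁
  | succ k ih =>
    intro p ψ hp hψ hb
    have hψ' : ContDiff ℝ (⊤ : ℕ∞) (deriv ψ) := (contDiff_infty_iff_deriv.mp hψ).2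
    obtain ⟨D₁, h₁, hD₁⟩ := ih (deriv p) ψ hp.deriv hψ hb
    have hq : SmoothPeriodic (fun x => p x * (-2 * (cos x * sin x))) :=
      hp.mul ((SmoothPeriodic.const (-2)).mul (SmoothPeriodic.cos.mul SmoothPeriodic.sin))
    obtain ⟨D₂, h₂, hD₂⟩ := ih _ (deriv ψ) hq hψ' (fun m => by
      obtain ⟨B, h, hB⟩ := hb (m + 1)
      exact ⟨B, h, fun x => by rw [← iteratedDeriv_succ']; exact hB x⟩)
    refine ⟨D₁ + D₂, by positivity, fun μ hμ a x => ?_⟩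
    have hu : SmoothPeriodic (fun x => μ * (cos x ^ 2 - a)) :=
      (SmoothPeriodic.const μ).mul ((SmoothPeriodic.cos.pow 2).add (SmoothPeriodic.const (-a)))
    have hder : deriv (fun x => p x * ψ (μ * (cos x ^ 2 - a))) = fun x =>
        deriv p x * ψ (μ * (cos x ^ 2 - a)) +
        μ * ((fun x => p x * (-2 * (cos x * sin x))) x * deriv ψ (μ * (cos x ^ 2 - a))) := by
      funext y
      have e1 : HasDerivAt (fun x => μ * (cos x ^ 2 - a)) (μ * (-2 * (cos y * sin y))) y := by
        refine ((((Real.hasDerivAt_cos y).pow 2).sub_const a).const_mul μ).congr_deriv ?_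
        norm_num [mul_assoc]
      have e2 := (hp.differentiable y).hasDerivAt.mul
        (((hψ.differentiable (by simp)) _).hasDerivAt.comp y e1)
      refine e2.deriv.trans ?_
      simp only [Function.comp]; ring
    have s1 : SmoothPeriodic (fun x => deriv p x * ψ (μ * (cos x ^ 2 - a))) :=
      hp.deriv.mul (hu.comp hψ)
    have s2 : SmoothPeriodic (fun x => (fun x => p x * (-2 * (cos x * sin x))) x *
        deriv ψ (μ * (cos x ^ 2 - a))) := hq.mul (hu.comp hψ')
    rw [iteratedDeriv_succ', hder, iteratedDeriv_fun_add
      (s1.1.contDiffAt.of_le (by exact_mod_cast le_top))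
      ((contDiff_const.mul s2.1).contDiffAt.of_le (by exact_mod_cast le_top)),
      iteratedDeriv_const_mul_field]
    refine (abs_add_le _ _).trans ?_
    rw [abs_mul, abs_of_nonneg hμ]
    have b1 := hD₁ μ hμ a x
    have b2 := hD₂ μ hμ a x
    have b3 : D₁ * (1 + μ) ^ k ≤ D₁ * (1 + μ) ^ (k + 1) := by
      gcongr
      · linarith
      · omega
    have b4 : μ * (D₂ * (1 + μ) ^ k) ≤ D₂ * (1 + μ) ^ (k + 1) := by
      rw [pow_succ]
      have : 0 ≤ D₂ * (1 + μ) ^ k := by positivity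
      nlinarith
    have b5 := mul_le_mul_of_nonneg_left b2 hμ
    linarith

/-- Differentiating `cos^p` costs a factor `p` and one power of the cosine, hence `p / s` on the
support of `g`. Derivatives of `g` keep the support condition, so the rate `s^p` survives. -/
theorem iteratedDeriv_mul_cos_pow_bound {s : ℝ} (hs : 0 < s) (k : ℕ) : ∀ g : ℝ → ℝ,
    SmoothPeriodic g → (∀ x, g x ≠ 0 → |cos x| ≤ s) →
    ∃ D, 0 ≤ D ∧ ∀ (p : ℕ) (x : ℝ),
      |iteratedDeriv k (fun x => g x * cos x ^ p) x| ≤ D * (p + 1 : ℝ) ^ k * s ^ p := by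
  induction k with
  | zero =>
    intro g hg hsupp
    obtain ⟨B, h, hB⟩ := hg.bounded
    refine ⟨B, h, fun p x => ?_⟩
    simp only [iteratedDeriv_zero, pow_zero, mul_one, abs_mul, abs_pow]
    by_cases hx : g x = 0
    · rw [hx, abs_zero, zero_mul]; positivity
    · exact mul_le_mul (hB x) (pow_le_pow_left₀ (abs_nonneg _) (hsupp x hx) p) (by positivity) h
  | succ k ih =>
    intro g hg hsupp
    have hsupp' : ∀ x, deriv g x ≠ 0 → |cos x| ≤ s := by
      intro x hx
      by_contra hcon
      push Not at hcon
      apply hx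
      have hopen : {y : ℝ | s < |cos y|} ∈ nhds x :=
        (isOpen_lt continuous_const (by fun_prop)).mem_nhds hcon
      have : g =ᶠ[nhds x] fun _ => (0 : ℝ) := by
        filter_upwards [hopen] with y hy
        by_contra h
        exact absurd (hsupp y h) (not_le.mpr hy)
      rw [this.deriv_eq]; simp
    obtain ⟨D₁, h₁, hD₁⟩ := ih (deriv g) hg.deriv hsupp'
    have hq : SmoothPeriodic (fun x => g x * (-1 * sin x)) :=
      hg.mul ((SmoothPeriodic.const (-1)).mul SmoothPeriodic.sin)
    obtain ⟨D₂, h₂, hD₂⟩ := ih _ hq (fun x hx => hsupp x (left_ne_zero_of_mul hx))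
    refine ⟨D₁ + D₂ / s, by positivity, fun p x => ?_⟩
    have hder : deriv (fun x => g x * cos x ^ p) = fun x => deriv g x * cos x ^ p +
        p * ((fun x => g x * (-1 * sin x)) x * cos x ^ (p - 1)) := by
      funext y
      have e2 := (hg.differentiable y).hasDerivAt.mul ((Real.hasDerivAt_cos y).pow p)
      refine e2.deriv.trans ?_
      simp only [Pi.pow_apply]; ring
    have s1 : SmoothPeriodic (fun x => deriv g x * cos x ^ p) :=
      hg.deriv.mul (SmoothPeriodic.cos.pow p)
    have s2 : SmoothPeriodic (fun x => (fun x => g x * (-1 * sin x)) x * cos x ^ (p - 1)) :=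
      hq.mul (SmoothPeriodic.cos.pow (p - 1))
    rw [iteratedDeriv_succ', hder, iteratedDeriv_fun_add
      (s1.1.contDiffAt.of_le (by exact_mod_cast le_top))
      ((contDiff_const.mul s2.1).contDiffAt.of_le (by exact_mod_cast le_top)),
      iteratedDeriv_const_mul_field]
    refine (abs_add_le _ _).trans ?_
    rw [abs_mul, Nat.abs_cast]
    have b1 := hD₁ p x
    have b2 := hD₂ (p - 1) x
    have b3 : D₁ * (p + 1 : ℝ) ^ k * s ^ p ≤ D₁ * (p + 1 : ℝ) ^ (k + 1) * s ^ p := by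
      gcongr
      · linarith [Nat.cast_nonneg (α := ℝ) p]
      · omega
    have b4 : (p : ℝ) * |iteratedDeriv k (fun x => (fun x => g x * (-1 * sin x)) x *
        cos x ^ (p - 1)) x| ≤ D₂ / s * (p + 1 : ℝ) ^ (k + 1) * s ^ p := by
      -- For `p = 0` the exponent `p - 1` is truncated, but the factor `p` kills the term.
      rcases p with _ | p
      · simp only [Nat.cast_zero, zero_mul]; positivity
      · simp only [Nat.add_sub_cancel] at b2 ⊢
        push_cast
        calc (p + 1 : ℝ) * _ ≤ (p + 1 : ℝ) * (D₂ * (p + 1) ^ k * s ^ p) := by gcongr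
          _ = D₂ * (p + 1) ^ (k + 1) * s ^ p := by ring
          _ ≤ D₂ * (p + 1 + 1) ^ (k + 1) * s ^ p := by gcongr; linarith
          _ = _ := by rw [pow_succ s]; field_simp
    linarith

end Fourier

/-! ### Smooth cutoffs and their Chebyshev series -/

section Cutoff

open Real Polynomial Chebyshev

/-- The smooth cutoff function of `t ^ 2` rising from `0` at `a` to `1` at `a + 1 / μ`. -/
noncomputable def cutoff (a μ t : ℝ) : ℝ := smoothTransition (μ * (t ^ 2 - a))

theorem cutoff_nonneg (a μ t : ℝ) : 0 ≤ cutoff a μ t := smoothTransition.nonneg _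

theorem cutoff_le_one (a μ t : ℝ) : cutoff a μ t ≤ 1 := smoothTransition.le_one _

theorem cutoff_eq_zero {a μ t : ℝ} (hμ : 0 ≤ μ) (h : t ^ 2 ≤ a) : cutoff a μ t = 0 :=
  smoothTransition.zero_of_nonpos (mul_nonpos_of_nonneg_of_nonpos hμ (by linarith))

theorem cutoff_eq_one {a μ t : ℝ} (hμ : 0 < μ) (h : a + 1 / μ ≤ t ^ 2) : cutoff a μ t = 1 := by
  refine smoothTransition.one_of_one_le ?_
  have : μ * (1 / μ) ≤ μ * (t ^ 2 - a) := by gcongr; linarith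
  rwa [mul_one_div_cancel hμ.ne'] at this

/-- The series `∑ b_j T_j` represents `f` on `[-1, 1]`, with a weighted bound on the
coefficients. -/
structure ChebyshevSeries (E : ℕ) (b : ℤ → ℝ) (f : ℝ → ℝ) (B : ℝ) : Prop where
  hasSum : ∀ t, |t| ≤ 1 → HasSum (fun j : ℤ => b j * (T ℝ j).eval t) (f t)
  summable : Summable (fun j : ℤ => |b j| * (|(j : ℝ)| + 1) ^ E)
  tsum_le : ∑' j : ℤ, |b j| * (|(j : ℝ)| + 1) ^ E ≤ B

/-- Under `t = cos θ` a Chebyshev series is a cosine series, because `T_j(cos θ) = cos(jθ)`. -/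
theorem exists_chebyshevSeries (E : ℕ) : ∃ D : ℝ, 0 ≤ D ∧ ∀ (f : ℝ → ℝ) (B : ℝ),
    SmoothPeriodic (fun x => f (cos x)) → (∀ x, |f (cos x)| ≤ B) →
    (∀ x, |iteratedDeriv (E + 2) (fun x => f (cos x)) x| ≤ B) →
    ∃ b : ℤ → ℝ, ChebyshevSeries E b f (D * B) := by
  obtain ⟨D, hD, h⟩ := exists_cosine_series E
  refine ⟨D, hD, fun f B hf hB hB' => ?_⟩
  obtain ⟨b, h1, h2, h3⟩ := h _ B hf (fun x => by rw [cos_neg]) hB hB'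
  refine ⟨b, fun t ht => ?_, h2, h3⟩
  have := h1 (arccos t)
  rw [abs_le] at ht
  rw [cos_arccos ht.1 ht.2] at this
  convert this using 2 with j
  rw [← T_real_cos, cos_arccos ht.1 ht.2]

theorem smoothPeriodic_cutoff (a μ : ℝ) : SmoothPeriodic (fun x => cutoff a μ (cos x)) := by
  have hu : SmoothPeriodic (fun x => μ * (cos x ^ 2 - a)) :=
    (SmoothPeriodic.const μ).mul ((SmoothPeriodic.cos.pow 2).add (SmoothPeriodic.const (-a)))
  exact @SmoothPeriodic.comp _ smoothTransition smoothTransition.contDiff hu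

theorem exists_chebyshevSeries_cutoff (E : ℕ) : ∃ D : ℝ, 0 ≤ D ∧ ∀ a μ : ℝ, 0 ≤ μ →
    ∃ b : ℤ → ℝ, ChebyshevSeries E b (cutoff a μ) (D * (1 + μ) ^ (E + 2)) := by
  obtain ⟨D, hD, h⟩ := exists_chebyshevSeries E
  obtain ⟨D', hD', h'⟩ := iteratedDeriv_mul_comp_bound (E + 2) (fun _ => 1) smoothTransition
    (SmoothPeriodic.const 1) smoothTransition.contDiff iteratedDeriv_smoothTransition_bounded
  refine ⟨D * max D' 1, by positivity, fun a μ hμ => ?_⟩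
  have h1 : 1 ≤ (1 + μ) ^ (E + 2) := one_le_pow₀ (by linarith)
  obtain ⟨b, hb⟩ := h (cutoff a μ) (max D' 1 * (1 + μ) ^ (E + 2)) (smoothPeriodic_cutoff a μ)
    (fun x => by
      rw [abs_of_nonneg (cutoff_nonneg _ _ _)]
      refine (cutoff_le_one _ _ _).trans (one_le_mul_of_one_le_of_one_le (le_max_right _ _) h1))
    (fun x => by
      have := h' μ hμ a x
      simp only [one_mul] at this
      refine this.trans ?_
      gcongr
      exact le_max_left _ _)
  exact ⟨b, by rwa [mul_assoc]⟩

/-- The factor `1 - cutoff` confines the monomial to `[-s, s]`, so its weighted coefficient sum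
grows only like `s^p` up to a polynomial in `p`. This is what makes large moments comparable with
the truncated ones. -/
theorem exists_chebyshevSeries_pow (E : ℕ) {a μ s : ℝ} (hμ : 0 < μ) (hs : 0 < s)
    (has : a + 1 / μ ≤ s ^ 2) : ∃ D : ℝ, 0 ≤ D ∧ ∀ p : ℕ,
    ∃ b : ℤ → ℝ, ChebyshevSeries E b (fun t => (1 - cutoff a μ t) * t ^ p)
      (D * (p + 1 : ℝ) ^ (E + 2) * s ^ p) := by
  obtain ⟨D, hD, h⟩ := exists_chebyshevSeries E
  have hg : SmoothPeriodic (fun x => 1 - cutoff a μ (cos x)) := by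
    have := (SmoothPeriodic.const 1).add
      ((SmoothPeriodic.const (-1)).mul (smoothPeriodic_cutoff a μ))
    convert this using 2
    ring
  have hsupp : ∀ x, 1 - cutoff a μ (cos x) ≠ 0 → |cos x| ≤ s := by
    intro x hx
    by_contra hcon
    push Not at hcon
    refine hx (sub_eq_zero.mpr (cutoff_eq_one hμ (has.trans ?_)).symm)
    rw [← sq_abs (cos x)]
    gcongr
  obtain ⟨D₁, h₁, hD₁⟩ := iteratedDeriv_mul_cos_pow_bound hs (E + 2) _ hg hsupp
  obtain ⟨D₂, h₂, hD₂⟩ := iteratedDeriv_mul_cos_pow_bound hs 0 _ hg hsupp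
  refine ⟨D * (D₁ + D₂), by positivity, fun p => ?_⟩
  obtain ⟨b, hb⟩ := h (fun t => (1 - cutoff a μ t) * t ^ p)
    ((D₁ + D₂) * (p + 1 : ℝ) ^ (E + 2) * s ^ p) (hg.mul (SmoothPeriodic.cos.pow p))
    (fun x => by
      have := hD₂ p x
      simp only [iteratedDeriv_zero] at this
      refine this.trans ?_
      gcongr
      · linarith
      · linarith [Nat.cast_nonneg (α := ℝ) p]
      · omega)
    (fun x => by
      refine (hD₁ p x).trans ?_
      gcongr
      linarith)
  exact ⟨b, by convert hb using 1; ring⟩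

end Cutoff

/-! ### Two-term expansions for smooth test functions -/

section Expansion

open Polynomial Chebyshev

/-- Random finite families `t n ω` of points in `[-1, 1]` (rescaled eigenvalues) whose averaged
moments have a two-term expansion in `1 / n` with coefficients `U₀`, `U₁`, where `U₀` is supported
in `[-s, s]`. -/
structure ExpansionData {Ω : ℕ → Type*} [∀ n, MeasurableSpace (Ω n)] (P : ∀ n, Measure (Ω n))
    (d : ℕ) (t : ∀ n, Ω n → Fin (d * n) → ℝ) (U₀ U₁ : ℝ[X] → ℝ) (s D : ℝ) (E : ℕ) : Prop where
  abs_le_one : ∀ n ω i, |t n ω i| ≤ 1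
  measurable : ∀ n (Q : ℝ[X]), Measurable fun ω => ∑ i, Q.eval (t n ω i)
  nonneg : 0 ≤ D
  bound₀ : ∀ j : ℤ, |U₀ (T ℝ j)| ≤ D * (|(j : ℝ)| + 1) ^ E
  bound₁ : ∀ j : ℤ, |U₁ (T ℝ j)| ≤ D * (|(j : ℝ)| + 1) ^ E
  expansion_T : ∀ (j : ℤ) (n : ℕ), 1 ≤ n →
    |(∫ ω, (∑ i, (T ℝ j).eval (t n ω i)) / (d * n : ℝ) ∂(P n)) - U₀ (T ℝ j) - U₁ (T ℝ j) / n| ≤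
      D * (|(j : ℝ)| + 1) ^ E / (n : ℝ) ^ 2
  expansion_pow : ∀ p : ℕ, ∃ D' : ℝ, ∀ n : ℕ, 1 ≤ n →
    |(∫ ω, (∑ i, (t n ω i) ^ p) / (d * n : ℝ) ∂(P n)) - U₀ (X ^ p) - U₁ (X ^ p) / n| ≤
      D' / (n : ℝ) ^ 2
  series₀ : ∀ (b : ℤ → ℝ) (Q : ℝ[X]), Summable (fun j => |b j|) →
    (∀ x, |x| ≤ s → HasSum (fun j : ℤ => b j * (T ℝ j).eval x) (Q.eval x)) →
    ∑' j, b j * U₀ (T ℝ j) = U₀ Q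

namespace ExpansionData

variable {Ω : ℕ → Type*} [∀ n, MeasurableSpace (Ω n)] {P : ∀ n, Measure (Ω n)}
  {d : ℕ} {t : ∀ n, Ω n → Fin (d * n) → ℝ}
  {U₀ U₁ : ℝ[X] → ℝ} {s D : ℝ} {E : ℕ}

theorem summable_abs {b : ℤ → ℝ} (hb : Summable (fun j : ℤ => |b j| * (|(j : ℝ)| + 1) ^ E)) :
    Summable (fun j => |b j|) :=
  Summable.of_nonneg_of_le (fun _ => abs_nonneg _) (fun j => le_mul_of_one_le_right (abs_nonneg _)
    (one_le_pow₀ (by linarith [abs_nonneg (j : ℝ)]))) hb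

theorem summable_mul {b : ℤ → ℝ} (hb : Summable (fun j : ℤ => |b j| * (|(j : ℝ)| + 1) ^ E))
    {V : ℤ → ℝ} (hV : ∀ j : ℤ, |V j| ≤ D * (|(j : ℝ)| + 1) ^ E) :
    Summable (fun j => b j * V j) := by
  refine Summable.of_norm_bounded (hb.mul_left D) fun j => ?_
  rw [Real.norm_eq_abs, abs_mul]
  calc |b j| * |V j| ≤ |b j| * (D * (|(j : ℝ)| + 1) ^ E) := by gcongr; exact hV j
    _ = _ := by ring

theorem abs_tsum_mul_le {b : ℤ → ℝ} (hb : Summable (fun j : ℤ => |b j| * (|(j : ℝ)| + 1) ^ E))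
    {V : ℤ → ℝ} {D : ℝ} (hV : ∀ j : ℤ, |V j| ≤ D * (|(j : ℝ)| + 1) ^ E) :
    |∑' j, b j * V j| ≤ D * ∑' j : ℤ, |b j| * (|(j : ℝ)| + 1) ^ E := by
  rw [← tsum_mul_left, ← Real.norm_eq_abs]
  refine tsum_of_norm_bounded (hb.mul_left D).hasSum fun j => ?_
  rw [Real.norm_eq_abs, abs_mul]
  calc |b j| * |V j| ≤ |b j| * (D * (|(j : ℝ)| + 1) ^ E) := by gcongr; exact hV j
    _ = _ := by ring

theorem abs_sum_le (H : ExpansionData P d t U₀ U₁ s D E) {n : ℕ} {ω : Ω n} {f : ℝ → ℝ} {c : ℝ}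
    (hf : ∀ x, |x| ≤ 1 → |f x| ≤ c) : |∑ i, f (t n ω i)| ≤ (d * n : ℕ) * c := by
  refine (Finset.abs_sum_le_sum_abs _ _).trans ?_
  refine (Finset.sum_le_card_nsmul _ _ c fun i _ => hf _ (H.abs_le_one n ω i)).trans ?_
  simp

/-- Neither `f` nor the individual points need be measurable: the sum is a pointwise series in the
measurable sums of `T_j`. -/
theorem measurable_sum (H : ExpansionData P d t U₀ U₁ s D E) {b : ℤ → ℝ} {f : ℝ → ℝ} {B : ℝ}
    (hf : ChebyshevSeries E b f B) (n : ℕ) : Measurable fun ω => ∑ i, f (t n ω i) := by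
  have h : (fun ω => ∑ i, f (t n ω i)) =
      fun ω => ∑' j : ℤ, b j * ∑ i, (T ℝ j).eval (t n ω i) := by
    funext ω
    have := hasSum_sum (s := Finset.univ) fun i _ => hf.hasSum _ (H.abs_le_one n ω i)
    simp_rw [← Finset.mul_sum] at this
    exact this.tsum_eq.symm
  rw [h]
  exact Measurable.tsum fun j => (H.measurable n _).const_mul _

theorem integral_nonneg_of (n : ℕ) {f : ℝ → ℝ} (hf : ∀ x, 0 ≤ f x) :
    0 ≤ ∫ ω, (∑ i, f (t n ω i)) / (d * n : ℝ) ∂(P n) :=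
  integral_nonneg fun ω => div_nonneg (Finset.sum_nonneg fun i _ => hf _) (by positivity)

/-- On `[-s, s]` the cutoff agrees with the polynomial `0`, and `series₀` sees only that interval.
-/
theorem series₀_cutoff (H : ExpansionData P d t U₀ U₁ s D E) (hU : U₀ 0 = 0) {a μ : ℝ}
    (hμ : 0 ≤ μ) (hs : s ≤ 1) (ha : s ^ 2 ≤ a) {b : ℤ → ℝ} {B : ℝ}
    (hb : ChebyshevSeries E b (cutoff a μ) B) : ∑' j, b j * U₀ (T ℝ j) = 0 := by
  rw [H.series₀ b 0 (summable_abs hb.summable) fun x hx => ?_, hU]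
  have h := hb.hasSum x (hx.trans hs)
  rwa [cutoff_eq_zero hμ, ← eval_zero (x := x)] at h
  refine le_trans ?_ ha
  rw [← sq_abs x]
  gcongr

variable [∀ n, IsProbabilityMeasure (P n)]

theorem integrable_sum (H : ExpansionData P d t U₀ U₁ s D E) {b : ℤ → ℝ} {f : ℝ → ℝ} {B : ℝ}
    (hf : ChebyshevSeries E b f B) (n : ℕ) : Integrable (fun ω => ∑ i, f (t n ω i)) (P n) := by
  refine Integrable.of_bound (H.measurable_sum hf n).aestronglyMeasurable
    ((d * n : ℕ) * ∑' j, |b j|) (ae_of_all _ fun ω => ?_)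
  rw [Real.norm_eq_abs]
  refine H.abs_sum_le fun x hx => ?_
  have hs := summable_abs hf.summable
  rw [← (hf.hasSum x hx).tsum_eq, ← Real.norm_eq_abs]
  refine tsum_of_norm_bounded hs.hasSum fun j => ?_
  rw [Real.norm_eq_abs, abs_mul]
  exact mul_le_of_le_one_right (abs_nonneg _) (abs_eval_T_real_le_one j hx)

theorem integrable_eval (H : ExpansionData P d t U₀ U₁ s D E) (Q : ℝ[X]) (n : ℕ) :
    Integrable (fun ω => ∑ i, Q.eval (t n ω i)) (P n) := by
  obtain ⟨c, hc⟩ := isCompact_Icc.exists_bound_of_continuousOn (s := Set.Icc (-1 : ℝ) 1)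
    (f := fun x => Q.eval x) (by fun_prop)
  refine Integrable.of_bound (H.measurable n Q).aestronglyMeasurable
    ((d * n : ℕ) * c) (ae_of_all _ fun ω => ?_)
  rw [Real.norm_eq_abs]
  exact H.abs_sum_le fun x hx => hc x (abs_le.mp hx)

/-- Sum and integral may be exchanged because `|T_j| ≤ 1` on `[-1, 1]` and the coefficients are
absolutely summable. -/
theorem integral_series (H : ExpansionData P d t U₀ U₁ s D E) {b : ℤ → ℝ} {f : ℝ → ℝ} {B : ℝ}
    (hf : ChebyshevSeries E b f B) (n : ℕ) :
    HasSum (fun j => b j * ∫ ω, (∑ i, (T ℝ j).eval (t n ω i)) / (d * n : ℝ) ∂(P n))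
      (∫ ω, (∑ i, f (t n ω i)) / (d * n : ℝ) ∂(P n)) := by
  have hint : ∀ j : ℤ, Integrable
      (fun ω => b j * ((∑ i, (T ℝ j).eval (t n ω i)) / (d * n : ℝ))) (P n) := fun j =>
    ((H.integrable_eval _ n).div_const _).const_mul _
  have hbd : ∀ (j : ℤ) (ω : Ω n), ‖(∑ i, (T ℝ j).eval (t n ω i)) / (d * n : ℝ)‖ ≤ 1 := by
    intro j ω
    have h0 : (0 : ℝ) ≤ (d : ℝ) * n := by positivity
    rw [norm_div, Real.norm_eq_abs, Real.norm_of_nonneg h0]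
    refine div_le_one_of_le₀ ?_ h0
    have := H.abs_sum_le (n := n) (ω := ω) (f := fun x => (T ℝ j).eval x) (c := 1)
      fun x hx => abs_eval_T_real_le_one j hx
    simpa using this
  have h := hasSum_integral_of_summable_integral_norm (μ := P n) hint (by
    refine Summable.of_nonneg_of_le (fun j => integral_nonneg fun ω => norm_nonneg _)
      (fun j => ?_) (summable_abs hf.summable)
    have h1 := integral_mono_of_nonneg (μ := P n) (ae_of_all _ fun ω => norm_nonneg
      (b j * ((∑ i, (T ℝ j).eval (t n ω i)) / (d * n : ℝ)))) (integrable_const |b j|)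
      (ae_of_all _ fun ω => by
        simp only [norm_mul, Real.norm_eq_abs (b j)]
        exact mul_le_of_le_one_right (abs_nonneg _) (hbd j ω))
    simpa using h1)
  have e1 : ∫ ω, (∑ i, f (t n ω i)) / (d * n : ℝ) ∂(P n) =
      ∫ ω, ∑' j : ℤ, b j * ((∑ i, (T ℝ j).eval (t n ω i)) / (d * n : ℝ)) ∂(P n) := by
    refine integral_congr_ae (ae_of_all _ fun ω => ?_)
    have := (hasSum_sum (s := Finset.univ) fun i _ =>
      hf.hasSum _ (H.abs_le_one n ω i)).div_const (d * n : ℝ)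
    simp_rw [← Finset.mul_sum, mul_div_assoc] at this
    exact this.tsum_eq.symm
  rw [e1]
  simp_rw [integral_const_mul] at h
  exact h

/-- The expansions of the `T_j` are added with weights `b_j`; their errors grow like `(|j| + 1)^E`,
exactly the weight built into `ChebyshevSeries`. -/
theorem abs_integral_sub_le (H : ExpansionData P d t U₀ U₁ s D E) {b : ℤ → ℝ} {f : ℝ → ℝ} {B : ℝ}
    (hf : ChebyshevSeries E b f B) {n : ℕ} (hn : 1 ≤ n) :
    |(∫ ω, (∑ i, f (t n ω i)) / (d * n : ℝ) ∂(P n)) - ∑' j, b j * U₀ (T ℝ j) -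
      (∑' j, b j * U₁ (T ℝ j)) / n| ≤ D * B / (n : ℝ) ^ 2 := by
  have hn0 : (0 : ℝ) < n := by exact_mod_cast hn
  have h0 := (summable_mul hf.summable H.bound₀).hasSum
  have h1 := ((summable_mul hf.summable H.bound₁).hasSum).div_const (n : ℝ)
  have h := ((H.integral_series hf n).sub h0).sub h1
  have heq : ∀ j : ℤ, b j * (∫ ω, (∑ i, (T ℝ j).eval (t n ω i)) / (d * n : ℝ) ∂(P n)) -
      b j * U₀ (T ℝ j) - b j * U₁ (T ℝ j) / n = b j *
      ((∫ ω, (∑ i, (T ℝ j).eval (t n ω i)) / (d * n : ℝ) ∂(P n)) - U₀ (T ℝ j) -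
        U₁ (T ℝ j) / n) := fun j => by ring
  simp_rw [heq] at h
  rw [← h.tsum_eq]
  have hV : ∀ j : ℤ, |(∫ ω, (∑ i, (T ℝ j).eval (t n ω i)) / (d * n : ℝ) ∂(P n)) - U₀ (T ℝ j) -
        U₁ (T ℝ j) / n| ≤ D / (n : ℝ) ^ 2 * (|(j : ℝ)| + 1) ^ E := fun j => by
    refine (H.expansion_T j n hn).trans (le_of_eq ?_); ring
  refine (abs_tsum_mul_le hf.summable hV).trans ?_
  have hD := H.nonneg
  rw [div_mul_eq_mul_div]
  gcongr
  exact hf.tsum_le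

/-- `n` times the averaged integral converges to the first-order coefficient when the zeroth-order
coefficient vanishes. -/
theorem tendsto_mul_integral (H : ExpansionData P d t U₀ U₁ s D E) {b : ℤ → ℝ} {f : ℝ → ℝ} {B : ℝ}
    (hf : ChebyshevSeries E b f B) (h0 : ∑' j, b j * U₀ (T ℝ j) = 0) :
    Tendsto (fun n : ℕ => (n : ℝ) * ∫ ω, (∑ i, f (t n ω i)) / (d * n : ℝ) ∂(P n)) atTop
      (nhds (∑' j, b j * U₁ (T ℝ j))) := by
  rw [tendsto_iff_norm_sub_tendsto_zero]
  refine squeeze_zero' (Eventually.of_forall fun _ => norm_nonneg _) (g := fun n : ℕ => D * B / n)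
    ?_ (tendsto_const_div_atTop_nhds_zero_nat _)
  filter_upwards [eventually_ge_atTop 1] with n hn
  have hn0 : (0 : ℝ) < n := by exact_mod_cast hn
  have h := H.abs_integral_sub_le hf hn
  rw [h0, sub_zero] at h
  rw [Real.norm_eq_abs]
  calc _ = (n : ℝ) * |(∫ ω, (∑ i, f (t n ω i)) / (d * n : ℝ) ∂(P n)) -
      (∑' j, b j * U₁ (T ℝ j)) / n| := by
        rw [← abs_of_pos hn0, ← abs_mul, abs_of_pos hn0, mul_sub, mul_div_cancel₀ _ hn0.ne']
    _ ≤ n * (D * B / (n : ℝ) ^ 2) := by gcongr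
    _ = _ := by field_simp

/-- Above the support of the zeroth-order term, the first-order term vanishes if its moments have
the right growth. -/
theorem tendsto_sum_cutoff_of_moments (H : ExpansionData P d t U₀ U₁ s D E) (hU : U₀ 0 = 0)
    (hs : s ≤ 1) (hmom : ∀ s', s < s' → ∀ᶠ p : ℕ in atTop, |U₁ (X ^ p)| ≤ s' ^ p)
    {a μ : ℝ} (hμ : 0 ≤ μ) (ha : s ^ 2 < a) :
    Tendsto (fun n : ℕ => ∫ ω, ∑ i, cutoff a μ (t n ω i) ∂(P n)) atTop (nhds 0) := by
  obtain ⟨Dc, hDc, hcut⟩ := exists_chebyshevSeries_cutoff E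
  obtain ⟨b, hb⟩ := hcut a μ hμ
  have hb0 := H.series₀_cutoff hU hμ hs ha.le hb
  have hlim := H.tendsto_mul_integral hb hb0
  set ν := ∑' j, b j * U₁ (T ℝ j) with hν
  have hν0 : 0 ≤ ν := ge_of_tendsto' hlim fun n =>
    mul_nonneg (Nat.cast_nonneg n) (integral_nonneg_of n (cutoff_nonneg a μ))
  -- an intermediate level between `s` and `√a`
  have ha0 : 0 < a := lt_of_le_of_lt (sq_nonneg s) ha
  obtain ⟨a₀, ha₀, ha₀'⟩ := exists_between ha
  obtain ⟨a₁, ha₁, ha₁'⟩ := exists_between ha₀'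
  have ha₁0 : 0 < a₁ := by linarith [sq_nonneg s]
  set σ := Real.sqrt a₁ with hσ
  have hσ0 : 0 < σ := Real.sqrt_pos.mpr ha₁0
  have hσ2 : σ ^ 2 = a₁ := Real.sq_sqrt ha₁0.le
  have hsσ : s < σ := by
    refine lt_of_pow_lt_pow_left₀ 2 hσ0.le ?_
    rw [hσ2]; linarith
  set μ₀ := 1 / (a₁ - a₀) with hμ₀
  have hμ₀0 : 0 < μ₀ := by rw [hμ₀]; exact one_div_pos.mpr (by linarith)
  have hlev : a₀ + 1 / μ₀ = a₁ := by rw [hμ₀, one_div_one_div]; ring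
  obtain ⟨Dp, hDp, hpow⟩ := exists_chebyshevSeries_pow E hμ₀0 hσ0 (by rw [hlev, hσ2])
  -- Write `cutoff a μ ≤ a⁻ᵖ x²ᵖ cutoff a₀ μ₀`. The first-order term of the right side is
  -- `a⁻ᵖ(U₁(X²ᵖ) - V)`, where `V` belongs to the truncated monomial. Both parts will grow at most
  -- like `σ²ᵖ` up to a polynomial, and `σ² = a₁ < a`.
  have key : ∀ p : ℕ, ν ≤ (a⁻¹) ^ p * (|U₁ (X ^ (2 * p))| +
      D * (Dp * ((2 * p : ℕ) + 1 : ℝ) ^ (E + 2) * σ ^ (2 * p))) := by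
    intro p
    obtain ⟨b', hb'⟩ := hpow (2 * p)
    -- The truncated and the full monomial agree on `[-s, s]`, so the zeroth-order terms cancel in
    -- the difference.
    have hb'0 : ∑' j, b' j * U₀ (T ℝ j) = U₀ (X ^ (2 * p)) := by
      refine H.series₀ b' _ (summable_abs hb'.summable) fun x hx => ?_
      have h := hb'.hasSum x (hx.trans hs)
      rwa [cutoff_eq_zero hμ₀0.le, sub_zero, one_mul, ← eval_X (x := x), ← eval_pow,
        eval_X (x := x)] at h
      refine le_trans ?_ ha₀.le
      rw [← sq_abs x]
      gcongr
    -- No control of `D'` in `p` is needed: `n` goes to infinity first, with `p` fixed.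
    obtain ⟨D', hD'⟩ := H.expansion_pow (2 * p)
    set V := ∑' j, b' j * U₁ (T ℝ j) with hV
    have hVb : |V| ≤ D * (Dp * ((2 * p : ℕ) + 1 : ℝ) ^ (E + 2) * σ ^ (2 * p)) := by
      refine (abs_tsum_mul_le hb'.summable H.bound₁).trans ?_
      exact mul_le_mul_of_nonneg_left hb'.tsum_le H.nonneg
    have hpt : ∀ x : ℝ, cutoff a μ x ≤
        (a⁻¹) ^ p * (x ^ (2 * p) - (1 - cutoff a₀ μ₀ x) * x ^ (2 * p)) := by
      intro x
      have e : x ^ (2 * p) - (1 - cutoff a₀ μ₀ x) * x ^ (2 * p) =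
          cutoff a₀ μ₀ x * (x ^ 2) ^ p := by rw [pow_mul]; ring
      rw [e]
      rcases le_or_gt (x ^ 2) a with h | h
      · rw [cutoff_eq_zero hμ h]
        have := cutoff_nonneg a₀ μ₀ x
        positivity
      · rw [cutoff_eq_one hμ₀0 (by rw [hlev]; linarith), one_mul, ← mul_pow]
        refine (cutoff_le_one _ _ _).trans (one_le_pow₀ ?_)
        rw [inv_mul_eq_div, le_div_iff₀ ha0]
        linarith
    have hbound : ∀ n : ℕ, 1 ≤ n → (n : ℝ) * ∫ ω, (∑ i, cutoff a μ (t n ω i)) / (d * n : ℝ) ∂(P n) ≤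
        (a⁻¹) ^ p * (U₁ (X ^ (2 * p)) - V + (D' +
          D * (Dp * ((2 * p : ℕ) + 1 : ℝ) ^ (E + 2) * σ ^ (2 * p))) / n) := by
      intro n hn
      have hn0 : (0 : ℝ) < n := by exact_mod_cast hn
      have hX := H.integrable_eval (X ^ (2 * p)) n
      simp only [eval_pow, eval_X] at hX
      have i1 : Integrable (fun ω => (∑ i, (t n ω i) ^ (2 * p)) / (d * n : ℝ)) (P n) :=
        hX.div_const _
      have i2 := (H.integrable_sum hb' n).div_const (d * n : ℝ)
      have h1 : ∫ ω, (∑ i, cutoff a μ (t n ω i)) / (d * n : ℝ) ∂(P n) ≤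
          ∫ ω, (a⁻¹) ^ p * ((∑ i, (t n ω i) ^ (2 * p)) / (d * n : ℝ) -
            (∑ i, (1 - cutoff a₀ μ₀ (t n ω i)) * (t n ω i) ^ (2 * p)) / (d * n : ℝ)) ∂(P n) := by
        refine integral_mono ((H.integrable_sum hb n).div_const _) ((i1.sub i2).const_mul _)
          fun ω => ?_
        simp only
        rw [← sub_div, ← Finset.sum_sub_distrib, ← mul_div_assoc, Finset.mul_sum]
        exact div_le_div_of_nonneg_right (Finset.sum_le_sum fun i _ => hpt _) (by positivity)
      rw [integral_const_mul, integral_sub i1 i2] at h1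
      have e1 := abs_le.mp (hD' n hn)
      have e2 := abs_le.mp (H.abs_integral_sub_le hb' hn)
      rw [hb'0] at e2
      have h2 : (∫ ω, (∑ i, (t n ω i) ^ (2 * p)) / (d * n : ℝ) ∂(P n)) -
          (∫ ω, (∑ i, (1 - cutoff a₀ μ₀ (t n ω i)) * (t n ω i) ^ (2 * p)) / (d * n : ℝ) ∂(P n)) ≤
          U₁ (X ^ (2 * p)) / n - V / n + (D' / (n : ℝ) ^ 2 +
          D * (Dp * ((2 * p : ℕ) + 1 : ℝ) ^ (E + 2) * σ ^ (2 * p)) / (n : ℝ) ^ 2) := by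
        linarith [e1.2, e2.1]
      calc _ ≤ (n : ℝ) * ((a⁻¹) ^ p * (U₁ (X ^ (2 * p)) / n - V / n + (D' / (n : ℝ) ^ 2 +
          D * (Dp * ((2 * p : ℕ) + 1 : ℝ) ^ (E + 2) * σ ^ (2 * p)) / (n : ℝ) ^ 2))) := by
            refine mul_le_mul_of_nonneg_left (h1.trans ?_) hn0.le
            exact mul_le_mul_of_nonneg_left h2 (by positivity)
        _ = _ := by field_simp
    have hlim2 : Tendsto (fun n : ℕ => (a⁻¹) ^ p * (U₁ (X ^ (2 * p)) - V + (D' +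
          D * (Dp * ((2 * p : ℕ) + 1 : ℝ) ^ (E + 2) * σ ^ (2 * p))) / (n : ℝ))) atTop
          (nhds ((a⁻¹) ^ p * (U₁ (X ^ (2 * p)) - V + 0))) :=
      ((tendsto_const_div_atTop_nhds_zero_nat _).const_add _).const_mul _
    have h3 : ν ≤ (a⁻¹) ^ p * (U₁ (X ^ (2 * p)) - V + 0) :=
      le_of_tendsto_of_tendsto hlim hlim2 (eventually_atTop.mpr ⟨1, hbound⟩)
    refine h3.trans (mul_le_mul_of_nonneg_left ?_ (by positivity))
    have := le_abs_self (U₁ (X ^ (2 * p)))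
    have := neg_abs_le V
    linarith
  -- Now `p → ∞`: the geometric factor `(a₁/a)^p` beats the polynomial.
  have hνle : ν ≤ 0 := by
    set r := a₁ / a with hr
    have hr0 : 0 ≤ r := by positivity
    have hr1 : r < 1 := by rw [hr, div_lt_one ha0]; exact ha₁'
    have hev : ∀ᶠ p : ℕ in atTop, ν ≤ r ^ p + D * Dp * 2 ^ (E + 2) * 2 ^ (E + 2) *
        ((p : ℝ) ^ (E + 2) * r ^ p) := by
      have h2p : Tendsto (fun p : ℕ => 2 * p) atTop atTop :=
        tendsto_id.const_mul_atTop' (by norm_num)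
      filter_upwards [h2p.eventually (hmom σ hsσ), eventually_ge_atTop 1] with p hp hp1
      refine (key p).trans ?_
      have hσp : σ ^ (2 * p) = a₁ ^ p := by rw [pow_mul, hσ2]
      have hrp : (a⁻¹) ^ p * a₁ ^ p = r ^ p := by rw [← mul_pow, hr, inv_mul_eq_div]
      have hp1' : (1 : ℝ) ≤ p := by exact_mod_cast hp1
      have hpp : ((2 * p : ℕ) + 1 : ℝ) ^ (E + 2) ≤ 2 ^ (E + 2) * 2 ^ (E + 2) * (p : ℝ) ^ (E + 2) := by
        rw [← mul_pow, ← mul_pow]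
        gcongr
        push_cast; linarith
      have hD := H.nonneg
      rw [hσp] at hp ⊢
      calc (a⁻¹) ^ p * (|U₁ (X ^ (2 * p))| + D * (Dp * ((2 * p : ℕ) + 1 : ℝ) ^ (E + 2) * a₁ ^ p))
          ≤ (a⁻¹) ^ p * (a₁ ^ p + D * (Dp * (2 ^ (E + 2) * 2 ^ (E + 2) * (p : ℝ) ^ (E + 2)) *
            a₁ ^ p)) := by gcongr
        _ = (a⁻¹) ^ p * a₁ ^ p + D * Dp * 2 ^ (E + 2) * 2 ^ (E + 2) *
          ((p : ℝ) ^ (E + 2) * ((a⁻¹) ^ p * a₁ ^ p)) := by ring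
        _ = _ := by rw [hrp]
    have hl : Tendsto (fun p : ℕ => r ^ p + D * Dp * 2 ^ (E + 2) * 2 ^ (E + 2) *
        ((p : ℝ) ^ (E + 2) * r ^ p)) atTop (nhds (0 + D * Dp * 2 ^ (E + 2) * 2 ^ (E + 2) * 0)) :=
      (tendsto_pow_atTop_nhds_zero_of_lt_one hr0 hr1).add
        ((tendsto_pow_const_mul_const_pow_of_lt_one (E + 2) hr0 hr1).const_mul _)
    have := ge_of_tendsto hl hev
    simpa using this
  have hν00 : ν = 0 := le_antisymm hνle hν0
  rw [hν00] at hlim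
  have hlim' := hlim.const_mul (d : ℝ)
  rw [mul_zero] at hlim'
  refine hlim'.congr' ?_
  filter_upwards [eventually_ge_atTop 1] with n hn
  have hn0 : (n : ℝ) ≠ 0 := by exact_mod_cast (by omega : n ≠ 0)
  rw [integral_div]
  rcases Nat.eq_zero_or_pos d with hd | hd
  · subst hd
    have : IsEmpty (Fin (0 * n)) := by rw [zero_mul]; infer_instance
    simp
  · have hd0 : (d : ℝ) ≠ 0 := by exact_mod_cast hd.ne'
    field_simp

/-- If the expected number of points above the level `a` tends to zero, it does so at rate
`1 / n` with explicit constants. -/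
theorem integral_sum_cutoff_le (H : ExpansionData P d t U₀ U₁ s D E) (hU : U₀ 0 = 0)
    (hs : s ≤ 1) {a μ : ℝ} (hμ : 0 ≤ μ) (ha : s ^ 2 ≤ a) {b : ℤ → ℝ} {B : ℝ}
    (hb : ChebyshevSeries E b (cutoff a μ) B)
    (hlim : Tendsto (fun n : ℕ => ∫ ω, ∑ i, cutoff a μ (t n ω i) ∂(P n)) atTop (nhds 0))
    {n : ℕ} (hn : 1 ≤ n) :
    ∫ ω, ∑ i, cutoff a μ (t n ω i) ∂(P n) ≤ d * (D * B) / n := by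
  rcases Nat.eq_zero_or_pos d with hd | hd
  · subst hd
    have : IsEmpty (Fin (0 * n)) := by rw [zero_mul]; infer_instance
    simp
  have hd0 : (0 : ℝ) < d := by exact_mod_cast hd
  have hb0 := H.series₀_cutoff hU hμ hs ha hb
  have h1 := H.tendsto_mul_integral hb hb0
  -- `n` times the averaged integral converges to the first-order term, but it is also the
  -- unnormalised expectation divided by `d`, which tends to zero by `hlim`.
  have hν : ∑' j, b j * U₁ (T ℝ j) = 0 := by
    have h2 : Tendsto (fun n : ℕ => (n : ℝ) * ∫ ω, (∑ i, cutoff a μ (t n ω i)) / (d * n : ℝ) ∂(P n))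
        atTop (nhds 0) := by
      have := hlim.div_const (d : ℝ)
      rw [zero_div] at this
      refine this.congr' ?_
      filter_upwards [eventually_ge_atTop 1] with m hm
      have hm0 : (m : ℝ) ≠ 0 := by exact_mod_cast (by omega : m ≠ 0)
      rw [integral_div]
      field_simp
    exact tendsto_nhds_unique h1 h2
  have h := H.abs_integral_sub_le hb hn
  rw [hb0, hν, zero_div, sub_zero, sub_zero, integral_div] at h
  have hn0 : (0 : ℝ) < n := by exact_mod_cast hn
  have h' := (le_abs_self _).trans h
  rw [div_le_iff₀ (by positivity)] at h'
  refine h'.trans (le_of_eq ?_)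
  field_simp

end ExpansionData

end Expansion

/-! ### The algebra of matrix-valued group elements, its representations and its `ℓ¹` norm -/

section Tensor

open scoped Matrix.Norms.L2Operator

variable {d : ℕ} {Λ : Type*} [Group Λ] {H : Type*} [NormedAddCommGroup H] [InnerProductSpace ℂ H]

theorem matTensor_apply (A : Matrix (Fin d) (Fin d) ℂ) (T : H →L[ℂ] H)
    (v : PiLp 2 fun _ : Fin d => H) (i : Fin d) :
    matTensor A T v i = ∑ j, A i j • T (v j) := by
  simp [matTensor]

theorem matTensor_mul (A B : Matrix (Fin d) (Fin d) ℂ) (T S : H →L[ℂ] H) :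
    matTensor A T * matTensor B S = matTensor (A * B) (T * S) := by
  ext v i
  have h : matTensor (A * B) (T * S) v i = ∑ j, (A * B) i j • T (S (v j)) := matTensor_apply _ _ _ _
  change matTensor A T (matTensor B S v) i = _
  rw [h]
  simp only [matTensor_apply, map_sum, map_smul, Finset.smul_sum, smul_smul, Matrix.mul_apply,
    Finset.sum_smul]
  rw [Finset.sum_comm]

theorem matTensor_one : matTensor (1 : Matrix (Fin d) (Fin d) ℂ) (1 : H →L[ℂ] H) = 1 := by
  ext v i
  simp [matTensor_apply, Matrix.one_apply]

theorem matTensor_add_left (A B : Matrix (Fin d) (Fin d) ℂ) (T : H →L[ℂ] H) :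
    matTensor (A + B) T = matTensor A T + matTensor B T := by
  ext v i
  simp [matTensor_apply, add_smul, Finset.sum_add_distrib]

theorem matTensor_zero_left (T : H →L[ℂ] H) :
    matTensor (0 : Matrix (Fin d) (Fin d) ℂ) T = 0 := by
  ext v i
  simp [matTensor_apply]

theorem matTensor_smul_left (c : ℂ) (A : Matrix (Fin d) (Fin d) ℂ) (T : H →L[ℂ] H) :
    matTensor (c • A) T = c • matTensor A T := by
  ext v i
  simp [matTensor_apply, Finset.smul_sum, smul_smul]

theorem matTensor_star [CompleteSpace H] (A : Matrix (Fin d) (Fin d) ℂ) (T : H →L[ℂ] H) :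
    star (matTensor A T) = matTensor (star A) (star T) := by
  refine ((ContinuousLinearMap.eq_adjoint_iff _ _).mpr fun v w => ?_).symm
  simp only [PiLp.inner_apply, matTensor_apply, sum_inner, inner_sum, inner_smul_left,
    inner_smul_right, Matrix.star_apply, ContinuousLinearMap.star_eq_adjoint,
    ContinuousLinearMap.adjoint_inner_left, RCLike.star_def, Complex.conj_conj]
  rw [Finset.sum_comm]

/-- `A ↦ A ⊗ 1` as a homomorphism of star algebras. -/
noncomputable def matTensorHom (d : ℕ) (H : Type*) [NormedAddCommGroup H] [InnerProductSpace ℂ H]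
    [CompleteSpace H] : Matrix (Fin d) (Fin d) ℂ →⋆ₐ[ℂ]
      (PiLp 2 (fun _ : Fin d => H) →L[ℂ] PiLp 2 (fun _ : Fin d => H)) where
  toFun A := matTensor A 1
  map_one' := matTensor_one
  map_mul' A B := by rw [matTensor_mul, mul_one]
  map_zero' := matTensor_zero_left _
  map_add' A B := matTensor_add_left _ _ _
  commutes' c := by
    rw [Algebra.algebraMap_eq_smul_one, matTensor_smul_left, matTensor_one,
      Algebra.algebraMap_eq_smul_one]
  map_star' A := by rw [matTensor_star, star_one]

/-- A star homomorphism of C*-algebras is contractive. -/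
theorem norm_matTensor_one_right_le [CompleteSpace H] (A : Matrix (Fin d) (Fin d) ℂ) :
    ‖matTensor A (1 : H →L[ℂ] H)‖ ≤ ‖A‖ :=
  NonUnitalStarAlgHom.norm_apply_le (matTensorHom d H) A

theorem norm_sq_matTensor_one_left (T : H →L[ℂ] H) (v : PiLp 2 fun _ : Fin d => H) :
    ‖matTensor (1 : Matrix (Fin d) (Fin d) ℂ) T v‖ ^ 2 = ∑ i, ‖T (v i)‖ ^ 2 := by
  rw [PiLp.norm_sq_eq_of_L2]
  simp [matTensor_apply, Matrix.one_apply]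

theorem norm_matTensor_one_left_le (T : H →L[ℂ] H) :
    ‖matTensor (1 : Matrix (Fin d) (Fin d) ℂ) T‖ ≤ ‖T‖ := by
  refine ContinuousLinearMap.opNorm_le_bound _ (norm_nonneg _) fun v => ?_
  refine le_of_sq_le_sq ?_ (by positivity)
  rw [norm_sq_matTensor_one_left, mul_pow, PiLp.norm_sq_eq_of_L2, Finset.mul_sum]
  refine Finset.sum_le_sum fun i _ => ?_
  rw [← mul_pow]
  gcongr
  exact T.le_opNorm _

theorem norm_matTensor_le [CompleteSpace H] (A : Matrix (Fin d) (Fin d) ℂ) (T : H →L[ℂ] H) :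
    ‖matTensor A T‖ ≤ ‖A‖ * ‖T‖ := by
  have : matTensor A T = matTensor A 1 * matTensor 1 T := by simp [matTensor_mul]
  rw [this]
  refine (norm_mul_le _ _).trans ?_
  gcongr
  · exact norm_matTensor_one_right_le A
  · exact norm_matTensor_one_left_le T

/-- `id ⊗ ρ` as a homomorphism of algebras. -/
noncomputable def idTensorHom [CompleteSpace H] (d : ℕ) (ρ : Λ →* (H →L[ℂ] H)) :
    MonoidAlgebra (Matrix (Fin d) (Fin d) ℂ) Λ →ₐ[ℂ]
      (PiLp 2 (fun _ : Fin d => H) →L[ℂ] PiLp 2 (fun _ : Fin d => H)) :=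
  MonoidAlgebra.liftNCAlgHom (matTensorHom d H : _ →ₐ[ℂ] _)
    { toFun := fun γ => matTensor 1 (ρ γ)
      map_one' := by rw [map_one, matTensor_one]
      map_mul' := fun γ η => by rw [map_mul, matTensor_mul, mul_one] } fun A γ => by
    change matTensor A 1 * matTensor 1 (ρ γ) = matTensor 1 (ρ γ) * matTensor A 1
    simp [matTensor_mul]

theorem idTensorHom_apply [CompleteSpace H] (ρ : Λ →* (H →L[ℂ] H))
    (x : MonoidAlgebra (Matrix (Fin d) (Fin d) ℂ) Λ) : idTensorHom d ρ x = idTensor ρ x := by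
  induction x using MonoidAlgebra.induction_linear with
  | zero => simp [idTensor]
  | add x y hx hy =>
    rw [map_add, hx, hy, idTensor, idTensor, idTensor, MonoidAlgebra.coeff_add,
      Finsupp.sum_add_index']
    · intro γ; exact matTensor_zero_left _
    · intro γ A B; exact matTensor_add_left _ _ _
  | single γ A =>
    rw [idTensor, MonoidAlgebra.coeff_single, Finsupp.sum_single_index (matTensor_zero_left _)]
    simp only [idTensorHom, MonoidAlgebra.coe_liftNCAlgHom, MonoidAlgebra.liftNC_single]
    change matTensor A 1 * matTensor 1 (ρ γ) = _
    simp [matTensor_mul]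

theorem idTensor_single (ρ : Λ →* (H →L[ℂ] H)) (γ : Λ) (A : Matrix (Fin d) (Fin d) ℂ) :
    idTensor ρ (MonoidAlgebra.single γ A) = matTensor A (ρ γ) := by
  rw [idTensor, MonoidAlgebra.coeff_single, Finsupp.sum_single_index (matTensor_zero_left _)]

theorem groupStar_single {R : Type*} [Semiring R] [StarRing R] (γ : Λ) (a : R) :
    groupStar (MonoidAlgebra.single γ a) = MonoidAlgebra.single γ⁻¹ (star a) := by
  rw [groupStar, MonoidAlgebra.coeff_single, Finsupp.sum_single_index (by simp)]

theorem groupStar_add {R : Type*} [Semiring R] [StarRing R] (x y : MonoidAlgebra R Λ) :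
    groupStar (x + y) = groupStar x + groupStar y := by
  rw [groupStar, groupStar, groupStar, MonoidAlgebra.coeff_add, Finsupp.sum_add_index']
  · intro γ; simp
  · intro γ a b; rw [star_add, MonoidAlgebra.single_add]

theorem groupStar_zero {R : Type*} [Semiring R] [StarRing R] :
    groupStar (0 : MonoidAlgebra R Λ) = 0 := by
  simp [groupStar]

theorem groupStar_groupStar {R : Type*} [Semiring R] [StarRing R] (x : MonoidAlgebra R Λ) :
    groupStar (groupStar x) = x := by
  induction x using MonoidAlgebra.induction_linear with
  | zero => simp [groupStar_zero]
  | add x y hx hy => rw [groupStar_add, groupStar_add, hx, hy]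
  | single γ a => simp [groupStar_single]

theorem groupStar_mul {R : Type*} [Semiring R] [StarRing R] (x y : MonoidAlgebra R Λ) :
    groupStar (x * y) = groupStar y * groupStar x := by
  induction x using MonoidAlgebra.induction_linear with
  | zero => simp [groupStar_zero]
  | add x₁ x₂ h₁ h₂ => rw [add_mul, groupStar_add, h₁, h₂, groupStar_add, mul_add]
  | single γ a =>
    induction y using MonoidAlgebra.induction_linear with
    | zero => simp [groupStar_zero]
    | add y₁ y₂ h₁ h₂ => rw [mul_add, groupStar_add, h₁, h₂, groupStar_add, add_mul]
    | single η b => simp [groupStar_single, MonoidAlgebra.single_mul_single]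

theorem groupStar_smul (c : ℝ) (x : MonoidAlgebra (Matrix (Fin d) (Fin d) ℂ) Λ) :
    groupStar (c • x) = c • groupStar x := by
  induction x using MonoidAlgebra.induction_linear with
  | zero => simp [groupStar_zero]
  | add x y hx hy => rw [smul_add, groupStar_add, hx, hy, groupStar_add, smul_add]
  | single γ a => simp [groupStar_single, MonoidAlgebra.smul_single]

theorem idTensor_groupStar [CompleteSpace H] (ρ : Λ →* (H →L[ℂ] H))
    (hρ : ∀ γ, ρ γ⁻¹ = star (ρ γ)) (x : MonoidAlgebra (Matrix (Fin d) (Fin d) ℂ) Λ) :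
    idTensor ρ (groupStar x) = star (idTensor ρ x) := by
  induction x using MonoidAlgebra.induction_linear with
  | zero =>
    rw [groupStar_zero, ← idTensorHom_apply, map_zero]
    exact (star_zero (PiLp 2 (fun _ : Fin d => H) →L[ℂ] PiLp 2 (fun _ : Fin d => H))).symm
  | add x y hx hy =>
    rw [groupStar_add, ← idTensorHom_apply, ← idTensorHom_apply, map_add, map_add,
      idTensorHom_apply, idTensorHom_apply, hx, hy, idTensorHom_apply, idTensorHom_apply]
    exact (star_add (idTensor ρ x) (idTensor ρ y)).symm
  | single γ A => rw [groupStar_single, idTensor_single, idTensor_single, matTensor_star, hρ]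

theorem isSelfAdjoint_idTensor [CompleteSpace H] (ρ : Λ →* (H →L[ℂ] H))
    (hρ : ∀ γ, ρ γ⁻¹ = star (ρ γ)) {x : MonoidAlgebra (Matrix (Fin d) (Fin d) ℂ) Λ}
    (hx : groupStar x = x) : IsSelfAdjoint (idTensor ρ x) := by
  rw [IsSelfAdjoint, ← idTensor_groupStar ρ hρ, hx]

theorem idTensor_aeval [CompleteSpace H] (ρ : Λ →* (H →L[ℂ] H))
    (x : MonoidAlgebra (Matrix (Fin d) (Fin d) ℂ) Λ) (Q : Polynomial ℝ) :
    idTensor ρ (Polynomial.aeval x Q) = Polynomial.aeval (idTensor ρ x) Q := by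
  rw [← idTensorHom_apply, ← idTensorHom_apply]
  exact (Polynomial.aeval_algHom_apply ((idTensorHom d ρ).restrictScalars ℝ) x Q).symm

theorem leftRegular_inv (γ : Λ) : leftRegular Λ γ⁻¹ = star (leftRegular Λ γ) := by
  rw [ContinuousLinearMap.star_eq_adjoint, ContinuousLinearMap.eq_adjoint_iff]
  intro f g
  have h : f = leftRegular Λ γ (leftRegular Λ γ⁻¹ f) := by
    change f = (leftRegular Λ γ * leftRegular Λ γ⁻¹) f
    rw [← map_mul, mul_inv_cancel, map_one]
    rfl
  conv_rhs => rw [h]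
  exact ((translate γ).inner_map_map _ _).symm

theorem norm_leftRegular_le (γ : Λ) : ‖leftRegular Λ γ‖ ≤ 1 :=
  (translate γ).norm_toContinuousLinearMap_le

theorem unitaryRep_inv {n : ℕ} (ρ : Λ →* Matrix.unitaryGroup (Fin n) ℂ) (γ : Λ) :
    unitaryRep ρ γ⁻¹ = star (unitaryRep ρ γ) := by
  change Matrix.toEuclideanCLM (n := Fin n) (𝕜 := ℂ) _ =
    star (Matrix.toEuclideanCLM (n := Fin n) (𝕜 := ℂ) _)
  rw [← map_star, map_inv]
  rfl

theorem norm_le_one_of_star_mul_self [CompleteSpace H] {T : H →L[ℂ] H} (hT : star T * T = 1) :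
    ‖T‖ ≤ 1 := by
  have h : ‖T‖ * ‖T‖ ≤ 1 := by
    rw [← CStarRing.norm_star_mul_self, hT]
    exact ContinuousLinearMap.norm_id_le
  nlinarith [norm_nonneg T]

theorem norm_unitaryRep_le {n : ℕ} (ρ : Λ →* Matrix.unitaryGroup (Fin n) ℂ) (γ : Λ) :
    ‖unitaryRep ρ γ‖ ≤ 1 := by
  refine norm_le_one_of_star_mul_self ?_
  rw [← unitaryRep_inv, ← map_mul, inv_mul_cancel, map_one]

/-- The `ℓ¹` norm `∑ ‖A_γ‖`. -/
noncomputable def lOneNorm (x : MonoidAlgebra (Matrix (Fin d) (Fin d) ℂ) Λ) : ℝ :=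
  x.coeff.sum fun _ A => ‖A‖

theorem lOneNorm_nonneg (x : MonoidAlgebra (Matrix (Fin d) (Fin d) ℂ) Λ) : 0 ≤ lOneNorm x :=
  Finset.sum_nonneg fun _ _ => norm_nonneg _

theorem lOneNorm_zero : lOneNorm (0 : MonoidAlgebra (Matrix (Fin d) (Fin d) ℂ) Λ) = 0 := by
  simp [lOneNorm]

theorem lOneNorm_single (γ : Λ) (A : Matrix (Fin d) (Fin d) ℂ) :
    lOneNorm (MonoidAlgebra.single γ A) = ‖A‖ := by
  rw [lOneNorm, MonoidAlgebra.coeff_single]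
  exact Finsupp.sum_single_index norm_zero

theorem lOneNorm_eq_sum {x : MonoidAlgebra (Matrix (Fin d) (Fin d) ℂ) Λ} {s : Finset Λ}
    (hs : x.coeff.support ⊆ s) : lOneNorm x = ∑ γ ∈ s, ‖x.coeff γ‖ :=
  Finsupp.sum_of_support_subset _ hs _ fun _ _ => norm_zero

theorem lOneNorm_add_le (x y : MonoidAlgebra (Matrix (Fin d) (Fin d) ℂ) Λ) :
    lOneNorm (x + y) ≤ lOneNorm x + lOneNorm y := by
  classical
  rw [lOneNorm_eq_sum (x := x + y) (s := x.coeff.support ∪ y.coeff.support) (by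
      rw [MonoidAlgebra.coeff_add]; exact Finsupp.support_add),
    lOneNorm_eq_sum (x := x) Finset.subset_union_left,
    lOneNorm_eq_sum (x := y) Finset.subset_union_right, ← Finset.sum_add_distrib]
  exact Finset.sum_le_sum fun γ _ => norm_add_le _ _

theorem lOneNorm_smul (c : ℝ) (x : MonoidAlgebra (Matrix (Fin d) (Fin d) ℂ) Λ) :
    lOneNorm (c • x) = |c| * lOneNorm x := by
  rw [lOneNorm_eq_sum (x := c • x) (s := x.coeff.support) (by
    rw [MonoidAlgebra.coeff_smul]; exact Finsupp.support_smul),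
    lOneNorm_eq_sum (x := x) subset_rfl, Finset.mul_sum]
  refine Finset.sum_congr rfl fun γ _ => ?_
  rw [MonoidAlgebra.coeff_smul_apply, norm_smul, Real.norm_eq_abs]

theorem lOneNorm_sum_le {ι : Type*} (s : Finset ι)
    (f : ι → MonoidAlgebra (Matrix (Fin d) (Fin d) ℂ) Λ) :
    lOneNorm (∑ i ∈ s, f i) ≤ ∑ i ∈ s, lOneNorm (f i) :=
  Finset.le_sum_of_subadditive _ lOneNorm_zero.le lOneNorm_add_le _ _

theorem lOneNorm_mul_le (x y : MonoidAlgebra (Matrix (Fin d) (Fin d) ℂ) Λ) :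
    lOneNorm (x * y) ≤ lOneNorm x * lOneNorm y := by
  rw [MonoidAlgebra.mul_def, Finsupp.sum]
  refine (lOneNorm_sum_le _ _).trans ?_
  rw [lOneNorm, lOneNorm, Finsupp.sum, Finsupp.sum, Finset.sum_mul_sum]
  refine Finset.sum_le_sum fun γ _ => ?_
  rw [Finsupp.sum]
  refine (lOneNorm_sum_le _ _).trans (Finset.sum_le_sum fun η _ => ?_)
  rw [lOneNorm_single]
  exact norm_mul_le _ _

theorem norm_idTensor_le_lOneNorm [CompleteSpace H] (ρ : Λ →* (H →L[ℂ] H)) (hρ : ∀ γ, ‖ρ γ‖ ≤ 1)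
    (x : MonoidAlgebra (Matrix (Fin d) (Fin d) ℂ) Λ) : ‖idTensor ρ x‖ ≤ lOneNorm x := by
  refine (norm_sum_le _ _).trans (Finset.sum_le_sum fun γ _ => ?_)
  exact (norm_matTensor_le _ _).trans (mul_le_of_le_one_right (norm_nonneg _) (hρ γ))

theorem norm_matrix_entry_le (A : Matrix (Fin d) (Fin d) ℂ) (i j : Fin d) : ‖A i j‖ ≤ ‖A‖ := by
  have h := Matrix.l2_opNorm_mulVec A (EuclideanSpace.single j (1 : ℂ))
  rw [PiLp.norm_single, norm_one, mul_one] at h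
  refine le_trans ?_ h
  have h2 := PiLp.norm_apply_le ((EuclideanSpace.equiv (Fin d) ℂ).symm
    (A.mulVec (EuclideanSpace.single j (1 : ℂ)).ofLp)) i
  simpa using h2

theorem norm_trace_div_le (A : Matrix (Fin d) (Fin d) ℂ) : ‖A.trace / d‖ ≤ ‖A‖ := by
  rw [norm_div, Complex.norm_natCast]
  refine div_le_of_le_mul₀ (Nat.cast_nonneg _) (norm_nonneg _) ?_
  rw [Matrix.trace]
  refine (norm_sum_le_of_le _ fun i _ => norm_matrix_entry_le A i i).trans ?_
  simp [mul_comm]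

/-- The functional `∑ A_γ ⊗ γ ↦ ∑ tr(A_γ) u(γ)` with the normalized trace on `M_d`. -/
noncomputable def coefTrace (u : Λ → ℂ) :
    MonoidAlgebra (Matrix (Fin d) (Fin d) ℂ) Λ →ₗ[ℂ] ℂ where
  toFun x := x.coeff.sum fun γ A => A.trace / d * u γ
  map_add' x y := by
    rw [MonoidAlgebra.coeff_add, Finsupp.sum_add_index']
    · simp
    · intro γ A B; rw [Matrix.trace_add]; ring
  map_smul' c x := by
    rw [MonoidAlgebra.coeff_smul, Finsupp.sum_smul_index' (by simp), Finsupp.smul_sum]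
    refine Finset.sum_congr rfl fun γ _ => ?_
    simp only [Matrix.trace_smul, smul_eq_mul, RingHom.id_apply]
    ring

theorem coefTrace_apply (u : Λ → ℂ) (x : MonoidAlgebra (Matrix (Fin d) (Fin d) ℂ) Λ) :
    coefTrace u x = ∑ γ ∈ x.coeff.support, (x.coeff γ).trace / d * u γ := rfl

theorem coefTrace_single (u : Λ → ℂ) (γ : Λ) (A : Matrix (Fin d) (Fin d) ℂ) :
    coefTrace u (MonoidAlgebra.single γ A) = A.trace / d * u γ := by
  change (MonoidAlgebra.single γ A).coeff.sum (fun γ A => A.trace / d * u γ) = _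
  rw [MonoidAlgebra.coeff_single, Finsupp.sum_single_index (by simp)]

/-- Transfers hypothesis 1 from single group elements to the group algebra, at the price of the `ℓ¹`
norm. -/
theorem norm_coefTrace_le {u : Λ → ℂ} {c : ℝ} {x : MonoidAlgebra (Matrix (Fin d) (Fin d) ℂ) Λ}
    (hu : ∀ γ ∈ x.coeff.support, ‖u γ‖ ≤ c) : ‖coefTrace u x‖ ≤ lOneNorm x * c := by
  rw [coefTrace_apply, lOneNorm, Finsupp.sum, Finset.sum_mul]
  refine norm_sum_le_of_le _ fun γ hγ => ?_
  rw [norm_mul]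
  gcongr
  · exact norm_trace_div_le _
  · exact hu γ hγ

end Tensor

/-! ### Word length, support length and the size of balls -/

section WordLength

variable {Λ : Type*} [Group Λ] {S : Finset Λ}

/-- Since `S` generates, the infimum is over a nonempty set and is attained; the default value of
`sInf ∅` does not interfere. -/
theorem exists_word (hS : Subgroup.closure (S : Set Λ) = ⊤) (γ : Λ) :
    ∃ w : List Λ, w.length = wordLength S γ ∧ (∀ s ∈ w, s ∈ S ∨ s⁻¹ ∈ S) ∧ w.prod = γ := by
  have hγ : γ ∈ Subgroup.closure (S : Set Λ) := hS ▸ Subgroup.mem_top γ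
  rw [← Subgroup.mem_toSubmonoid, Subgroup.closure_toSubmonoid] at hγ
  obtain ⟨w, hw, hprod⟩ := Submonoid.exists_list_of_mem_closure hγ
  have hne : {k : ℕ | ∃ w : List Λ, w.length = k ∧ (∀ s ∈ w, s ∈ S ∨ s⁻¹ ∈ S) ∧
      w.prod = γ}.Nonempty := ⟨w.length, w, rfl, by simpa using hw, hprod⟩
  exact Nat.sInf_mem hne

theorem wordLength_le {γ : Λ} (w : List Λ) (hw : ∀ s ∈ w, s ∈ S ∨ s⁻¹ ∈ S) (hprod : w.prod = γ) :
    wordLength S γ ≤ w.length :=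
  Nat.sInf_le ⟨w, rfl, hw, hprod⟩

theorem wordLength_one : wordLength S (1 : Λ) = 0 :=
  Nat.le_zero.mp (wordLength_le [] (by simp) rfl)

theorem wordLength_mul_le (hS : Subgroup.closure (S : Set Λ) = ⊤) (γ η : Λ) :
    wordLength S (γ * η) ≤ wordLength S γ + wordLength S η := by
  obtain ⟨w, hw, hw', hwp⟩ := exists_word hS γ
  obtain ⟨v, hv, hv', hvp⟩ := exists_word hS η
  rw [← hw, ← hv, ← List.length_append]
  refine wordLength_le _ (fun s hs => ?_) (by rw [List.prod_append, hwp, hvp])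
  rcases List.mem_append.mp hs with h | h
  · exact hw' s h
  · exact hv' s h

/-- A ball of radius `L` lies in `A ^ L` for `A = {1} ∪ S ∪ S⁻¹`; including `1` makes the powers of
`A` increasing, so shorter words are covered. -/
theorem card_le_of_wordLength_le (hS : Subgroup.closure (S : Set Λ) = ⊤) {L : ℕ} {B : Finset Λ}
    (hB : ∀ γ ∈ B, wordLength S γ ≤ L) : B.card ≤ (2 * S.card + 1) ^ L := by
  classical
  open scoped Pointwise in
  set A : Finset Λ := insert 1 (S ∪ S⁻¹) with hA
  have hAcard : A.card ≤ 2 * S.card + 1 := by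
    refine (Finset.card_insert_le _ _).trans ?_
    have := Finset.card_union_le S S⁻¹
    rw [Finset.card_inv] at this
    omega
  have h1 : (1 : Λ) ∈ A := Finset.mem_insert_self _ _
  have hprod : ∀ w : List Λ, (∀ s ∈ w, s ∈ S ∨ s⁻¹ ∈ S) → w.prod ∈ A ^ w.length := by
    intro w
    induction w with
    | nil => intro _; simp
    | cons a w ih =>
      intro hw
      rw [List.prod_cons, List.length_cons, pow_succ']
      refine Finset.mul_mem_mul ?_ (ih fun s hs => hw s (List.mem_cons_of_mem _ hs))
      rw [hA, Finset.mem_insert, Finset.mem_union, Finset.mem_inv']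
      exact Or.inr (hw a List.mem_cons_self)
  have hsub : B ⊆ A ^ L := by
    intro γ hγ
    obtain ⟨w, hw, hw', hwp⟩ := exists_word hS γ
    have := hprod w hw'
    rw [hwp, hw] at this
    exact Finset.pow_subset_pow_right h1 (hB γ hγ) this
  refine (Finset.card_le_card hsub).trans (Finset.card_pow_le.trans ?_)
  gcongr

variable {R : Type*} [Ring R]

theorem supportLength_le_iff {x : MonoidAlgebra R Λ} {m : ℕ} :
    supportLength S x ≤ m ↔ ∀ γ ∈ x.coeff.support, wordLength S γ ≤ m := by
  rw [supportLength, Finset.sup_le_iff]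

theorem supportLength_zero : supportLength S (0 : MonoidAlgebra R Λ) = 0 := by
  simp [supportLength]

theorem supportLength_single_le (γ : Λ) (a : R) :
    supportLength S (MonoidAlgebra.single γ a) ≤ wordLength S γ := by
  rw [supportLength_le_iff]
  intro η hη
  rw [MonoidAlgebra.coeff_single] at hη
  have := Finsupp.support_single_subset hη
  rw [Finset.mem_singleton] at this
  rw [this]

theorem supportLength_add_le {x y : MonoidAlgebra R Λ} {m : ℕ} (hx : supportLength S x ≤ m)
    (hy : supportLength S y ≤ m) : supportLength S (x + y) ≤ m := by
  classical
  rw [supportLength_le_iff] at *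
  intro γ hγ
  rw [MonoidAlgebra.coeff_add] at hγ
  rcases Finset.mem_union.mp (Finsupp.support_add hγ) with h | h
  · exact hx γ h
  · exact hy γ h

theorem supportLength_sum_le {ι : Type*} {s : Finset ι} {f : ι → MonoidAlgebra R Λ} {m : ℕ}
    (hf : ∀ i ∈ s, supportLength S (f i) ≤ m) : supportLength S (∑ i ∈ s, f i) ≤ m :=
  Finset.sum_induction _ (fun x => supportLength S x ≤ m) (fun _ _ => supportLength_add_le)
    (by rw [supportLength_zero]; exact Nat.zero_le _) hf

theorem supportLength_mul_le (hS : Subgroup.closure (S : Set Λ) = ⊤) (x y : MonoidAlgebra R Λ) :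
    supportLength S (x * y) ≤ supportLength S x + supportLength S y := by
  rw [MonoidAlgebra.mul_def, Finsupp.sum]
  refine supportLength_sum_le fun γ hγ => ?_
  rw [Finsupp.sum]
  refine supportLength_sum_le fun η hη => ?_
  exact (supportLength_single_le _ _).trans ((wordLength_mul_le hS γ η).trans
    (add_le_add (supportLength_le_iff.mp le_rfl γ hγ) (supportLength_le_iff.mp le_rfl η hη)))

theorem supportLength_one : supportLength S (1 : MonoidAlgebra R Λ) = 0 := by
  rw [MonoidAlgebra.one_def, ← Nat.le_zero]
  exact (supportLength_single_le _ _).trans wordLength_one.le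

theorem supportLength_pow_le (hS : Subgroup.closure (S : Set Λ) = ⊤) (x : MonoidAlgebra R Λ)
    (p : ℕ) : supportLength S (x ^ p) ≤ p * supportLength S x := by
  induction p with
  | zero => rw [pow_zero, supportLength_one]; exact Nat.zero_le _
  | succ p ih =>
    rw [pow_succ]
    refine (supportLength_mul_le hS _ _).trans ?_
    rw [Nat.succ_mul]
    exact Nat.add_le_add_right ih _

theorem supportLength_smul_le [Algebra ℝ R] (c : ℝ) (x : MonoidAlgebra R Λ) :
    supportLength S (c • x) ≤ supportLength S x := by
  rw [supportLength_le_iff]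
  intro γ hγ
  rw [MonoidAlgebra.coeff_smul] at hγ
  exact supportLength_le_iff.mp le_rfl γ (Finsupp.support_smul hγ)

end WordLength

/-! ### Expansion of expected traces of group algebra elements -/

section Growth

open Polynomial Chebyshev
open scoped Matrix.Norms.L2Operator

variable {Λ : Type*} [Group Λ] {S : Finset Λ} {d : ℕ}

theorem lOneNorm_one_le : lOneNorm (1 : MonoidAlgebra (Matrix (Fin d) (Fin d) ℂ) Λ) ≤ 1 := by
  rw [MonoidAlgebra.one_def, lOneNorm_single]
  rcases Nat.eq_zero_or_pos d with h | h
  · subst h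
    rw [Subsingleton.elim (1 : Matrix (Fin 0) (Fin 0) ℂ) 0, norm_zero]
    exact zero_le_one
  · have : Nonempty (Fin d) := ⟨⟨0, h⟩⟩
    exact norm_one.le

theorem lOneNorm_pow_le {x : MonoidAlgebra (Matrix (Fin d) (Fin d) ℂ) Λ} (hx : lOneNorm x ≤ 1)
    (p : ℕ) : lOneNorm (x ^ p) ≤ 1 := by
  induction p with
  | zero => rw [pow_zero]; exact lOneNorm_one_le
  | succ p ih =>
    rw [pow_succ]
    exact (lOneNorm_mul_le _ _).trans (mul_le_one₀ ih (lOneNorm_nonneg _) hx)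

/-- Induction on `T_{j+2} = 2X T_{j+1} - T_j`, using `2·3^{j+1} + 3^j ≤ 3^{j+2}`. Exponential growth
of the `ℓ¹` norm is harmless, as it is absorbed into the base of the error `(A/n)^q`. -/
theorem aeval_T_bound (hS : Subgroup.closure (S : Set Λ) = ⊤)
    {x : MonoidAlgebra (Matrix (Fin d) (Fin d) ℂ) Λ} (hx : lOneNorm x ≤ 1) {L : ℕ}
    (hL : supportLength S x ≤ L) (j : ℕ) :
    lOneNorm (aeval x (T ℝ j)) ≤ 3 ^ j ∧ supportLength S (aeval x (T ℝ j)) ≤ j * L := by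
  induction j using Nat.twoStepInduction with
  | zero =>
    simp only [Nat.cast_zero, T_zero, map_one, pow_zero, zero_mul]
    exact ⟨lOneNorm_one_le, supportLength_one.le⟩
  | one =>
    simp only [Nat.cast_one, T_one, aeval_X, pow_one, one_mul]
    exact ⟨hx.trans (by norm_num), hL⟩
  | more j h0 h1 =>
    have e : aeval x (T ℝ ((j + 2 : ℕ) : ℤ)) =
        (2 : ℝ) • (x * aeval x (T ℝ ((j + 1 : ℕ) : ℤ))) + (-1 : ℝ) • aeval x (T ℝ (j : ℤ)) := by
      have : T ℝ ((j + 2 : ℕ) : ℤ) =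
          (2 : ℝ) • (X * T ℝ ((j + 1 : ℕ) : ℤ)) + (-1 : ℝ) • T ℝ (j : ℤ) := by
        push_cast
        rw [T_add_two, neg_one_smul, ← sub_eq_add_neg, smul_eq_C_mul]
        simp only [map_ofNat]
        ring
      rw [this, map_add, map_smul, map_smul, map_mul, aeval_X]
    rw [e]
    constructor
    · refine (lOneNorm_add_le _ _).trans ?_
      rw [lOneNorm_smul, lOneNorm_smul, abs_neg, abs_one, abs_two, one_mul]
      have h2 : lOneNorm (x * aeval x (T ℝ ((j + 1 : ℕ) : ℤ))) ≤ 3 ^ (j + 1) := by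
        refine (lOneNorm_mul_le _ _).trans ?_
        calc _ ≤ 1 * lOneNorm (aeval x (T ℝ ((j + 1 : ℕ) : ℤ))) :=
              mul_le_mul_of_nonneg_right hx (lOneNorm_nonneg _)
          _ ≤ _ := by rw [one_mul]; exact h1.1
      have h3 : (3 : ℝ) ^ j ≤ 3 ^ (j + 1) := pow_le_pow_right₀ (by norm_num) (by omega)
      have h4 : (3 : ℝ) ^ (j + 2) = 3 * 3 ^ (j + 1) := by ring
      have := h0.1
      linarith
    · refine supportLength_add_le ((supportLength_smul_le _ _).trans
        ((supportLength_mul_le hS _ _).trans ?_)) ((supportLength_smul_le _ _).trans ?_)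
      · have := h1.2
        calc _ ≤ L + (j + 1) * L := add_le_add hL this
          _ = (j + 2) * L := by ring
      · exact h0.2.trans (Nat.mul_le_mul_right L (by omega))

/-- Justifies the choice `A = 3(κq)^κ`: it exceeds the threshold for `n` in hypothesis 1, and
`(A/n)^q` absorbs both `(Cq)^{Cq}` and the factor `3^q` from the `ℓ¹` norm. -/
theorem abs_le_of_expansion {C : ℝ} (hC : 1 ≤ C) {q n κ : ℕ} (hκ : C ≤ κ) (hq : 1 ≤ q) :
    C * (q : ℝ) ^ C ≤ (3 * (κ * q) ^ κ : ℕ) ∧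
    3 ^ q * ((C * q) ^ (C * q) / (n : ℝ) ^ q) ≤ (((3 * (κ * q) ^ κ : ℕ) : ℝ) / n) ^ q := by
  have hq1 : (1 : ℝ) ≤ q := by exact_mod_cast hq
  have hκ1 : (1 : ℝ) ≤ κ := hC.trans hκ
  have hκq : (1 : ℝ) ≤ κ * q := one_le_mul_of_one_le_of_one_le hκ1 hq1
  constructor
  · have h1 : C * (q : ℝ) ^ C ≤ κ * (q : ℝ) ^ κ := by
      rw [← Real.rpow_natCast (q : ℝ) κ]
      gcongr
    have h2 : (κ : ℝ) ≤ (κ : ℝ) ^ κ :=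
      le_self_pow₀ hκ1 (by rintro rfl; norm_num at hκ1)
    push_cast
    rw [mul_pow]
    have h3 : (κ : ℝ) * (q : ℝ) ^ κ ≤ (κ : ℝ) ^ κ * (q : ℝ) ^ κ := by gcongr
    have h4 : 0 ≤ (κ : ℝ) ^ κ * (q : ℝ) ^ κ := by positivity
    linarith
  · have h1 : (C * q) ^ (C * q) ≤ (((κ : ℝ) * q) ^ κ) ^ q := by
      rw [← pow_mul, ← Real.rpow_natCast]
      push_cast
      calc (C * q) ^ (C * q) ≤ ((κ : ℝ) * q) ^ (C * q) := by gcongr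
        _ ≤ ((κ : ℝ) * q) ^ ((κ : ℝ) * q) := by
            apply Real.rpow_le_rpow_of_exponent_le hκq
            gcongr
    push_cast
    rw [div_pow, mul_pow, ← mul_div_assoc]
    gcongr

/-- Origin of the exponent `3κ + 10 = 4 + 3(κ + 2)`, since `A + 8q²` is at most a constant times
`q^{κ+2}`. -/
theorem expansion_constant_le {q κ : ℕ} (hq : 1 ≤ q) :
    65 * (q : ℝ) ^ 4 * (((3 * (κ * q) ^ κ : ℕ) : ℝ) + 8 * (q : ℝ) ^ 2) ^ 3 ≤
      65 * (3 * (κ : ℝ) ^ κ + 8) ^ 3 * (q : ℝ) ^ (3 * κ + 10) := by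
  have hq1 : (1 : ℝ) ≤ q := by exact_mod_cast hq
  have h : ((3 * (κ * q) ^ κ : ℕ) : ℝ) + 8 * (q : ℝ) ^ 2 ≤
      (3 * (κ : ℝ) ^ κ + 8) * (q : ℝ) ^ (κ + 2) := by
    push_cast
    have h1 : (q : ℝ) ^ κ ≤ (q : ℝ) ^ (κ + 2) := pow_le_pow_right₀ hq1 (by omega)
    have h2 : (q : ℝ) ^ 2 ≤ (q : ℝ) ^ (κ + 2) := pow_le_pow_right₀ hq1 (by omega)
    rw [mul_pow, add_mul, mul_assoc]
    gcongr
  calc _ ≤ 65 * (q : ℝ) ^ 4 * ((3 * (κ : ℝ) ^ κ + 8) * (q : ℝ) ^ (κ + 2)) ^ 3 := by gcongr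
    _ = _ := by
      rw [mul_pow, ← pow_mul]
      have : (q : ℝ) ^ (3 * κ + 10) = q ^ 4 * q ^ ((κ + 2) * 3) := by
        rw [← pow_add]; congr 1; ring
      rw [this]; ring

/-- The expansion of `E[tr π_n(w)]` for an element `w` of the group algebra. -/
theorem element_expansion {Ω : ℕ → Type*} [∀ n, MeasurableSpace (Ω n)] {P : ∀ n, Measure (Ω n)}
    {π : ∀ n, Ω n → (Λ →* Matrix.unitaryGroup (Fin n) ℂ)} {C : ℝ} (hC : 1 ≤ C)
    {u : ℕ → Λ → ℝ} (hE : EffectiveExpansion S P π C u) {κ : ℕ} (hκ : C ≤ κ)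
    {w : MonoidAlgebra (Matrix (Fin d) (Fin d) ℂ) Λ} {q : ℕ} (hq : 2 ≤ q)
    (hsupp : supportLength S w ≤ q) (hnorm : lOneNorm w ≤ 3 ^ q) {F : ℕ → ℝ}
    (hF : ∀ n, F n = (coefTrace (fun γ => ∫ ω, (π n ω γ : Matrix (Fin n) (Fin n) ℂ).trace / (n : ℂ)
      ∂(P n)) w).re) (hF1 : ∀ n, 1 ≤ n → |F n| ≤ 1) {M : ℝ}
    (hM : M = 65 * (3 * (κ : ℝ) ^ κ + 8) ^ 3 * (q : ℝ) ^ (3 * κ + 10)) :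
    |(coefTrace (fun γ => (u 0 γ : ℂ)) w).re| ≤ M ∧
    |(coefTrace (fun γ => (u 1 γ : ℂ)) w).re| ≤ M ∧
    ∀ n : ℕ, 1 ≤ n → |F n - (coefTrace (fun γ => (u 0 γ : ℂ)) w).re -
      (coefTrace (fun γ => (u 1 γ : ℂ)) w).re / n| ≤ M / (n : ℝ) ^ 2 := by
  set U : ℕ → ℝ := fun k => (coefTrace (fun γ => (u k γ : ℂ)) w).re with hU
  have hκ1 : 1 ≤ κ := by exact_mod_cast hC.trans hκ
  have hA : 1 ≤ 3 * (κ * q) ^ κ := Nat.mul_pos (by norm_num) (Nat.pow_pos (Nat.mul_pos hκ1 (by omega)))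
  have key := expansion_bound (F := F) (U := U) (q := q) (A := 3 * (κ * q) ^ κ) hq hA hF1 (by
    intro n hn
    obtain ⟨hb1, hb2⟩ := abs_le_of_expansion hC (n := n) hκ (by omega : 1 ≤ q)
    have hn1 : 1 ≤ n := hA.trans hn
    have hnC : C * (q : ℝ) ^ C ≤ n := hb1.trans (by exact_mod_cast hn)
    -- `coefTrace` is linear in the function on `Λ` too, so the error for `w` is the functional
    -- applied to the errors for the group elements.
    have e : ((F n - ∑ k ∈ Finset.range q, U k / (n : ℝ) ^ k : ℝ)) =
        (coefTrace (fun γ => (∫ ω, (π n ω γ : Matrix (Fin n) (Fin n) ℂ).trace / (n : ℂ) ∂(P n)) -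
          ∑ k ∈ Finset.range q, (u k γ : ℂ) / (n : ℂ) ^ k) w).re := by
      have e1 : coefTrace (fun γ => (∫ ω, (π n ω γ : Matrix (Fin n) (Fin n) ℂ).trace / (n : ℂ)
          ∂(P n)) - ∑ k ∈ Finset.range q, (u k γ : ℂ) / (n : ℂ) ^ k) w =
          coefTrace (fun γ => ∫ ω, (π n ω γ : Matrix (Fin n) (Fin n) ℂ).trace / (n : ℂ)
          ∂(P n)) w - ∑ k ∈ Finset.range q, coefTrace (fun γ => (u k γ : ℂ)) w / (n : ℂ) ^ k := by
        simp only [coefTrace_apply, mul_sub, Finset.sum_sub_distrib, Finset.mul_sum,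
          Finset.sum_div]
        rw [Finset.sum_comm]
        simp only [mul_div_assoc]
      rw [e1, Complex.sub_re, Complex.re_sum, hF n]
      congr 1
      refine Finset.sum_congr rfl fun k _ => ?_
      rw [hU, show ((n : ℂ) ^ k) = (((n : ℝ) ^ k : ℝ) : ℂ) by push_cast; rfl,
        Complex.div_ofReal_re]
    rw [e]
    refine (Complex.abs_re_le_norm _).trans ((norm_coefTrace_le fun γ hγ => hE.2 γ q n
      ((supportLength_le_iff.mp hsupp) γ hγ) hn1 hnC).trans (le_trans ?_ hb2))
    gcongr)
  have hcst := expansion_constant_le (κ := κ) (by omega : 1 ≤ q)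
  rw [← hM] at hcst
  refine ⟨key.1.trans hcst, key.2.1.trans hcst, fun n hn => (key.2.2 n hn).trans ?_⟩
  gcongr

end Growth

/-! ### Eigenvalues of self-adjoint operators and a dimension count -/

section Eigenvalues

variable {E : Type*} [NormedAddCommGroup E] [InnerProductSpace ℂ E] [FiniteDimensional ℂ E] {m : ℕ}

open Classical in
/-- The eigenvalues of a self-adjoint operator on a space of dimension `m`, with multiplicity. -/
noncomputable def eigs (m : ℕ) (T : E →L[ℂ] E) : Fin m → ℝ :=
  if h : T.toLinearMap.IsSymmetric ∧ Module.finrank ℂ E = m then h.1.eigenvalues h.2 else 0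

theorem exists_eigenbasis {T : E →L[ℂ] E} (hT : T.toLinearMap.IsSymmetric)
    (hm : Module.finrank ℂ E = m) :
    ∃ b : OrthonormalBasis (Fin m) ℂ E, ∀ v i, b.repr (T v) i = eigs m T i * b.repr v i := by
  refine ⟨hT.eigenvectorBasis hm, fun v i => ?_⟩
  rw [eigs, dif_pos ⟨hT, hm⟩]
  exact hT.eigenvectorBasis_apply_self_apply hm v i

theorem apply_basis {T : E →L[ℂ] E} {b : OrthonormalBasis (Fin m) ℂ E} {t : Fin m → ℝ}
    (hb : ∀ v i, b.repr (T v) i = t i * b.repr v i) (i : Fin m) : T (b i) = (t i : ℂ) • b i := by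
  apply b.repr.injective
  ext j
  rw [hb, map_smul, PiLp.smul_apply, OrthonormalBasis.repr_self, smul_eq_mul]
  by_cases h : j = i
  · rw [h]
  · simp [h]

theorem aeval_apply_basis {T : E →L[ℂ] E} {b : OrthonormalBasis (Fin m) ℂ E} {t : Fin m → ℝ}
    (hb : ∀ v i, b.repr (T v) i = t i * b.repr v i) (Q : Polynomial ℝ) (i : Fin m) :
    Polynomial.aeval T Q (b i) = ((Q.eval (t i) : ℝ) : ℂ) • b i := by
  induction Q using Polynomial.induction_on' with
  | add p q hp hq =>
    rw [map_add, add_apply, hp, hq, Polynomial.eval_add, Complex.ofReal_add,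
      add_smul]
  | monomial k a =>
    have h : ∀ k : ℕ, (T ^ k) (b i) = ((t i ^ k : ℝ) : ℂ) • b i := by
      intro k
      induction k with
      | zero => simp
      | succ k ih =>
        rw [pow_succ]
        change (T ^ k) (T (b i)) = _
        rw [apply_basis hb, map_smul, ih, smul_smul, pow_succ]
        push_cast
        rw [mul_comm]
    rw [Polynomial.aeval_monomial, Polynomial.eval_monomial, Algebra.algebraMap_eq_smul_one,
      smul_mul_assoc, one_mul]
    change a • (T ^ k) (b i) = _
    rw [h]
    push_cast
    rw [mul_smul]
    exact (Complex.coe_smul a _).symm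

theorem trace_aeval {T : E →L[ℂ] E} (hT : T.toLinearMap.IsSymmetric)
    (hm : Module.finrank ℂ E = m) (Q : Polynomial ℝ) :
    LinearMap.trace ℂ E (Polynomial.aeval T Q).toLinearMap =
      ((∑ i, Q.eval (eigs m T i) : ℝ) : ℂ) := by
  obtain ⟨b, hb⟩ := exists_eigenbasis hT hm
  rw [LinearMap.trace_eq_sum_inner _ b]
  push_cast
  refine Finset.sum_congr rfl fun i _ => ?_
  change inner ℂ (b i) (Polynomial.aeval T Q (b i)) = _
  rw [aeval_apply_basis hb, inner_smul_right, inner_self_eq_norm_sq_to_K, b.norm_eq_one]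
  simp

theorem norm_sq_eq_sum_repr (b : OrthonormalBasis (Fin m) ℂ E) (v : E) :
    ‖v‖ ^ 2 = ∑ i, ‖b.repr v i‖ ^ 2 := by
  rw [← b.repr.norm_map, EuclideanSpace.norm_sq_eq]

theorem abs_eigs_le {T : E →L[ℂ] E} (hT : T.toLinearMap.IsSymmetric)
    (hm : Module.finrank ℂ E = m) (i : Fin m) : |eigs m T i| ≤ ‖T‖ := by
  obtain ⟨b, hb⟩ := exists_eigenbasis hT hm
  have h := T.le_opNorm (b i)
  rw [apply_basis hb, norm_smul, b.norm_eq_one, mul_one, mul_one, Complex.norm_real] at h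
  exact h

/-- In an eigenbasis the norm is at most the largest `|eigenvalue|`. Positivity of `c` excludes the
zero space, which has no eigenvalues. -/
theorem exists_le_abs_eigs {T : E →L[ℂ] E} (hT : T.toLinearMap.IsSymmetric)
    (hm : Module.finrank ℂ E = m) {c : ℝ} (hc : 0 < c) (h : c ≤ ‖T‖) :
    ∃ i, c ≤ |eigs m T i| := by
  by_contra! hcon
  obtain ⟨b, hb⟩ := exists_eigenbasis hT hm
  obtain ⟨c', hc'0, hc'c, hc'⟩ : ∃ c', 0 ≤ c' ∧ c' < c ∧ ∀ i, |eigs m T i| ≤ c' := by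
    rcases isEmpty_or_nonempty (Fin m) with hem | hne
    · exact ⟨0, le_rfl, hc, fun i => (hem.false i).elim⟩
    · obtain ⟨i₀, hi₀⟩ := Finite.exists_max fun i => |eigs m T i|
      exact ⟨_, abs_nonneg _, hcon i₀, hi₀⟩
  have : ‖T‖ ≤ c' := by
    refine ContinuousLinearMap.opNorm_le_bound _ hc'0 fun v => ?_
    refine le_of_sq_le_sq ?_ (by positivity)
    rw [mul_pow, norm_sq_eq_sum_repr b, norm_sq_eq_sum_repr b v, Finset.mul_sum]
    refine Finset.sum_le_sum fun i _ => ?_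
    rw [hb, norm_mul, mul_pow, Complex.norm_real, Real.norm_eq_abs]
    gcongr
    exact hc' i
  linarith

theorem le_norm_pow_apply {T : E →L[ℂ] E} {b : OrthonormalBasis (Fin m) ℂ E} {t : Fin m → ℝ}
    (hb : ∀ v i, b.repr (T v) i = t i * b.repr v i) {c : ℝ} (hc : 0 ≤ c) {v : E}
    (hv : ∀ i, b.repr v i ≠ 0 → c ≤ |t i|) (k : ℕ) : c ^ k * ‖v‖ ≤ ‖(T ^ k) v‖ := by
  have h : ∀ i, b.repr ((T ^ k) v) i = (t i : ℂ) ^ k * b.repr v i := by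
    intro i
    induction k with
    | zero => simp
    | succ k ih =>
      rw [pow_succ']
      change b.repr (T ((T ^ k) v)) i = _
      rw [hb, ih, pow_succ']
      ring
  refine le_of_sq_le_sq ?_ (norm_nonneg _)
  rw [mul_pow, norm_sq_eq_sum_repr b v, norm_sq_eq_sum_repr b ((T ^ k) v), Finset.mul_sum]
  refine Finset.sum_le_sum fun i _ => ?_
  rw [h, norm_mul, mul_pow, norm_pow, Complex.norm_real, Real.norm_eq_abs]
  by_cases h0 : b.repr v i = 0
  · rw [h0]; simp
  · gcongr
    exact hv i h0

theorem re_inner_le {T : E →L[ℂ] E} {b : OrthonormalBasis (Fin m) ℂ E} {t : Fin m → ℝ}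
    (hb : ∀ v i, b.repr (T v) i = t i * b.repr v i) {c : ℝ} {v : E}
    (hv : ∀ i, b.repr v i ≠ 0 → |t i| ≤ c) : (inner ℂ v (T v)).re ≤ c * ‖v‖ ^ 2 := by
  rw [← b.repr.inner_map_map, PiLp.inner_apply, Complex.re_sum, norm_sq_eq_sum_repr b,
    Finset.mul_sum]
  refine Finset.sum_le_sum fun i _ => ?_
  rw [hb]
  have : inner ℂ (b.repr v i) ((t i : ℂ) * b.repr v i) = ((t i * ‖b.repr v i‖ ^ 2 : ℝ) : ℂ) := by
    rw [← smul_eq_mul, inner_smul_right, inner_self_eq_norm_sq_to_K]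
    push_cast
    rfl
  rw [this, Complex.ofReal_re]
  by_cases h0 : b.repr v i = 0
  · rw [h0]; simp
  · gcongr
    exact (le_abs_self _).trans (hv i h0)

/-- Comparison of the numbers of large eigenvalues: if every vector on which all quadratic forms
`Z a` are small is contracted by `X ^ k`, then `X` has at most as many large eigenvalues as the
`Z a` altogether. -/
theorem card_eigs_le {α : Type*} [Fintype α] {X : E →L[ℂ] E} {Z : α → E →L[ℂ] E}
    (hX : X.toLinearMap.IsSymmetric) (hZ : ∀ a, (Z a).toLinearMap.IsSymmetric)
    (hm : Module.finrank ℂ E = m) {k : ℕ} {c : ℝ} (hc : 0 ≤ c) {c' : α → ℝ}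
    (h : ∀ v : E, v ≠ 0 → (∀ a, (inner ℂ v (Z a v)).re ≤ c' a * ‖v‖ ^ 2) →
      ‖(X ^ k) v‖ < c ^ k * ‖v‖) :
    (Finset.univ.filter fun i => c ≤ |eigs m X i|).card ≤
      ∑ a, (Finset.univ.filter fun i => c' a ≤ |eigs m (Z a) i|).card := by
  classical
  by_contra! hlt
  obtain ⟨b, hb⟩ := exists_eigenbasis hX hm
  choose bZ hbZ using fun a => exists_eigenbasis (hZ a) hm
  let I := {i : Fin m // c ≤ |eigs m X i|}
  let J := Σ a, {i : Fin m // c' a ≤ |eigs m (Z a) i|}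
  -- `Φ` parametrises the span of the eigenvectors of `X` with large eigenvalues; `G` records the
  -- components along the large eigenvectors of all `Z a`. If the claimed inequality failed, `G ∘ Φ`
  -- would map to a smaller space and have a kernel.
  let Φ : (I → ℂ) →ₗ[ℂ] E := Fintype.linearCombination ℂ (fun i : I => b i.1)
  let G : E →ₗ[ℂ] (J → ℂ) := LinearMap.pi fun p => (innerSL ℂ (bZ p.1 p.2.1)).toLinearMap
  have hker : LinearMap.ker (G ∘ₗ Φ) ≠ ⊥ := by
    apply LinearMap.ker_ne_bot_of_finrank_lt
    rw [Module.finrank_fintype_fun_eq_card, Module.finrank_fintype_fun_eq_card,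
      Fintype.card_sigma, Fintype.card_subtype]
    simpa [Fintype.card_subtype] using hlt
  obtain ⟨a, ha, ha0⟩ := Submodule.exists_mem_ne_zero_of_ne_bot hker
  have hΦ : ∀ i, b.repr (Φ a) i = if hi : c ≤ |eigs m X i| then a ⟨i, hi⟩ else 0 := by
    intro i
    rw [OrthonormalBasis.repr_apply_apply, Fintype.linearCombination_apply, inner_sum]
    simp only [inner_smul_right, b.inner_eq_ite]
    split_ifs with hi
    · rw [Finset.sum_eq_single ⟨i, hi⟩]
      · simp
      · intro j _ hj
        rw [if_neg, mul_zero]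
        intro e
        exact hj (Subtype.ext e.symm)
      · simp
    · refine Finset.sum_eq_zero fun j _ => ?_
      rw [if_neg, mul_zero]
      rintro rfl
      exact hi j.2
  have hv0 : Φ a ≠ 0 := by
    intro h0
    apply ha0
    funext i
    have := hΦ i.1
    rw [h0, map_zero, dif_pos i.2] at this
    simpa using this.symm
  -- A kernel vector has no component along eigenvectors of `Z p` with large eigenvalues, so its
  -- quadratic form is small and `X ^ k` contracts it. Its lying in the span for `X` gives the
  -- opposite inequality.
  have h1 := h (Φ a) hv0 fun p => by
    refine re_inner_le (hbZ p) fun i hi => ?_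
    by_contra! hcon
    apply hi
    have := congrFun (LinearMap.mem_ker.mp ha) ⟨p, ⟨i, hcon.le⟩⟩
    rw [OrthonormalBasis.repr_apply_apply]
    exact this
  have h2 := le_norm_pow_apply hb hc (v := Φ a) (fun i hi => by
    rw [hΦ] at hi
    by_contra hcon
    exact hi (dif_neg hcon)) k
  linarith

end Eigenvalues

/-! ### Traces of tensor products -/

section Trace

open scoped Matrix.Norms.L2Operator

variable {d n : ℕ} {Λ : Type*} [Group Λ]

theorem trace_matTensor (A : Matrix (Fin d) (Fin d) ℂ) (B : Matrix (Fin n) (Fin n) ℂ) :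
    LinearMap.trace ℂ (PiLp 2 fun _ : Fin d => EuclideanSpace ℂ (Fin n))
      (matTensor A (Matrix.toEuclideanCLM (n := Fin n) (𝕜 := ℂ) B)).toLinearMap =
      A.trace * B.trace := by
  rw [LinearMap.trace_eq_sum_inner _ (Pi.orthonormalBasis fun _ : Fin d =>
    EuclideanSpace.basisFun (Fin n) ℂ), Fintype.sum_sigma, Matrix.trace, Matrix.trace,
    Finset.sum_mul_sum]
  refine Finset.sum_congr rfl fun i _ => Finset.sum_congr rfl fun k _ => ?_
  rw [Pi.orthonormalBasis_apply]
  change inner ℂ _ (matTensor A (Matrix.toEuclideanCLM (n := Fin n) (𝕜 := ℂ) B) _) = _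
  rw [PiLp.inner_apply, Finset.sum_eq_single i]
  · rw [matTensor_apply, Finset.sum_eq_single i]
    · simp [EuclideanSpace.inner_single_left]
    · intro j _ hj
      simp [hj]
    · simp
  · intro j _ hj
    simp [hj]
  · simp

theorem trace_idTensor (hd : d ≠ 0) (hn : n ≠ 0) (ρ : Λ →* Matrix.unitaryGroup (Fin n) ℂ)
    (w : MonoidAlgebra (Matrix (Fin d) (Fin d) ℂ) Λ) :
    LinearMap.trace ℂ _ (idTensor (unitaryRep ρ) w).toLinearMap =
      (d * n : ℂ) * coefTrace (fun γ => (ρ γ : Matrix (Fin n) (Fin n) ℂ).trace / (n : ℂ)) w := by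
  have hd' : (d : ℂ) ≠ 0 := by exact_mod_cast hd
  have hn' : (n : ℂ) ≠ 0 := by exact_mod_cast hn
  induction w using MonoidAlgebra.induction_linear with
  | zero =>
    rw [← idTensorHom_apply, map_zero, map_zero, mul_zero]
    exact map_zero _
  | add x y hx hy =>
    rw [← idTensorHom_apply, map_add, map_add, idTensorHom_apply, idTensorHom_apply, mul_add,
      ← hx, ← hy]
    exact map_add (LinearMap.trace ℂ _) _ _
  | single γ A =>
    rw [idTensor_single, coefTrace_single]
    have := trace_matTensor A (ρ γ : Matrix (Fin n) (Fin n) ℂ)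
    refine this.trans ?_
    field_simp

theorem finrank_power : Module.finrank ℂ (PiLp 2 fun _ : Fin d => EuclideanSpace ℂ (Fin n)) =
    d * n := by
  rw [LinearEquiv.finrank_eq (WithLp.linearEquiv 2 ℂ (Fin d → EuclideanSpace ℂ (Fin n)))]
  rw [Module.finrank_pi_fintype]
  simp

end Trace

/-! ### The random matrices fit the abstract expansion -/

section Model

open Polynomial Chebyshev
open scoped Matrix.Norms.L2Operator

theorem norm_aeval_le {E : Type*} [NormedAddCommGroup E] [InnerProductSpace ℂ E] [CompleteSpace E]
    {a : E →L[ℂ] E} (ha : IsSelfAdjoint a) (Q : ℝ[X]) {c : ℝ} (hc : 0 ≤ c)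
    (h : ∀ x, |x| ≤ ‖a‖ → |Q.eval x| ≤ c) : ‖aeval a Q‖ ≤ c := by
  rw [← cfc_polynomial Q a ha]
  refine norm_cfc_le hc fun x hx => h x ?_
  refine (spectrum.norm_le_norm_mul_of_mem hx).trans ?_
  exact mul_le_of_le_one_right (norm_nonneg _) ContinuousLinearMap.norm_id_le

theorem abs_sub_sum_le {b : ℤ → ℝ} (hb : Summable fun j => |b j|) {x a : ℝ} (hx : |x| ≤ 1)
    (h : HasSum (fun j : ℤ => b j * (T ℝ j).eval x) a) (F : Finset ℤ) :
    |a - ∑ j ∈ F, b j * (T ℝ j).eval x| ≤ (∑' j, |b j|) - ∑ j ∈ F, |b j| := by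
  have h1 := (Finset.hasSum_compl_iff F (f := fun j : ℤ => b j * (T ℝ j).eval x)
    (a := a - ∑ j ∈ F, b j * (T ℝ j).eval x)).mpr (by simpa using h)
  have h2 := (Finset.hasSum_compl_iff F (f := fun j : ℤ => |b j|)
    (a := (∑' j, |b j|) - ∑ j ∈ F, |b j|)).mpr (by simpa using hb.hasSum)
  rw [← h1.tsum_eq, ← Real.norm_eq_abs]
  refine tsum_of_norm_bounded h2 fun j => ?_
  rw [Real.norm_eq_abs, abs_mul]
  exact mul_le_of_le_one_right (abs_nonneg _) (abs_eval_T_real_le_one _ hx)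

variable {Λ : Type*} [Group Λ] {d : ℕ}

open Classical in
/-- The vector `δ_e` of `ℓ²(Λ)`. -/
noncomputable def deltaOne (Λ : Type*) [Group Λ] : Ell2 Λ := lp.single 2 (1 : Λ) (1 : ℂ)

theorem norm_deltaOne : ‖deltaOne Λ‖ = 1 := by
  classical
  exact (lp.norm_single (by norm_num) _ _).trans norm_one

theorem canonicalTrace_eq (a : Ell2 Λ →L[ℂ] Ell2 Λ) :
    canonicalTrace a = inner ℂ (deltaOne Λ) (a (deltaOne Λ)) := rfl

theorem coefTrace_leftRegular (w : MonoidAlgebra (Matrix (Fin d) (Fin d) ℂ) Λ) :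
    coefTrace (fun γ => canonicalTrace (leftRegular Λ γ)) w =
      (∑ i : Fin d, inner ℂ (PiLp.single 2 i (deltaOne Λ) : PiLp 2 fun _ : Fin d => Ell2 Λ)
        (idTensor (leftRegular Λ) w (PiLp.single 2 i (deltaOne Λ)))) / d := by
  induction w using MonoidAlgebra.induction_linear with
  | zero =>
    rw [← idTensorHom_apply, map_zero, map_zero]
    simp
  | add x y hx hy =>
    rw [← idTensorHom_apply, map_add, map_add, idTensorHom_apply, idTensorHom_apply, hx, hy,
      ← add_div, ← Finset.sum_add_distrib]
    congr 1
    refine Finset.sum_congr rfl fun i _ => ?_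
    rw [← inner_add_right]
    rfl
  | single γ A =>
    rw [idTensor_single, coefTrace_single, Matrix.trace, div_mul_eq_mul_div, Finset.sum_mul]
    congr 1
    refine Finset.sum_congr rfl fun i _ => ?_
    rw [PiLp.inner_apply, Finset.sum_eq_single i]
    · rw [matTensor_apply, Finset.sum_eq_single i]
      · simp only [PiLp.single_apply, inner_smul_right, canonicalTrace_eq,
          Matrix.diag_apply, if_true]
      · intro j _ hj
        simp [hj]
      · simp
    · intro j _ hj
      simp [hj]
    · simp

/-- The functional is an average of the vector states at `e_i ⊗ δ_e`. This bound confines the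
zeroth-order term to `[-s, s]`, with `s` the norm in the regular representation. -/
theorem norm_coefTrace_leftRegular_le (w : MonoidAlgebra (Matrix (Fin d) (Fin d) ℂ) Λ) :
    ‖coefTrace (fun γ => canonicalTrace (leftRegular Λ γ)) w‖ ≤ ‖idTensor (leftRegular Λ) w‖ := by
  rw [coefTrace_leftRegular, norm_div, Complex.norm_natCast]
  refine div_le_of_le_mul₀ (Nat.cast_nonneg _) (norm_nonneg _) ?_
  have hterm : ∀ i : Fin d, ‖(inner ℂ
      (PiLp.single 2 i (deltaOne Λ) : PiLp 2 fun _ : Fin d => Ell2 Λ)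
      (idTensor (leftRegular Λ) w (PiLp.single 2 i (deltaOne Λ))) : ℂ)‖ ≤
      ‖idTensor (leftRegular Λ) w‖ := by
    intro i
    refine (norm_inner_le_norm _ _).trans ?_
    have h1 : ‖(PiLp.single 2 i (deltaOne Λ) : PiLp 2 fun _ : Fin d => Ell2 Λ)‖ = 1 := by
      rw [PiLp.norm_single, norm_deltaOne]
    have h2 := (idTensor (leftRegular Λ) w).le_opNorm (PiLp.single 2 i (deltaOne Λ))
    rw [h1, mul_one] at h2
    rw [h1, one_mul]
    exact h2
  refine (norm_sum_le_of_le _ fun i _ => hterm i).trans ?_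
  simp [mul_comm]

variable {S : Finset Λ} {Ω : ℕ → Type*} [∀ n, MeasurableSpace (Ω n)] {P : ∀ n, Measure (Ω n)}
  {π : ∀ n, Ω n → (Λ →* Matrix.unitaryGroup (Fin n) ℂ)} {u : ℕ → Λ → ℝ}

/-- The coefficient functional of `E[tr Q(X_n)]` for `X_n = [id ⊗ π_n](y)`. -/
noncomputable def coefPoly (v : Λ → ℝ) (y : MonoidAlgebra (Matrix (Fin d) (Fin d) ℂ) Λ)
    (Q : ℝ[X]) : ℝ :=
  (coefTrace (fun γ => (v γ : ℂ)) (aeval y Q)).re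

/-- The eigenvalues of `[id ⊗ π_n](y)`. -/
noncomputable def modelEigs (π : ∀ n, Ω n → (Λ →* Matrix.unitaryGroup (Fin n) ℂ))
    (y : MonoidAlgebra (Matrix (Fin d) (Fin d) ℂ) Λ) (n : ℕ) (ω : Ω n) : Fin (d * n) → ℝ :=
  eigs (d * n) (idTensor (unitaryRep (π n ω)) y)

theorem isSymmetric_model {y : MonoidAlgebra (Matrix (Fin d) (Fin d) ℂ) Λ} (hy : groupStar y = y)
    {n : ℕ} (ρ : Λ →* Matrix.unitaryGroup (Fin n) ℂ) :
    (idTensor (unitaryRep ρ) y).toLinearMap.IsSymmetric :=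
  ContinuousLinearMap.isSelfAdjoint_iff_isSymmetric.mp
    (isSelfAdjoint_idTensor _ (unitaryRep_inv ρ) hy)

/-- The trace of `Q(X_n)` is computed in an eigenbasis and, separately, by linearity over the group
elements. -/
theorem sum_eval_modelEigs {y : MonoidAlgebra (Matrix (Fin d) (Fin d) ℂ) Λ} (hy : groupStar y = y)
    (hd : d ≠ 0) {n : ℕ} (hn : n ≠ 0) (ω : Ω n) (Q : ℝ[X]) :
    ∑ i, Q.eval (modelEigs π y n ω i) = (d * n : ℝ) * (coefTrace (fun γ =>
      (π n ω γ : Matrix (Fin n) (Fin n) ℂ).trace / (n : ℂ)) (aeval y Q)).re := by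
  have h1 := trace_aeval (isSymmetric_model hy (π n ω)) finrank_power Q
  have h2 := trace_idTensor hd hn (π n ω) (aeval y Q)
  rw [idTensor_aeval, h1] at h2
  have h3 := congrArg Complex.re h2
  rw [Complex.ofReal_re, show ((d : ℂ) * n) = (((d * n : ℝ)) : ℂ) by push_cast; rfl,
    Complex.re_ofReal_mul] at h3
  exact h3

theorem norm_trace_div_le_one {n : ℕ} (U : Matrix.unitaryGroup (Fin n) ℂ) :
    ‖(U : Matrix (Fin n) (Fin n) ℂ).trace / (n : ℂ)‖ ≤ 1 := by
  refine (norm_trace_div_le _).trans ?_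
  rcases Nat.eq_zero_or_pos n with h | h
  · subst h
    rw [Subsingleton.elim (U : Matrix (Fin 0) (Fin 0) ℂ) 0, norm_zero]
    exact zero_le_one
  · have : Nonempty (Fin n) := ⟨⟨0, h⟩⟩
    exact (CStarRing.norm_of_mem_unitary U.2).le

variable [∀ n, IsProbabilityMeasure (P n)]
  (hmeas : ∀ (n : ℕ) (γ : Λ) (i j : Fin n),
    Measurable fun ω => (π n ω γ : Matrix (Fin n) (Fin n) ℂ) i j)

include hmeas

omit [∀ n, IsProbabilityMeasure (P n)] in
theorem measurable_trace (n : ℕ) (γ : Λ) :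
    Measurable fun ω => (π n ω γ : Matrix (Fin n) (Fin n) ℂ).trace / (n : ℂ) := by
  refine Measurable.div_const ?_ _
  simp only [Matrix.trace, Matrix.diag_apply]
  exact Finset.measurable_sum _ fun i _ => hmeas n γ i i

theorem integrable_trace (n : ℕ) (γ : Λ) :
    Integrable (fun ω => (π n ω γ : Matrix (Fin n) (Fin n) ℂ).trace / (n : ℂ)) (P n) :=
  Integrable.of_bound (measurable_trace hmeas n γ).aestronglyMeasurable 1
    (ae_of_all _ fun _ => norm_trace_div_le_one _)

theorem integral_coefTrace (n : ℕ) (w : MonoidAlgebra (Matrix (Fin d) (Fin d) ℂ) Λ) :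
    (coefTrace (fun γ => ∫ ω, (π n ω γ : Matrix (Fin n) (Fin n) ℂ).trace / (n : ℂ) ∂(P n)) w).re =
      ∫ ω, (coefTrace (fun γ => (π n ω γ : Matrix (Fin n) (Fin n) ℂ).trace / (n : ℂ)) w).re
        ∂(P n) := by
  simp only [coefTrace_apply]
  have hint : ∀ γ : Λ, Integrable (fun ω => (w.coeff γ).trace / d *
      ((π n ω γ : Matrix (Fin n) (Fin n) ℂ).trace / (n : ℂ))) (P n) := fun γ =>
    (integrable_trace hmeas n γ).const_mul _
  have h := integral_re (𝕜 := ℂ) (f := fun ω => ∑ γ ∈ w.coeff.support, (w.coeff γ).trace / d *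
      ((π n ω γ : Matrix (Fin n) (Fin n) ℂ).trace / (n : ℂ))) (μ := P n)
      (integrable_finsetSum _ fun γ _ => hint γ)
  refine Eq.trans ?_ h.symm
  rw [integral_finsetSum _ fun γ _ => hint γ]
  simp only [integral_const_mul]
  rfl

theorem integral_modelEigs {y : MonoidAlgebra (Matrix (Fin d) (Fin d) ℂ) Λ} (hy : groupStar y = y)
    (hd : d ≠ 0) {n : ℕ} (hn : n ≠ 0) (Q : ℝ[X]) :
    ∫ ω, (∑ i, Q.eval (modelEigs π y n ω i)) / (d * n : ℝ) ∂(P n) =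
      (coefTrace (fun γ => ∫ ω, (π n ω γ : Matrix (Fin n) (Fin n) ℂ).trace / (n : ℂ) ∂(P n))
        (aeval y Q)).re := by
  rw [integral_coefTrace hmeas]
  refine integral_congr_ae (ae_of_all _ fun ω => ?_)
  have hd' : (d : ℝ) ≠ 0 := by exact_mod_cast hd
  have hn' : (n : ℝ) ≠ 0 := by exact_mod_cast hn
  simp only
  rw [sum_eval_modelEigs hy hd hn]
  field_simp

theorem poly_expansion {C : ℝ} (hC : 1 ≤ C)
    (hE : EffectiveExpansion S P π C u) {κ : ℕ} (hκ : C ≤ κ)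
    {y : MonoidAlgebra (Matrix (Fin d) (Fin d) ℂ) Λ} (hy : groupStar y = y) (hd : d ≠ 0)
    (hy1 : lOneNorm y ≤ 1) {L : ℕ} {Q : ℝ[X]} {j : ℕ}
    (hQ : ∀ x, |x| ≤ 1 → |Q.eval x| ≤ 1) (hQ1 : lOneNorm (aeval y Q) ≤ 3 ^ j)
    (hQ2 : supportLength S (aeval y Q) ≤ j * L) {M : ℝ}
    (hM : M = 65 * (3 * (κ : ℝ) ^ κ + 8) ^ 3 * ((L : ℝ) + 3) ^ (3 * κ + 10) *
      ((j : ℝ) + 1) ^ (3 * κ + 10)) :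
    |coefPoly (u 0) y Q| ≤ M ∧ |coefPoly (u 1) y Q| ≤ M ∧
    ∀ n : ℕ, 1 ≤ n → |(∫ ω, (∑ i, Q.eval (modelEigs π y n ω i)) / (d * n : ℝ) ∂(P n)) -
      coefPoly (u 0) y Q - coefPoly (u 1) y Q / n| ≤ M / (n : ℝ) ^ 2 := by
  have hbd : ∀ (n : ℕ) (ω : Ω n), |∑ i, Q.eval (modelEigs π y n ω i)| ≤ d * n := by
    intro n ω
    refine (Finset.abs_sum_le_sum_abs _ _).trans ((Finset.sum_le_card_nsmul _ _ 1 fun i _ =>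
      hQ _ ?_).trans (by simp))
    exact (abs_eigs_le (isSymmetric_model hy (π n ω)) finrank_power i).trans
      ((norm_idTensor_le_lOneNorm _ (norm_unitaryRep_le _) _).trans hy1)
  -- This `q` bounds the support length `jL`, and also `j` (even if `L = 0`), so that `3^j ≤ 3^q`;
  -- the `+ 2` gives `q ≥ 2` when `j = 0`. The final bound uses `q ≤ (L + 3)(j + 1)`.
  set q := j * (L + 1) + 2 with hq
  have key := element_expansion hC hE hκ (d := d) (w := aeval y Q) (q := q) (by omega)
    (hQ2.trans (by rw [hq]; nlinarith)) (hQ1.trans (pow_le_pow_right₀ (by norm_num) (by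
      rw [hq]; nlinarith)))
    (F := fun n => (coefTrace (fun γ => ∫ ω, (π n ω γ : Matrix (Fin n) (Fin n) ℂ).trace / (n : ℂ)
      ∂(P n)) (aeval y Q)).re) (fun n => rfl) (fun n hn => by
        rw [← integral_modelEigs hmeas hy hd (by omega : n ≠ 0), ← Real.norm_eq_abs]
        refine (norm_integral_le_of_norm_le_const (C := 1) (ae_of_all _ fun ω => ?_)).trans
          (by simp)
        have h0 : (0 : ℝ) ≤ (d : ℝ) * n := by positivity
        rw [norm_div, Real.norm_of_nonneg h0]
        exact div_le_one_of_le₀ (hbd n ω) h0) rfl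
  have hMle : 65 * (3 * (κ : ℝ) ^ κ + 8) ^ 3 * (q : ℝ) ^ (3 * κ + 10) ≤ M := by
    rw [hM, mul_assoc _ (((L : ℝ) + 3) ^ _), ← mul_pow]
    gcongr
    rw [hq]
    push_cast
    nlinarith [Nat.cast_nonneg (α := ℝ) j, Nat.cast_nonneg (α := ℝ) L]
  refine ⟨key.1.trans hMle, key.2.1.trans hMle, fun n hn => ?_⟩
  rw [integral_modelEigs hmeas hy hd (by omega : n ≠ 0)]
  refine (key.2.2 n hn).trans ?_
  gcongr

theorem expansionData (hS : Subgroup.closure (S : Set Λ) = ⊤) {C : ℝ} (hC : 1 ≤ C)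
    (hE : EffectiveExpansion S P π C u) {κ : ℕ} (hκ : C ≤ κ)
    {y : MonoidAlgebra (Matrix (Fin d) (Fin d) ℂ) Λ} (hy : groupStar y = y) (hd : d ≠ 0)
    (hy1 : lOneNorm y ≤ 1) {L : ℕ} (hL : supportLength S y ≤ L) :
    ExpansionData P d (modelEigs π y) (coefPoly (u 0) y) (coefPoly (u 1) y)
      ‖idTensor (leftRegular Λ) y‖
      (65 * (3 * (κ : ℝ) ^ κ + 8) ^ 3 * ((L : ℝ) + 3) ^ (3 * κ + 10)) (3 * κ + 10) := by
  have hT : ∀ j : ℤ, T ℝ j = T ℝ (j.natAbs : ℤ) := fun j => (T_natAbs ℝ j).symm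
  have hTj := fun j : ℤ => poly_expansion hmeas hC hE hκ hy hd hy1 (L := L)
    (Q := T ℝ j) (j := j.natAbs) (fun x hx => abs_eval_T_real_le_one j hx)
    (by rw [hT]; exact (aeval_T_bound hS hy1 hL _).1)
    (by rw [hT]; exact (aeval_T_bound hS hy1 hL _).2) rfl
  have hcast : ∀ j : ℤ, ((j.natAbs : ℕ) : ℝ) = |(j : ℝ)| := fun j => by
    rw [Nat.cast_natAbs, Int.cast_abs]
  simp only [hcast] at hTj
  have hs1 : ‖idTensor (leftRegular Λ) y‖ ≤ 1 :=
    (norm_idTensor_le_lOneNorm _ norm_leftRegular_le _).trans hy1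
  refine ⟨fun n ω i => ?_, fun n Q => ?_, by positivity, fun j => (hTj j).1, fun j => (hTj j).2.1,
    fun j n hn => (hTj j).2.2 n hn, fun p => ?_, fun b Q hb hsum => ?_⟩
  · exact (abs_eigs_le (isSymmetric_model hy (π n ω)) finrank_power i).trans
      ((norm_idTensor_le_lOneNorm _ (norm_unitaryRep_le _) _).trans hy1)
  · rcases Nat.eq_zero_or_pos n with h | h
    · subst h
      have : IsEmpty (Fin (d * 0)) := by rw [mul_zero]; infer_instance
      simp
    -- Measurability of single eigenvalues is avoided: the symmetric sums are traces, finite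
    -- combinations of measurable matrix entries.
    · simp only [sum_eval_modelEigs hy hd h.ne', coefTrace_apply]
      refine Measurable.const_mul (Complex.measurable_re.comp ?_) _
      exact Finset.measurable_sum _ fun γ _ => (measurable_trace hmeas n γ).const_mul _
  · have h := poly_expansion hmeas hC hE hκ hy hd hy1 (L := L)
      (Q := X ^ p) (j := p) (fun x hx => by
        rw [eval_pow, eval_X, abs_pow]; exact pow_le_one₀ (abs_nonneg _) hx)
      (by
        rw [map_pow, aeval_X]
        exact (lOneNorm_pow_le hy1 p).trans (one_le_pow₀ (by norm_num)))
      (by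
        rw [map_pow, aeval_X]
        exact (supportLength_pow_le hS y p).trans (Nat.mul_le_mul_left p hL)) rfl
    refine ⟨65 * (3 * (κ : ℝ) ^ κ + 8) ^ 3 * ((L : ℝ) + 3) ^ (3 * κ + 10) *
      ((p : ℝ) + 1) ^ (3 * κ + 10), fun n hn => ?_⟩
    have h2 := h.2.2 n hn
    simp only [eval_pow, eval_X] at h2
    exact h2
  -- By functional calculus, the difference between `Q` and a partial sum has operator norm at most
  -- its supremum on `[-s, s]`. The tail of `∑ |b_j|` bounds this, and `U₀` is dominated by the
  -- operator norm.
  · have hsa := isSelfAdjoint_idTensor (leftRegular Λ) leftRegular_inv hy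
    have hbound : ∀ R : ℝ[X], |coefPoly (u 0) y R| ≤ ‖aeval (idTensor (leftRegular Λ) y) R‖ := by
      intro R
      refine ((Complex.abs_re_le_norm _).trans ?_).trans_eq
        (congrArg norm (idTensor_aeval (leftRegular Λ) y R))
      have : (fun γ => (u 0 γ : ℂ)) = fun γ => canonicalTrace (leftRegular Λ γ) := by
        funext γ; exact hE.1 γ
      rw [this]
      exact norm_coefTrace_leftRegular_le _
    have hadd : ∀ F : Finset ℤ, coefPoly (u 0) y Q - ∑ j ∈ F, b j * coefPoly (u 0) y (T ℝ j) =
        coefPoly (u 0) y (Q - ∑ j ∈ F, b j • T ℝ j) := by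
      intro F
      simp only [coefPoly, map_sub, map_sum, map_smul, Complex.sub_re, Complex.re_sum]
      congr 1
      refine Finset.sum_congr rfl fun j _ => ?_
      rw [← Complex.coe_smul, map_smul, smul_eq_mul, Complex.re_ofReal_mul]
    have hle : ∀ F : Finset ℤ, |coefPoly (u 0) y Q - ∑ j ∈ F, b j * coefPoly (u 0) y (T ℝ j)| ≤
        (∑' j, |b j|) - ∑ j ∈ F, |b j| := by
      intro F
      rw [hadd]
      have h0 : 0 ≤ (∑' j, |b j|) - ∑ j ∈ F, |b j| :=
        sub_nonneg.mpr (hb.sum_le_tsum F fun j _ => abs_nonneg _)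
      refine (hbound _).trans (norm_aeval_le hsa _ h0 fun x hx => ?_)
      have := abs_sub_sum_le hb (hx.trans hs1) (hsum x hx) F
      simpa [eval_finsetSum] using this
    refine HasSum.tsum_eq ?_
    rw [HasSum, tendsto_iff_norm_sub_tendsto_zero]
    have hlim : Tendsto (fun F : Finset ℤ => (∑' j, |b j|) - ∑ j ∈ F, |b j|) atTop (nhds 0) := by
      have := (tendsto_const_nhds (x := ∑' j, |b j|)).sub hb.hasSum
      simpa using this
    refine squeeze_zero (fun _ => norm_nonneg _) (fun F => ?_) hlim
    rw [Real.norm_eq_abs, abs_sub_comm]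
    exact hle F

end Model

/-! ### Reduction from matrix to scalar coefficients -/

section Scalar

open scoped Matrix.Norms.L2Operator

variable {Λ : Type*} [Group Λ] {d : ℕ}

/-- The embedding `z ↦ 1 ⊗ z` of `ℂ[Λ]` into `M_d(ℂ) ⊗ ℂ[Λ]`. -/
noncomputable def scalar (Λ : Type*) [Group Λ] (d : ℕ) :
    MonoidAlgebra ℂ Λ →ₐ[ℂ] MonoidAlgebra (Matrix (Fin d) (Fin d) ℂ) Λ :=
  MonoidAlgebra.lift ℂ _ Λ (MonoidAlgebra.of (Matrix (Fin d) (Fin d) ℂ) Λ)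

theorem scalar_single (γ : Λ) (a : ℂ) :
    scalar Λ d (MonoidAlgebra.single γ a) = MonoidAlgebra.single γ (a • 1) := by
  rw [scalar, MonoidAlgebra.lift_single, MonoidAlgebra.of_apply, MonoidAlgebra.smul_single]

/-- The `(i, j)` coefficient of an element of `M_d(ℂ) ⊗ ℂ[Λ] = M_d(ℂ[Λ])`. -/
noncomputable def entry (i j : Fin d) (x : MonoidAlgebra (Matrix (Fin d) (Fin d) ℂ) Λ) :
    MonoidAlgebra ℂ Λ :=
  x.coeff.sum fun γ A => MonoidAlgebra.single γ (A i j)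

theorem entry_single (i j : Fin d) (γ : Λ) (A : Matrix (Fin d) (Fin d) ℂ) :
    entry i j (MonoidAlgebra.single γ A) = MonoidAlgebra.single γ (A i j) := by
  rw [entry, MonoidAlgebra.coeff_single, Finsupp.sum_single_index (by simp)]

theorem entry_add (i j : Fin d) (x y : MonoidAlgebra (Matrix (Fin d) (Fin d) ℂ) Λ) :
    entry i j (x + y) = entry i j x + entry i j y := by
  rw [entry, entry, entry, MonoidAlgebra.coeff_add, Finsupp.sum_add_index']
  · intro γ; simp
  · intro γ A B; rw [Matrix.add_apply, MonoidAlgebra.single_add]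

variable {H : Type*} [NormedAddCommGroup H] [InnerProductSpace ℂ H] [CompleteSpace H]

theorem idTensor_apply (ρ : Λ →* (H →L[ℂ] H)) (x : MonoidAlgebra (Matrix (Fin d) (Fin d) ℂ) Λ)
    (v : PiLp 2 fun _ : Fin d => H) (i : Fin d) :
    idTensor ρ x v i = ∑ j, MonoidAlgebra.lift ℂ (H →L[ℂ] H) Λ ρ (entry i j x) (v j) := by
  induction x using MonoidAlgebra.induction_linear with
  | zero => simp [idTensor, entry]
  | add x y hx hy =>
    simp only [entry_add, map_add, add_apply, Finset.sum_add_distrib]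
    rw [← hx, ← hy, ← idTensorHom_apply, map_add, idTensorHom_apply, idTensorHom_apply]
    rfl
  | single γ A =>
    rw [idTensor_single, matTensor_apply]
    refine Finset.sum_congr rfl fun j _ => ?_
    rw [entry_single, MonoidAlgebra.lift_single]
    rfl

theorem idTensor_scalar (ρ : Λ →* (H →L[ℂ] H)) (z : MonoidAlgebra ℂ Λ) :
    idTensor ρ (scalar Λ d z) = matTensor 1 (MonoidAlgebra.lift ℂ (H →L[ℂ] H) Λ ρ z) := by
  ext v i
  rw [idTensor_apply, matTensor_apply]
  refine Finset.sum_congr rfl fun j _ => ?_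
  rw [← smul_apply, ← map_smul]
  congr 2
  induction z using MonoidAlgebra.induction_linear with
  | zero => simp [entry]
  | add x y hx hy => rw [map_add, entry_add, hx, hy, smul_add]
  | single γ a =>
    rw [scalar_single, entry_single, MonoidAlgebra.smul_single, Matrix.smul_apply, smul_eq_mul,
      smul_eq_mul, mul_comm]

theorem groupStar_scalar (z : MonoidAlgebra ℂ Λ) :
    groupStar (scalar Λ d z) = scalar Λ d (groupStar z) := by
  induction z using MonoidAlgebra.induction_linear with
  | zero => rw [map_zero, groupStar_zero, groupStar_zero, map_zero]
  | add x y hx hy => rw [map_add, groupStar_add, hx, hy, groupStar_add, map_add]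
  | single γ a =>
    rw [scalar_single, groupStar_single, groupStar_single, scalar_single, star_smul, star_one]

theorem coefTrace_scalar (hd : d ≠ 0) (u : Λ → ℝ) (z : MonoidAlgebra ℂ Λ) :
    coefTrace (fun γ => (u γ : ℂ)) (scalar Λ d z) = extendLinear u z := by
  have hd' : (d : ℂ) ≠ 0 := by exact_mod_cast hd
  induction z using MonoidAlgebra.induction_linear with
  | zero => simp [extendLinear]
  | add x y hx hy =>
    rw [map_add, map_add, hx, hy, extendLinear, extendLinear, extendLinear,
      MonoidAlgebra.coeff_add, Finsupp.sum_add_index']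
    · simp
    · intro γ a b; ring
  | single γ a =>
    rw [scalar_single, coefTrace_single, extendLinear, MonoidAlgebra.coeff_single,
      Finsupp.sum_single_index (by simp), Matrix.trace_smul, Matrix.trace_one, Fintype.card_fin,
      smul_eq_mul, mul_div_cancel_right₀ _ hd']

theorem lift_groupStar (ρ : Λ →* (H →L[ℂ] H)) (hρ : ∀ γ, ρ γ⁻¹ = star (ρ γ))
    (z : MonoidAlgebra ℂ Λ) :
    MonoidAlgebra.lift ℂ (H →L[ℂ] H) Λ ρ (groupStar z) =
      star (MonoidAlgebra.lift ℂ (H →L[ℂ] H) Λ ρ z) := by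
  induction z using MonoidAlgebra.induction_linear with
  | zero => rw [groupStar_zero, map_zero, star_zero]
  | add x y hx hy => rw [groupStar_add, map_add, hx, hy, map_add, star_add]
  | single γ a =>
    rw [groupStar_single, MonoidAlgebra.lift_single, MonoidAlgebra.lift_single, hρ, star_smul]

/-- An entry is a compression to one input and one output coordinate of `H^d`. -/
theorem norm_lift_entry_le (ρ : Λ →* (H →L[ℂ] H))
    (x : MonoidAlgebra (Matrix (Fin d) (Fin d) ℂ) Λ) (i j : Fin d) :
    ‖MonoidAlgebra.lift ℂ (H →L[ℂ] H) Λ ρ (entry i j x)‖ ≤ ‖idTensor ρ x‖ := by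
  refine ContinuousLinearMap.opNorm_le_bound _ (norm_nonneg _) fun f => ?_
  have h1 := (idTensor ρ x).le_opNorm (PiLp.single 2 j f)
  rw [PiLp.norm_single] at h1
  refine le_trans ?_ h1
  refine le_trans (le_of_eq ?_) (PiLp.norm_apply_le _ i)
  rw [idTensor_apply, Finset.sum_eq_single j]
  · simp
  · intro l _ hl
    simp [hl]
  · simp

theorem entry_scalar_self (i : Fin d) (z : MonoidAlgebra ℂ Λ) :
    entry i i (scalar Λ d z) = z := by
  induction z using MonoidAlgebra.induction_linear with
  | zero => simp [entry]
  | add x y hx hy => rw [map_add, entry_add, hx, hy]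
  | single γ a => rw [scalar_single, entry_single, Matrix.smul_apply, Matrix.one_apply_eq,
      smul_eq_mul, mul_one]

theorem norm_lift_le (ρ : Λ →* (H →L[ℂ] H)) (hd : d ≠ 0) (z : MonoidAlgebra ℂ Λ) :
    ‖MonoidAlgebra.lift ℂ (H →L[ℂ] H) Λ ρ z‖ ≤ ‖idTensor ρ (scalar Λ d z)‖ := by
  have i : Fin d := ⟨0, Nat.pos_of_ne_zero hd⟩
  have h := norm_lift_entry_le ρ (scalar Λ d z) i i
  rwa [entry_scalar_self] at h

theorem lOneNorm_scalar_entry_le (i j : Fin d)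
    (x : MonoidAlgebra (Matrix (Fin d) (Fin d) ℂ) Λ) :
    lOneNorm (scalar Λ d (entry i j x)) ≤ lOneNorm x := by
  rw [entry, Finsupp.sum, map_sum]
  refine (lOneNorm_sum_le _ _).trans (Finset.sum_le_sum fun γ _ => ?_)
  rw [scalar_single, lOneNorm_single, norm_smul]
  have : Nonempty (Fin d) := ⟨i⟩
  rw [norm_one, mul_one]
  exact norm_matrix_entry_le _ i j

theorem lOneNorm_groupStar_le (x : MonoidAlgebra (Matrix (Fin d) (Fin d) ℂ) Λ) :
    lOneNorm (groupStar x) ≤ lOneNorm x := by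
  rw [groupStar, Finsupp.sum]
  refine (lOneNorm_sum_le _ _).trans (Finset.sum_le_sum fun γ _ => ?_)
  rw [lOneNorm_single]
  exact (norm_star _).le

/-- A crude triangle inequality over the `d²` entries. The loss is harmless because it is applied to
a high power of `y`. -/
theorem norm_idTensor_apply_le (ρ : Λ →* (H →L[ℂ] H))
    (x : MonoidAlgebra (Matrix (Fin d) (Fin d) ℂ) Λ) (v : PiLp 2 fun _ : Fin d => H) :
    ‖idTensor ρ x v‖ ≤ ∑ a : Fin d × Fin d,
      ‖idTensor ρ (scalar Λ d (entry a.1 a.2 x)) v‖ := by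
  have h1 : ‖idTensor ρ x v‖ ≤ ∑ i, ‖idTensor ρ x v i‖ := by
    refine abs_le_of_sq_le_sq' ?_ (Finset.sum_nonneg fun _ _ => norm_nonneg _) |>.2
    rw [PiLp.norm_sq_eq_of_L2]
    exact Finset.sum_sq_le_sq_sum_of_nonneg fun _ _ => norm_nonneg _
  refine h1.trans ?_
  rw [Fintype.sum_prod_type]
  refine Finset.sum_le_sum fun i _ => ?_
  rw [idTensor_apply]
  refine norm_sum_le_of_le _ fun j _ => ?_
  refine le_trans (le_of_eq ?_) (PiLp.norm_apply_le _ j)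
  rw [idTensor_scalar, matTensor_apply, Finset.sum_eq_single j]
  · simp
  · intro l _ hl
    simp [hl.symm]
  · simp

/-- Expresses smallness of `(1 ⊗ z)v` as smallness of the quadratic form of `1 ⊗ z^* z`, a
self-adjoint scalar element to which temperedness applies. -/
theorem norm_sq_idTensor_scalar (ρ : Λ →* (H →L[ℂ] H)) (hρ : ∀ γ, ρ γ⁻¹ = star (ρ γ))
    (z : MonoidAlgebra ℂ Λ) (v : PiLp 2 fun _ : Fin d => H) :
    ‖idTensor ρ (scalar Λ d z) v‖ ^ 2 =
      (inner ℂ v (idTensor ρ (scalar Λ d (groupStar z * z)) v)).re := by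
  rw [idTensor_scalar, idTensor_scalar, map_mul, lift_groupStar ρ hρ, norm_sq_matTensor_one_left,
    PiLp.inner_apply, Complex.re_sum]
  refine Finset.sum_congr rfl fun i _ => ?_
  rw [matTensor_apply, Finset.sum_eq_single i]
  · rw [Matrix.one_apply_eq, one_smul, mul_apply_eq_comp,
      ContinuousLinearMap.star_eq_adjoint, ContinuousLinearMap.adjoint_inner_right,
      inner_self_eq_norm_sq_to_K]
    norm_cast
  · intro l _ hl
    simp [hl.symm]
  · simp

theorem norm_idTensor_scalar_star_mul_le (ρ : Λ →* (H →L[ℂ] H)) (hρ : ∀ γ, ρ γ⁻¹ = star (ρ γ))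
    (x : MonoidAlgebra (Matrix (Fin d) (Fin d) ℂ) Λ) (i j : Fin d) :
    ‖idTensor ρ (scalar Λ d (groupStar (entry i j x) * entry i j x))‖ ≤ ‖idTensor ρ x‖ ^ 2 := by
  rw [idTensor_scalar, map_mul, lift_groupStar ρ hρ]
  refine (norm_matTensor_one_left_le _).trans ?_
  rw [CStarRing.norm_star_mul_self, ← sq]
  gcongr
  exact norm_lift_entry_le ρ x i j

end Scalar

/-! ### The expected number of outlying eigenvalues tends to zero -/

section Tempered

open Polynomial
open scoped Matrix.Norms.L2Operator

variable {Λ : Type*} [Group Λ] {d : ℕ} {S : Finset Λ} {Ω : ℕ → Type*}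
  [∀ n, MeasurableSpace (Ω n)] {P : ∀ n, Measure (Ω n)} [∀ n, IsProbabilityMeasure (P n)]
  {π : ∀ n, Ω n → (Λ →* Matrix.unitaryGroup (Fin n) ℂ)} {u : ℕ → Λ → ℝ}

/-- A limsup of `p`-th roots strictly below `s'` gives an eventual bound by `s' ^ p`, the moment
hypothesis of `tendsto_sum_cutoff_of_moments`. -/
theorem Tempered.eventually_le {v : Λ → ℝ} (hv : Tempered v) (hd : d ≠ 0) {z : MonoidAlgebra ℂ Λ}
    (hz : groupStar z = z) {s' : ℝ} (hs : ‖idTensor (leftRegular Λ) (scalar Λ d z)‖ < s') :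
    ∀ᶠ p : ℕ in atTop, |coefPoly v (scalar Λ d z) (X ^ p)| ≤ s' ^ p := by
  have hs' : 0 ≤ s' := (norm_nonneg _).trans hs.le
  have hlt : limsup (fun p : ℕ => ‖extendLinear v (z ^ p)‖ₑ ^ (1 / (p : ℝ))) atTop <
      ENNReal.ofReal s' := by
    refine (hv z hz).trans_lt ?_
    rw [← ofReal_norm]
    exact (ENNReal.ofReal_lt_ofReal_iff_of_nonneg (norm_nonneg _)).mpr
      ((norm_lift_le (leftRegular Λ) hd z).trans_lt hs)
  filter_upwards [eventually_lt_of_limsup_lt hlt, eventually_ge_atTop 1] with p hp hp1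
  have hp0 : (0 : ℝ) < p := by exact_mod_cast hp1
  rw [coefPoly, map_pow, aeval_X, ← map_pow, coefTrace_scalar hd]
  refine (Complex.abs_re_le_norm _).trans ?_
  have h := ENNReal.rpow_le_rpow hp.le hp0.le
  rw [← ENNReal.rpow_mul, one_div_mul_cancel hp0.ne', ENNReal.rpow_one, ENNReal.rpow_natCast,
    ← ENNReal.ofReal_pow hs', ← ofReal_norm] at h
  exact (ENNReal.ofReal_le_ofReal_iff (pow_nonneg hs' p)).mp h

theorem norm_clm_pow_le {E : Type*} [NormedAddCommGroup E] [NormedSpace ℂ E] (A : E →L[ℂ] E)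
    (k : ℕ) : ‖A ^ k‖ ≤ ‖A‖ ^ k := by
  induction k with
  | zero => rw [pow_zero, pow_zero]; exact ContinuousLinearMap.norm_id_le
  | succ k ih =>
    rw [pow_succ, pow_succ]
    exact (norm_mul_le _ _).trans (mul_le_mul_of_nonneg_right ih (norm_nonneg _))

theorem norm_idTensor_pow_le {H : Type*} [NormedAddCommGroup H] [InnerProductSpace ℂ H]
    [CompleteSpace H] (ρ : Λ →* (H →L[ℂ] H))
    (y : MonoidAlgebra (Matrix (Fin d) (Fin d) ℂ) Λ) (k : ℕ) :
    ‖idTensor ρ (y ^ k)‖ ≤ ‖idTensor ρ y‖ ^ k := by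
  have h : idTensor ρ (y ^ k) = idTensor ρ y ^ k := by
    rw [← idTensorHom_apply, ← idTensorHom_apply, map_pow]
  exact (congrArg norm h).trans_le (norm_clm_pow_le _ k)

theorem coefPoly_zero (v : Λ → ℝ) (y : MonoidAlgebra (Matrix (Fin d) (Fin d) ℂ) Λ) :
    coefPoly v y 0 = 0 := by
  simp [coefPoly]

theorem sum_cutoff_le_card {m : ℕ} (t : Fin m → ℝ) {a μ c : ℝ} (hμ : 0 ≤ μ)
    (hca : c ^ 2 ≤ a) :
    ∑ i, cutoff a μ (t i) ≤ (Finset.univ.filter fun i => c ≤ |t i|).card := by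
  rw [Finset.card_filter]
  push_cast
  refine Finset.sum_le_sum fun i _ => ?_
  split_ifs with h
  · exact cutoff_le_one _ _ _
  · refine (cutoff_eq_zero hμ ?_).le
    rw [← sq_abs]
    exact (pow_le_pow_left₀ (abs_nonneg _) (not_le.mp h).le 2).trans hca

theorem card_le_sum_cutoff {m : ℕ} (t : Fin m → ℝ) {a μ c : ℝ} (hμ : 0 < μ) (hc : 0 ≤ c)
    (hca : a + 1 / μ ≤ c ^ 2) :
    ((Finset.univ.filter fun i => c ≤ |t i|).card : ℝ) ≤ ∑ i, cutoff a μ (t i) := by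
  rw [Finset.card_filter]
  push_cast
  refine Finset.sum_le_sum fun i _ => ?_
  split_ifs with h
  · refine (cutoff_eq_one hμ (hca.trans ?_)).ge
    rw [← sq_abs (t i)]
    exact pow_le_pow_left₀ hc h 2
  · exact cutoff_nonneg _ _ _

/-- The number of eigenvalues of `[id ⊗ ρ](y)` outside `(-c, c)` is controlled by the large
eigenvalues of the scalar elements `1 ⊗ w_{ij}^* w_{ij}`, where `w = y ^ k`. -/
theorem card_modelEigs_le {y : MonoidAlgebra (Matrix (Fin d) (Fin d) ℂ) Λ} (hy : groupStar y = y)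
    {c s : ℝ} (hc : 0 ≤ c) (hs : 0 ≤ s) {k : ℕ} (hk : d ^ 2 * s ^ k < c ^ k) (n : ℕ) (ω : Ω n) :
    (Finset.univ.filter fun i => c ≤ |modelEigs π y n ω i|).card ≤
      ∑ a : Fin d × Fin d, (Finset.univ.filter fun i => (s ^ k) ^ 2 ≤ |modelEigs π (scalar Λ d
        (groupStar (entry a.1 a.2 (y ^ k)) * entry a.1 a.2 (y ^ k))) n ω i|).card := by
  refine card_eigs_le (isSymmetric_model hy (π n ω)) (fun a => isSymmetric_model ?_ (π n ω))
    finrank_power (k := k) hc (c' := fun _ => (s ^ k) ^ 2) fun v hv h => ?_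
  · rw [groupStar_scalar, groupStar_mul, groupStar_groupStar]
  · have hpow : idTensor (unitaryRep (π n ω)) y ^ k = idTensor (unitaryRep (π n ω)) (y ^ k) := by
      rw [← idTensorHom_apply, ← idTensorHom_apply, map_pow]
    rw [hpow]
    refine (norm_idTensor_apply_le _ _ _).trans_lt ?_
    have hterm : ∀ a : Fin d × Fin d, ‖idTensor (unitaryRep (π n ω))
        (scalar Λ d (entry a.1 a.2 (y ^ k))) v‖ ≤ s ^ k * ‖v‖ := by
      intro a
      have h1 := norm_sq_idTensor_scalar (unitaryRep (π n ω)) (unitaryRep_inv _)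
        (entry a.1 a.2 (y ^ k)) v
      have h2 := h1.le.trans (h a)
      rw [← mul_pow] at h2
      exact le_of_sq_le_sq h2 (by positivity)
    refine (Finset.sum_le_sum fun a _ => hterm a).trans_lt ?_
    have hv0 : 0 < ‖v‖ := norm_pos_iff.mpr hv
    calc ∑ _a : Fin d × Fin d, s ^ k * ‖v‖ = d ^ 2 * s ^ k * ‖v‖ := by
          simp; ring
      _ < c ^ k * ‖v‖ := by gcongr

variable (hmeas : ∀ (n : ℕ) (γ : Λ) (i j : Fin n),
    Measurable fun ω => (π n ω γ : Matrix (Fin n) (Fin n) ℂ) i j)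

include hmeas

/-- Temperedness concerns scalar elements only, so it is used for `z_ij = w_ij^* w_ij` with `w =
y^k`. Few large eigenvalues of these force few large eigenvalues of `X_n`. The expansion constants
of the `z_ij` depend on `k`, which does not matter for a limit. -/
theorem tendsto_sum_cutoff (hS : Subgroup.closure (S : Set Λ) = ⊤) {C : ℝ} (hC : 1 ≤ C)
    (hE : EffectiveExpansion S P π C u) (hT : Tempered (u 1))
    {y : MonoidAlgebra (Matrix (Fin d) (Fin d) ℂ) Λ} (hy : groupStar y = y) (hd : d ≠ 0)
    (hy1 : lOneNorm y ≤ 1) {a μ : ℝ} (hμ : 0 ≤ μ) (ha : ‖idTensor (leftRegular Λ) y‖ ^ 2 < a) :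
    Tendsto (fun n : ℕ => ∫ ω, ∑ i, cutoff a μ (modelEigs π y n ω i) ∂(P n)) atTop (nhds 0) := by
  set s := ‖idTensor (leftRegular Λ) y‖ with hs
  have hs0 : 0 ≤ s := norm_nonneg _
  have ha0 : 0 < a := (sq_nonneg s).trans_lt ha
  obtain ⟨s₁, hs₁, hs₁'⟩ := exists_between (Real.lt_sqrt_of_sq_lt ha)
  have hs₁0 : 0 < s₁ := hs0.trans_lt hs₁
  set c := Real.sqrt a with hc
  have hc0 : 0 < c := hs₁0.trans hs₁'
  -- The gap between `s₁` and `c`, raised to a high power, beats the loss `d²`; `k ≠ 0` keeps `s ^ k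
  -- < s₁ ^ k` strict.
  obtain ⟨k, hk, hk1⟩ : ∃ k : ℕ, (d : ℝ) ^ 2 * s₁ ^ k < c ^ k ∧ k ≠ 0 := by
    have h1 := (tendsto_pow_atTop_nhds_zero_of_lt_one (r := s₁ / c) (by positivity)
      ((div_lt_one hc0).mpr hs₁')).const_mul ((d : ℝ) ^ 2)
    rw [mul_zero] at h1
    obtain ⟨k, hk, hk1⟩ :=
      ((h1.eventually (gt_mem_nhds one_pos)).and (eventually_ne_atTop 0)).exists
    refine ⟨k, ?_, hk1⟩
    rwa [div_pow, mul_div_assoc', div_lt_one (by positivity)] at hk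
  obtain ⟨κ, hκ⟩ := exists_nat_ge C
  set z : Fin d × Fin d → MonoidAlgebra ℂ Λ := fun e =>
    groupStar (entry e.1 e.2 (y ^ k)) * entry e.1 e.2 (y ^ k) with hz
  have hzstar : ∀ e, groupStar (z e) = z e := fun e => by
    rw [hz]; simp only [groupStar_mul, groupStar_groupStar]
  have hZstar : ∀ e, groupStar (scalar Λ d (z e)) = scalar Λ d (z e) := fun e => by
    rw [groupStar_scalar, hzstar]
  have hZ1 : ∀ e, lOneNorm (scalar Λ d (z e)) ≤ 1 := fun e => by
    have h1 := (lOneNorm_scalar_entry_le e.1 e.2 (y ^ k)).trans (lOneNorm_pow_le hy1 k)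
    rw [hz]
    simp only
    rw [map_mul, ← groupStar_scalar]
    exact (lOneNorm_mul_le _ _).trans (mul_le_one₀ ((lOneNorm_groupStar_le _).trans h1)
      (lOneNorm_nonneg _) h1)
  have hZnorm : ∀ e, ‖idTensor (leftRegular Λ) (scalar Λ d (z e))‖ ≤ (s ^ k) ^ 2 := fun e => by
    refine (norm_idTensor_scalar_star_mul_le _ leftRegular_inv _ _ _).trans ?_
    exact pow_le_pow_left₀ (norm_nonneg _) (norm_idTensor_pow_le _ _ _) 2
  have hZlt : ∀ e, ‖idTensor (leftRegular Λ) (scalar Λ d (z e))‖ < (s₁ ^ k) ^ 2 := fun e =>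
    (hZnorm e).trans_lt (pow_lt_pow_left₀ (pow_lt_pow_left₀ hs₁ hs0 hk1) (by positivity)
      two_ne_zero)
  have hZle1 : ∀ e, ‖idTensor (leftRegular Λ) (scalar Λ d (z e))‖ ≤ 1 := fun e =>
    (norm_idTensor_le_lOneNorm _ norm_leftRegular_le _).trans (hZ1 e)
  -- The cutoff must vanish up to the norm of `z e` and equal `1` from `s₁^{2k}` on. Levels are
  -- compared after squaring, since `cutoff` is a function of `t²`.
  have hcut : ∀ e, ∃ a' μ' : ℝ, 0 < μ' ∧ a' + 1 / μ' ≤ ((s₁ ^ k) ^ 2) ^ 2 ∧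
      ‖idTensor (leftRegular Λ) (scalar Λ d (z e))‖ ^ 2 < a' := fun e => by
    obtain ⟨a', h1, h2⟩ := exists_between
      (pow_lt_pow_left₀ (hZlt e) (norm_nonneg _) two_ne_zero)
    exact ⟨a', 1 / (((s₁ ^ k) ^ 2) ^ 2 - a'), one_div_pos.mpr (sub_pos.mpr h2),
      by rw [one_div_one_div]; linarith, h1⟩
  choose a' μ' hμ' ha' haZ using hcut
  have hdata := fun e => expansionData hmeas hS hC hE hκ (hZstar e) hd (hZ1 e) le_rfl
  have hZlim : Tendsto (fun n : ℕ => ∑ e, ∫ ω, ∑ i, cutoff (a' e) (μ' e)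
      (modelEigs π (scalar Λ d (z e)) n ω i) ∂(P n)) atTop (nhds 0) := by
    rw [← Finset.sum_const_zero (s := (Finset.univ : Finset (Fin d × Fin d)))]
    exact tendsto_finsetSum _ fun e _ => (hdata e).tendsto_sum_cutoff_of_moments
      (coefPoly_zero _ _) (hZle1 e) (fun s' hs' => hT.eventually_le hd (hzstar e) hs')
      (hμ' e).le (haZ e)
  have hint : ∀ {w : MonoidAlgebra (Matrix (Fin d) (Fin d) ℂ) Λ}, groupStar w = w →
      lOneNorm w ≤ 1 → ∀ {α ν : ℝ}, 0 ≤ ν → ∀ n,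
      Integrable (fun ω => ∑ i, cutoff α ν (modelEigs π w n ω i)) (P n) := by
    intro w hw hw1 α ν hν n
    obtain ⟨_, -, h⟩ := exists_chebyshevSeries_cutoff (3 * κ + 10)
    obtain ⟨_, hb⟩ := h α ν hν
    exact (expansionData hmeas hS hC hE hκ hw hd hw1 le_rfl).integrable_sum hb n
  refine squeeze_zero (fun n => integral_nonneg fun ω => Finset.sum_nonneg fun i _ =>
    cutoff_nonneg _ _ _) (fun n => ?_) hZlim
  rw [← integral_finsetSum _ fun e _ => hint (hZstar e) (hZ1 e) (hμ' e).le n]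
  refine integral_mono (hint hy hy1 hμ n)
    (integrable_finsetSum _ fun e _ => hint (hZstar e) (hZ1 e) (hμ' e).le n) fun ω => ?_
  refine (sum_cutoff_le_card _ hμ (Real.sq_sqrt ha0.le).le).trans ?_
  refine (Nat.cast_le.mpr (card_modelEigs_le hy hc0.le hs₁0.le hk n ω)).trans ?_
  push_cast
  exact Finset.sum_le_sum fun e _ => card_le_sum_cutoff _ (hμ' e) (by positivity) (ha' e)

end Tempered

/-! ### Normalisation and the tail bound -/

section Final

open scoped Matrix.Norms.L2Operator

variable {Λ : Type*} [Group Λ] {d : ℕ}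

theorem norm_idTensor_smul {H : Type*} [NormedAddCommGroup H] [InnerProductSpace ℂ H]
    [CompleteSpace H] (ρ : Λ →* (H →L[ℂ] H)) (c : ℝ)
    (x : MonoidAlgebra (Matrix (Fin d) (Fin d) ℂ) Λ) :
    ‖idTensor ρ (c • x)‖ = |c| * ‖idTensor ρ x‖ := by
  have h : idTensor ρ (c • x) = (c : ℂ) • idTensor ρ x := by
    rw [← idTensorHom_apply, ← idTensorHom_apply, ← Complex.coe_smul, map_smul]
  rw [h]
  refine (norm_smul _ _).trans ?_
  rw [Complex.norm_real, Real.norm_eq_abs]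

theorem leftRegular_deltaOne (γ η : Λ) [Decidable (γ = η)] :
    (leftRegular Λ γ (deltaOne Λ) : Λ → ℂ) η = if γ = η then 1 else 0 := by
  classical
  change (deltaOne Λ : Λ → ℂ) (γ⁻¹ * η) = _
  by_cases h : γ = η
  · subst h
    rw [inv_mul_cancel, if_pos rfl, deltaOne]
    exact lp.single_apply_self ..
  · rw [if_neg h, deltaOne]
    refine lp.single_apply_ne _ _ _ ?_
    rwa [ne_eq, inv_mul_eq_one]

theorem idTensor_leftRegular_apply (x : MonoidAlgebra (Matrix (Fin d) (Fin d) ℂ) Λ)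
    (v : Fin d → ℂ) (i : Fin d) (γ : Λ) :
    (idTensor (leftRegular Λ) x (WithLp.toLp 2 fun j => v j • deltaOne Λ) i : Λ → ℂ) γ =
      (x.coeff γ).mulVec v i := by
  classical
  induction x using MonoidAlgebra.induction_linear with
  | zero => simp [idTensor]
  | add x y hx hy =>
    rw [MonoidAlgebra.coeff_add, Finsupp.add_apply, Matrix.add_mulVec, Pi.add_apply, ← hx, ← hy,
      ← idTensorHom_apply, map_add, idTensorHom_apply, idTensorHom_apply]
    rfl
  | single η A =>
    rw [idTensor_single, matTensor_apply, Matrix.mulVec, dotProduct, lp.coeFn_sum,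
      Finset.sum_apply]
    refine Finset.sum_congr rfl fun j _ => ?_
    rw [map_smul, lp.coeFn_smul, lp.coeFn_smul, Pi.smul_apply, Pi.smul_apply,
      leftRegular_deltaOne, MonoidAlgebra.coeff_single, Finsupp.single_apply]
    split_ifs <;> simp

/-- Applying `[id ⊗ λ](x)` to `v ⊗ δ_e` and reading the result at `γ` gives `A_γ v`. -/
theorem norm_coeff_le (x : MonoidAlgebra (Matrix (Fin d) (Fin d) ℂ) Λ) (γ : Λ) :
    ‖x.coeff γ‖ ≤ ‖idTensor (leftRegular Λ) x‖ := by
  rw [Matrix.l2_opNorm_def]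
  refine ContinuousLinearMap.opNorm_le_bound _ (norm_nonneg _) fun v => ?_
  have h := (idTensor (leftRegular Λ) x).le_opNorm (WithLp.toLp 2 fun j => v j • deltaOne Λ)
  have hv : ‖(WithLp.toLp 2 fun j => v j • deltaOne Λ : PiLp 2 fun _ : Fin d => Ell2 Λ)‖ = ‖v‖ := by
    rw [PiLp.norm_eq_of_L2, EuclideanSpace.norm_eq]
    congr 1
    refine Finset.sum_congr rfl fun j _ => ?_
    simp only
    rw [norm_smul, norm_deltaOne, mul_one]
  rw [hv] at h
  refine le_trans ?_ h
  rw [EuclideanSpace.norm_eq, PiLp.norm_eq_of_L2]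
  refine Real.sqrt_le_sqrt (Finset.sum_le_sum fun i _ => ?_)
  refine pow_le_pow_left₀ (norm_nonneg _) ?_ 2
  refine le_trans (le_of_eq ?_) (lp.norm_apply_le_norm two_ne_zero _ γ)
  rw [idTensor_leftRegular_apply]
  rfl

theorem lOneNorm_le_card_mul {S : Finset Λ} (hS : Subgroup.closure (S : Set Λ) = ⊤)
    (x : MonoidAlgebra (Matrix (Fin d) (Fin d) ℂ) Λ) :
    lOneNorm x ≤ (2 * S.card + 1 : ℝ) ^ supportLength S x * ‖idTensor (leftRegular Λ) x‖ := by
  refine (Finset.sum_le_card_nsmul _ _ _ fun γ _ => norm_coeff_le x γ).trans ?_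
  rw [nsmul_eq_mul]
  gcongr
  exact_mod_cast card_le_of_wordLength_le hS (supportLength_le_iff.mp (le_refl (supportLength S x)))

theorem norm_idTensor_leftRegular_pos {x : MonoidAlgebra (Matrix (Fin d) (Fin d) ℂ) Λ}
    (hx : x ≠ 0) : 0 < ‖idTensor (leftRegular Λ) x‖ := by
  refine lt_of_le_of_ne (norm_nonneg _) fun h => hx ?_
  ext γ : 2
  have := norm_coeff_le x γ
  rw [← h] at this
  rw [norm_le_zero_iff.mp this]
  rfl

/-- If the norm is at least `c`, some eigenvalue lies where the cutoff equals `1`, so the sum of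
cutoffs is at least `1`; Markov's inequality and the bound `O(d / n)` on its expectation finish. -/
theorem measure_norm_ge_le {S : Finset Λ} {Ω : ℕ → Type*} [∀ n, MeasurableSpace (Ω n)]
    {P : ∀ n, Measure (Ω n)} [∀ n, IsProbabilityMeasure (P n)]
    {π : ∀ n, Ω n → (Λ →* Matrix.unitaryGroup (Fin n) ℂ)} {u : ℕ → Λ → ℝ}
    (hmeas : ∀ (n : ℕ) (γ : Λ) (i j : Fin n),
      Measurable fun ω => (π n ω γ : Matrix (Fin n) (Fin n) ℂ) i j)
    (hS : Subgroup.closure (S : Set Λ) = ⊤) {C : ℝ} (hC : 1 ≤ C)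
    (hE : EffectiveExpansion S P π C u) (hT : Tempered (u 1)) {κ : ℕ} (hκ : C ≤ κ) {Dc : ℝ}
    (hcut : ∀ a μ : ℝ, 0 ≤ μ → ∃ b : ℤ → ℝ, ChebyshevSeries (3 * κ + 10) b (cutoff a μ)
      (Dc * (1 + μ) ^ (3 * κ + 10 + 2)))
    {y : MonoidAlgebra (Matrix (Fin d) (Fin d) ℂ) Λ} (hy : groupStar y = y) (hd : d ≠ 0)
    (hy1 : lOneNorm y ≤ 1) {L : ℕ} (hL : supportLength S y ≤ L) {a μ c : ℝ} (hμ : 0 < μ)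
    (hc : 0 < c) (ha : ‖idTensor (leftRegular Λ) y‖ ^ 2 < a) (hac : a + 1 / μ ≤ c ^ 2) {n : ℕ}
    (hn : 1 ≤ n) :
    (P n).real {ω | c ≤ ‖idTensor (unitaryRep (π n ω)) y‖} ≤
      d * (65 * (3 * (κ : ℝ) ^ κ + 8) ^ 3 * ((L : ℝ) + 3) ^ (3 * κ + 10) *
        (Dc * (1 + μ) ^ (3 * κ + 10 + 2))) / n := by
  have hdata := expansionData hmeas hS hC hE hκ hy hd hy1 hL
  obtain ⟨b, hb⟩ := hcut a μ hμ.le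
  have h1 := hdata.integral_sum_cutoff_le (coefPoly_zero _ _)
    ((norm_idTensor_le_lOneNorm _ norm_leftRegular_le _).trans hy1) hμ.le ha.le hb
    (tendsto_sum_cutoff hmeas hS hC hE hT hy hd hy1 hμ.le ha) hn
  refine le_trans ?_ h1
  have h2 := mul_meas_ge_le_integral_of_nonneg (μ := P n)
    (ae_of_all _ fun ω => Finset.sum_nonneg fun i _ => cutoff_nonneg a μ (modelEigs π y n ω i))
    (hdata.integrable_sum hb n) 1
  rw [one_mul] at h2
  refine le_trans (measureReal_mono fun ω hω => ?_) h2
  obtain ⟨i, hi⟩ := exists_le_abs_eigs (isSymmetric_model hy (π n ω)) finrank_power hc hω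
  refine le_trans (le_of_eq ?_) (Finset.single_le_sum
    (fun i _ => cutoff_nonneg a μ (modelEigs π y n ω i)) (Finset.mem_univ i))
  refine (cutoff_eq_one hμ (hac.trans ?_)).symm
  rw [← sq_abs (modelEigs π y n ω i)]
  exact pow_le_pow_left₀ hc.le hi 2

end Final

end StrongConv

/-! ### Choice of constants -/

theorem theorem3p4 (C : ℝ) (hC : 1 ≤ C) :
    ∃ b : ℝ, 0 < b ∧ ∀ r L : ℕ, ∃ c : ℝ, 0 < c ∧
      ∀ (Λ : Type*) [Group Λ] (S : Finset Λ),
        Subgroup.closure (S : Set Λ) = ⊤ → S.card = r →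
      ∀ (Ω : ℕ → Type*) [∀ n, MeasurableSpace (Ω n)] (P : ∀ n, MeasureTheory.Measure (Ω n))
        [∀ n, MeasureTheory.IsProbabilityMeasure (P n)]
        (π : ∀ n, Ω n → (Λ →* Matrix.unitaryGroup (Fin n) ℂ)),
        (∀ (n : ℕ) (γ : Λ) (i j : Fin n),
          Measurable fun ω => (π n ω γ : Matrix (Fin n) (Fin n) ℂ) i j) →
      ∀ u : ℕ → Λ → ℝ,
        StrongConv.EffectiveExpansion S P π C u → StrongConv.Tempered (u 1) →
      ∀ (d : ℕ) (x : MonoidAlgebra (Matrix (Fin d) (Fin d) ℂ) Λ),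
        StrongConv.groupStar x = x → x ≠ 0 → StrongConv.supportLength S x = L →
      ∀ (n : ℕ) (ε : ℝ), 1 ≤ n → 0 < ε →
        (P n).real {ω | (1 + ε) * ‖StrongConv.idTensor (StrongConv.leftRegular Λ) x‖ ≤
            ‖StrongConv.idTensor (StrongConv.unitaryRep (π n ω)) x‖} ≤
          c * d / (n * ε ^ b) := by
  open StrongConv in
  obtain ⟨κ, hκ⟩ := exists_nat_ge C
  obtain ⟨Dc, hDc, hcut⟩ := exists_chebyshevSeries_cutoff (3 * κ + 10)
  -- `3κ + 10` is the growth exponent of the expansion in the Chebyshev degree, and `2` counts the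
  -- extra derivatives making the Chebyshev series converge. `M` below bounds the size of the ball
  -- of radius `L`.
  refine ⟨((3 * κ + 10 + 2 : ℕ) : ℝ), by positivity, fun r L => ?_⟩
  set M : ℝ := (2 * (r : ℝ) + 1) ^ L with hM
  have hM1 : 1 ≤ M := one_le_pow₀ (by linarith [Nat.cast_nonneg (α := ℝ) r])
  have hM0 : 0 < M := one_pos.trans_le hM1
  set D : ℝ := 65 * (3 * (κ : ℝ) ^ κ + 8) ^ 3 * ((L : ℝ) + 3) ^ (3 * κ + 10) with hD
  have hD0 : 0 ≤ D := by positivity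
  -- The `+ 1` only makes the constant positive.
  refine ⟨D * Dc * (2 * M ^ 2) ^ (3 * κ + 10 + 2) + 1, by positivity, ?_⟩
  intro Λ _ S hS hr Ω _ P _ π hmeas u hE hT d x hx hx0 hL n ε hn hε
  have hd : d ≠ 0 := by
    rintro rfl
    exact hx0 (by ext γ : 2; exact Subsingleton.elim _ _)
  have hρ := norm_idTensor_leftRegular_pos hx0
  set ρ := ‖idTensor (leftRegular Λ) x‖ with hρdef
  have hMρ : 0 < M * ρ := mul_pos hM0 hρ
  set y := (M * ρ)⁻¹ • x with hy
  have hystar : groupStar y = y := by rw [hy, groupStar_smul, hx]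
  have hinv : |(M * ρ)⁻¹| = (M * ρ)⁻¹ := abs_of_pos (inv_pos.mpr hMρ)
  have hy1 : lOneNorm y ≤ 1 := by
    rw [hy, lOneNorm_smul, hinv, inv_mul_le_one₀ hMρ]
    have h := lOneNorm_le_card_mul hS x
    rwa [hr, hL] at h
  have hys : ‖idTensor (leftRegular Λ) y‖ = 1 / M := by
    rw [hy, norm_idTensor_smul, hinv, ← hρdef]
    field_simp
  have hevent : {ω | (1 + ε) * ρ ≤ ‖idTensor (unitaryRep (π n ω)) x‖} ⊆
      {ω | (1 + ε) / M ≤ ‖idTensor (unitaryRep (π n ω)) y‖} := by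
    intro ω hω
    simp only [Set.mem_ofPred_eq] at hω ⊢
    rw [hy, norm_idTensor_smul, hinv]
    calc (1 + ε) / M = (M * ρ)⁻¹ * ((1 + ε) * ρ) := by field_simp
      _ ≤ _ := by gcongr
  refine (measureReal_mono hevent).trans ?_
  have hn0 : (0 : ℝ) < n := by exact_mod_cast hn
  rw [Real.rpow_natCast]
  -- For large `ε` the threshold exceeds the `ℓ¹` norm and the event is empty. Otherwise `ε ≤ M²`,
  -- which allows `1 + M²/ε ≤ 2M²/ε`.
  by_cases hεM : M < 1 + ε
  · have hempty : {ω | (1 + ε) / M ≤ ‖idTensor (unitaryRep (π n ω)) y‖} = ∅ := by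
      ext ω
      simp only [Set.mem_ofPred_eq, Set.mem_empty_iff_false, iff_false, not_le]
      refine ((norm_idTensor_le_lOneNorm _ (norm_unitaryRep_le _) _).trans hy1).trans_lt ?_
      rwa [one_lt_div hM0]
    rw [hempty, measureReal_empty]
    positivity
  · have hM2 : 0 < M ^ 2 := by positivity
    -- In units of `1/M²`, the squared norm is `1`, the cutoff rises from `1 + ε` to `1 + 2ε`, and
    -- the squared threshold is `(1 + ε)² ≥ 1 + 2ε`.
    refine (measure_norm_ge_le hmeas hS hC hE hT hκ hcut hystar hd hy1 (L := L)
      ((supportLength_smul_le _ _).trans hL.le) (a := (1 + ε) / M ^ 2) (μ := M ^ 2 / ε)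
      (div_pos hM2 hε) (div_pos (by linarith) hM0) ?_ ?_ hn).trans ?_
    · rw [hys, div_pow, one_pow]
      gcongr
      linarith
    · rw [one_div_div, ← add_div, div_pow]
      gcongr
      nlinarith
    · have hμ : 1 + M ^ 2 / ε ≤ 2 * M ^ 2 / ε := by
        rw [le_div_iff₀ hε, add_mul, div_mul_cancel₀ _ hε.ne']
        nlinarith
      have hμp : (1 + M ^ 2 / ε) ^ (3 * κ + 10 + 2) ≤
          (2 * M ^ 2) ^ (3 * κ + 10 + 2) / ε ^ (3 * κ + 10 + 2) := by
        rw [← div_pow]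
        exact pow_le_pow_left₀ (by positivity) hμ _
      rw [← hD]
      calc d * (D * (Dc * (1 + M ^ 2 / ε) ^ (3 * κ + 10 + 2))) / n
          ≤ d * (D * (Dc * ((2 * M ^ 2) ^ (3 * κ + 10 + 2) / ε ^ (3 * κ + 10 + 2)))) / n := by
            gcongr
        _ = (D * Dc * (2 * M ^ 2) ^ (3 * κ + 10 + 2)) * d / (n * ε ^ (3 * κ + 10 + 2)) := by
            field_simp
        _ ≤ _ := by
            gcongr
            linarith
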